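/- **Setting and definitions.** Let $\mathcal Q$ be the universal UHF algebra and $\tau_{\mathcal Q}$ its unique tracial state. Let $B$ be a unital C*-algebra with a recursive subhomogeneous decomposition $[B_l,X_l,\Omega_l,r_l,\phi_l]_{l=1}^R$ over compact metrizable spaces: $\Omega_l\subset X_l$ is closed, $r_l\ge 1$, $\Omega_1=\emptyset$, $B_1=C(X_1,M_{r_1})$, $B_R=B$, and $B_{l+1}$ is the pullback of $B_l$ and $C(X_{l+1},M_{r_{l+1}})$ over $C(\Omega_{l+1},M_{r_{l+1}})$ along a unital $^*$-homomorphism $\phi_l$ and the restriction map. Let $\mathcal F\subset B$ be a finite set of positive elements of norm at most $1$, and let $\eta>0$. *Excisors.* A (compatible) weighted $(\mathcal F,\eta)$-excisor $(E,\rho,\sigma,\kappa)$ consists of a finite dimensional C*-algebra $E=\bigoplus_{l=1}^R E_l$, unital $^*$-homomorphisms $\rho=\bigoplus_l\rho_l:B\to E$ and $\kappa:E\to\mathcal Q$, and an isometric completely positive order zero map $\sigma:E\to B\otimes\mathcal Q$ with $\|\sigma(1_E)(b\otimes 1)-\sigma\rho(b)\|<\eta$ for $b\in\mathcal F$, such that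 each $\rho_l$ factors through $B\to C(K_l,M_{r_l})$ for some compact $K_l\subset X_l\setminus\Omega_l$. Excisors $(E_l,\rho_l,\sigma_l,\kappa_l)$ are pairwise orthogonal if there are pairwise orthogonal projections $q_l\in\mathcal Q$ with $\sigma_l(E_l)\subset B\otimes q_l\mathcal Qq_l$. *Bridges.* $(E,\rho,\sigma,\kappa)\sim_{(\mathcal F,\eta)}(E',\rho',\sigma',\kappa')$ means that there is a finite chain, with at least one step, of compatible weighted $(\mathcal F,\eta)$-excisors from the first to the second such that for consecutive members $\|\kappa_j\rho_j(b)-\kappa_{j+1}\rho_{j+1}(b)\|<\eta$ for all $b\in\mathcal F$. *Points.* For $x\in X_l$ write the evaluation $\mathrm{ev}_x:B\to M_{r_l}$ as a surjection $\pi_x:B\to E_x$ followed by an embedding $E_x\hookrightarrow M_{r_l}$, and let $\kappa_x:E_x\to\mathcal Q$ be this embedding followed by some unital embedding $M_{r_l}\to\mathcal Q$. The decomposition is $(\mathcal F,\eta)$-connected if for all $l$ and $x,y\in X_l$ any two weighted $(\mathcal F,\eta)$-excisors $(E_x,\pi_x,\sigma_x,\kappa_x)$ and $(E_y,\pi_y,\sigma_y,\kappa_y)$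 satisfy $(E_x,\pi_x,\sigma_x,\kappa_x)\sim_{(\mathcal F,\eta)}(E_y,\pi_y,\sigma_y,\kappa_y)$. Projections can be lifted along the decomposition if for all $N$ and $1\le l<R$ every projection in $B_l\otimes M_N$ lifts to a projection in $B_{l+1}\otimes M_N$. *Weights.* For a tracial state $\tau$ on $B$ choose strictly positive $0\le h_l\le1$ in $C_0(X_l\setminus\Omega_l)$ and put $\tau_R=\tau$, $\bar\tau_l(b)=\lim_n\tau_l((h_l^{1/n}\otimes1)b)$ for $b\in B_l$, $\tau_{l-1}(b)=\tau_l(\hat b)-\bar\tau_l(\hat b)$ for any lift $\hat b\in B_l$ of $b\in B_{l-1}$, and $\tau_0=0$. The weights of $\tau$ are $y^\tau_l=\tau_l(1_{B_l})-\tau_{l-1}(1_{B_{l-1}})$. **Proposition.** Suppose that the decomposition is $(\mathcal F,\eta)$-connected, that projections can be lifted along it, and that $X_l\setminus\Omega_l\neq\emptyset$ for all $l$. Let $\tau_0,\tau_1$ be tracial states on $B$ inducing the same state on $K_0(B)$, and let $0<\bar\beta\le1$. Then there are points $x_l\in X_l\setminus\Omega_l$ and pairwise orthogonal weighted $(\mathcal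 F,\eta)$-excisors $(E_{x_l},\pi_{x_l},\sigma_{x_l},\kappa_{x_l})$, $l=1,\dots,R$, and unital embeddings $$\gamma_0,\gamma_1,\tilde\gamma:\bigoplus_{l=1}^R\mathcal Q\to\mathcal Q,\qquad \bar\gamma:\mathcal Q\oplus\mathcal Q\to\mathcal Q$$ such that, with $E=\bigoplus_lE_{x_l}$, $\pi=\bigoplus_l\pi_{x_l}$, $\sigma=\bigoplus_l\sigma_{x_l}$, $\bar\kappa_i=\gamma_i\circ\bigoplus_l\kappa_{x_l}$ and $\bar\kappa=\tilde\gamma\circ\bigoplus_l\kappa_{x_l}$, the tuples $(E,\pi,\sigma,\bar\kappa_i)$, $i\in\{0,1\}$, and $(E,\pi,\sigma,\bar\kappa)$ are weighted $(\mathcal F,\eta)$-excisors, $$(E,\pi,\sigma,\bar\gamma\circ(\bar\kappa_0\oplus\bar\kappa))\sim_{(\mathcal F,\eta)}(E,\pi,\sigma,\bar\gamma\circ(\bar\kappa_1\oplus\bar\kappa)),$$ and $|\tau_{\mathcal Q}(\gamma_i(1_l))-y^{\tau_i}_l|<\bar\beta$ for $i\in\{0,1\}$ and $l\in\{1,\dots,R\}$,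 where $1_l$ is the unit of the $l$-th summand of $\bigoplus_l\mathcal Q$. -/

import Mathlib

open Filter Topology
open scoped ComplexOrder

/-! ### Tracial states -/

/-- Tracial states on a unital C*-algebra. -/
structure TracialState (A : Type*) [CStarAlgebra A] where
  toLin : A →ₗ[ℂ] ℂ
  nonneg : ∀ a : A, 0 ≤ toLin (star a * a)
  map_one : toLin 1 = 1
  comm : ∀ a b : A, toLin (a * b) = toLin (b * a)

/-! ### The group `K₀` and the maps induced on it by traces -/

section KZero

open Matrix

/-- Murray-von Neumann equivalence of (square matrix) projections `p`, `q`, possibly of different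
sizes, implemented by the partial isometry `v`. -/
def MvN {A : Type*} [Ring A] [StarRing A] {m n : Type*} [Fintype m] [Fintype n]
    (p : Matrix m m A) (q : Matrix n n A) : Prop :=
  ∃ v : Matrix m n A, v * vᴴ = p ∧ vᴴ * v = q ∧ p * v = v

/-- Projections in matrix algebras of arbitrary finite size over `A`. -/
structure MatProj (A : Type*) [Ring A] [StarRing A] where
  size : ℕ
  mat : Matrix (Fin size) (Fin size) A
  isProj : IsStarProjection mat

variable {A : Type*} [Ring A] [StarRing A]
variable {m n k m' n' : Type*} [Fintype m] [Fintype n] [Fintype k] [Fintype m'] [Fintype n']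

theorem MvN.refl {p : Matrix m m A} (hp : IsStarProjection p) : MvN p p := by
  have h1 : pᴴ = p := hp.isSelfAdjoint
  have h2 : p * p = p := hp.isIdempotentElem
  exact ⟨p, by rw [h1, h2], by rw [h1, h2], h2⟩

theorem MvN.symm {p : Matrix m m A} {q : Matrix n n A} (h : MvN p q) : MvN q p := by
  obtain ⟨v, h1, h2, h3⟩ := h
  refine ⟨vᴴ, by rw [conjTranspose_conjTranspose, h2], by rw [conjTranspose_conjTranspose, h1], ?_⟩
  have h4 : pᴴ = p := by rw [← h1, conjTranspose_mul, conjTranspose_conjTranspose]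
  rw [← h2, Matrix.mul_assoc, h1]
  nth_rewrite 2 [← h3]
  rw [conjTranspose_mul, h4]

theorem MvN.trans {p : Matrix m m A} {q : Matrix n n A} {r : Matrix k k A}
    (h : MvN p q) (h' : MvN q r) : MvN p r := by
  obtain ⟨v, h1, h2, h3⟩ := h
  obtain ⟨w, g1, g2, g3⟩ := h'
  refine ⟨v * w, ?_, ?_, ?_⟩
  · rw [conjTranspose_mul, Matrix.mul_assoc, ← Matrix.mul_assoc w, g1, ← h2,
      ← Matrix.mul_assoc, ← Matrix.mul_assoc, h1, h3, h1]
  · rw [conjTranspose_mul, Matrix.mul_assoc, ← Matrix.mul_assoc vᴴ, h2, g3, g2]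
  · rw [← Matrix.mul_assoc, h3]

theorem MvN.reindex {p : Matrix m m A} (hp : IsStarProjection p) (e : m ≃ n) :
    MvN (p.submatrix e.symm e.symm) p := by
  have h1 : pᴴ = p := hp.isSelfAdjoint
  have h2 : p * p = p := hp.isIdempotentElem
  refine ⟨p.submatrix e.symm id, ?_, ?_, ?_⟩
  · rw [conjTranspose_submatrix, h1]
    rw [← Matrix.submatrix_mul _ _ _ _ _ Function.bijective_id, h2]
  · rw [conjTranspose_submatrix, h1, ← Matrix.submatrix_mul _ _ _ _ _ e.symm.bijective, h2]
    simp
  · rw [← Matrix.submatrix_mul _ _ _ _ _ e.symm.bijective, h2]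

theorem MvN.fromBlocks {p : Matrix m m A} {p' : Matrix m' m' A} {q : Matrix n n A}
    {q' : Matrix n' n' A} (h : MvN p p') (h' : MvN q q') :
    MvN (Matrix.fromBlocks p 0 0 q) (Matrix.fromBlocks p' 0 0 q') := by
  obtain ⟨v, h1, h2, h3⟩ := h
  obtain ⟨w, g1, g2, g3⟩ := h'
  refine ⟨Matrix.fromBlocks v 0 0 w, ?_, ?_, ?_⟩ <;>
    simp [fromBlocks_conjTranspose, fromBlocks_multiply, *]

theorem isStarProjection_fromBlocks {p : Matrix m m A} {q : Matrix n n A}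
    (hp : IsStarProjection p) (hq : IsStarProjection q) :
    IsStarProjection (Matrix.fromBlocks p 0 0 q) := by
  have h1 : pᴴ = p := hp.isSelfAdjoint
  have h2 : p * p = p := hp.isIdempotentElem
  have g1 : qᴴ = q := hq.isSelfAdjoint
  have g2 : q * q = q := hq.isIdempotentElem
  refine ⟨?_, ?_⟩
  · simp [IsIdempotentElem, fromBlocks_multiply, h2, g2]
  · rw [IsSelfAdjoint, star_eq_conjTranspose, fromBlocks_conjTranspose, h1, g1]
    simp

theorem isStarProjection_submatrix {p : Matrix m m A} (hp : IsStarProjection p) (e : n ≃ m) :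
    IsStarProjection (p.submatrix e e) := by
  have h1 : pᴴ = p := hp.isSelfAdjoint
  have h2 : p * p = p := hp.isIdempotentElem
  refine ⟨?_, ?_⟩
  · rw [IsIdempotentElem, ← Matrix.submatrix_mul _ _ _ _ _ e.bijective, h2]
  · rw [IsSelfAdjoint, star_eq_conjTranspose, conjTranspose_submatrix, h1]

variable (A) in
instance MatProj.setoid : Setoid (MatProj A) where
  r p q := MvN p.mat q.mat
  iseqv := ⟨fun p => MvN.refl p.isProj, MvN.symm, MvN.trans⟩

/-- The direct sum `p ⊕ q`. -/
def MatProj.dsum (p q : MatProj A) : MatProj A where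
  size := p.size + q.size
  mat := (Matrix.fromBlocks p.mat 0 0 q.mat).submatrix finSumFinEquiv.symm finSumFinEquiv.symm
  isProj := isStarProjection_submatrix (isStarProjection_fromBlocks p.isProj q.isProj) _

theorem MatProj.dsum_equiv (p q : MatProj A) :
    MvN (p.dsum q).mat (Matrix.fromBlocks p.mat 0 0 q.mat) :=
  MvN.reindex (isStarProjection_fromBlocks p.isProj q.isProj) finSumFinEquiv

variable (A) in
/-- The Murray-von Neumann semigroup of `A`. -/
def MvNMonoid : Type _ := Quotient (MatProj.setoid A)

instance MvNMonoid.instAdd : Add (MvNMonoid A) where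
  add := Quotient.map₂ MatProj.dsum (by
    intro p p' h q q' h'
    exact (MatProj.dsum_equiv p q).trans ((MvN.fromBlocks h h').trans
      (MatProj.dsum_equiv p' q').symm))

instance MvNMonoid.instZero : Zero (MvNMonoid A) where
  zero := Quotient.mk _ ⟨0, 0, ⟨by simp [IsIdempotentElem], by simp⟩⟩

instance MvNMonoid.instAddCommMonoid : AddCommMonoid (MvNMonoid A) where
  add_assoc := by
    rintro ⟨p⟩ ⟨q⟩ ⟨r⟩
    refine Quotient.sound ?_
    have hp := p.isProj
    have hq := q.isProj
    have hr := r.isProj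
    have h1 := (MatProj.dsum_equiv (p.dsum q) r).trans
      (MvN.fromBlocks (MatProj.dsum_equiv p q) (MvN.refl hr))
    have h2 := (MatProj.dsum_equiv p (q.dsum r)).trans
      (MvN.fromBlocks (MvN.refl hp) (MatProj.dsum_equiv q r))
    have h3 := MvN.reindex (isStarProjection_fromBlocks
      (isStarProjection_fromBlocks hp hq) hr) (Equiv.sumAssoc _ _ _)
    refine h1.trans (h3.symm.trans (MvN.trans ?_ h2.symm))
    convert MvN.refl (isStarProjection_fromBlocks hp (isStarProjection_fromBlocks hq hr)) using 1
    ext (i | i | i) (j | j | j) <;> simp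
  zero_add := by
    rintro ⟨p⟩
    refine Quotient.sound ?_
    refine (MatProj.dsum_equiv _ p).trans (MvN.trans ?_ (MvN.reindex p.isProj
      (Equiv.emptySum (Fin 0) (Fin p.size)).symm))
    rw [Equiv.symm_symm]
    convert MvN.refl (isStarProjection_submatrix p.isProj (Equiv.emptySum (Fin 0) (Fin p.size)))
      using 1
    ext (i | i) (j | j)
    · exact i.elim0
    · exact i.elim0
    · exact j.elim0
    · simp
  add_zero := by
    rintro ⟨p⟩
    refine Quotient.sound ?_
    refine (MatProj.dsum_equiv p _).trans (MvN.trans ?_ (MvN.reindex p.isProj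
      (Equiv.sumEmpty (Fin p.size) (Fin 0)).symm))
    rw [Equiv.symm_symm]
    convert MvN.refl (isStarProjection_submatrix p.isProj (Equiv.sumEmpty (Fin p.size) (Fin 0)))
      using 1
    ext (i | i) (j | j)
    · simp
    · exact j.elim0
    · exact i.elim0
    · exact i.elim0
  add_comm := by
    rintro ⟨p⟩ ⟨q⟩
    refine Quotient.sound ?_
    have h3 := MvN.reindex (isStarProjection_fromBlocks p.isProj q.isProj) (Equiv.sumComm _ _)
    refine (MatProj.dsum_equiv p q).trans (h3.symm.trans (MvN.trans ?_
      (MatProj.dsum_equiv q p).symm))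
    convert MvN.refl (isStarProjection_fromBlocks q.isProj p.isProj) using 1
    ext (i | i) (j | j) <;> simp
  nsmul := nsmulRec

variable (A) in
/-- `K₀(A)`, for a unital C*-algebra `A`. -/
abbrev KZero : Type _ := Algebra.GrothendieckAddGroup (MvNMonoid A)

end KZero

section KZeroTrace

open Matrix

variable {A : Type*} [CStarAlgebra A]

theorem TracialState.eq_of_mvN (τ : TracialState A) {m n : Type*} [Fintype m] [Fintype n]
    {p : Matrix m m A} {q : Matrix n n A} (h : MvN p q) :
    τ.toLin p.trace = τ.toLin q.trace := by
  obtain ⟨v, rfl, rfl, -⟩ := h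
  simp only [Matrix.trace, Matrix.diag_apply, Matrix.mul_apply, map_sum, conjTranspose_apply]
  rw [Finset.sum_comm]
  exact Finset.sum_congr rfl fun i _ => Finset.sum_congr rfl fun j _ => τ.comm _ _

/-- `[p] ↦ (τ ⊗ Tr)(p)`. -/
noncomputable def TracialState.onMvN (τ : TracialState A) : MvNMonoid A →+ ℂ where
  toFun := Quotient.lift (fun p : MatProj A => τ.toLin p.mat.trace)
    fun _ _ h => τ.eq_of_mvN h
  map_zero' := by
    change τ.toLin (Matrix.trace (0 : Matrix (Fin 0) (Fin 0) A)) = 0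
    simp
  map_add' := by
    rintro ⟨p⟩ ⟨q⟩
    change τ.toLin (p.dsum q).mat.trace = τ.toLin p.mat.trace + τ.toLin q.mat.trace
    rw [τ.eq_of_mvN (MatProj.dsum_equiv p q), ← map_add]
    simp [Matrix.trace]

/-- The state `τ_*` induced by a tracial state `τ` on `K₀`. -/
noncomputable def TracialState.kZero (τ : TracialState A) : KZero A →+ ℂ :=
  Algebra.GrothendieckAddGroup.lift τ.onMvN

end KZeroTrace

/-! ### The universal UHF algebra -/

/-- The Hilbert space `ℓ²(ℕ)`. -/
abbrev EllTwo : Type := lp (fun _ : ℕ => ℂ) 2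

/-- The matrix entry `⟨e_p, T e_q⟩`. -/
noncomputable def matrixEntry (T : EllTwo →L[ℂ] EllTwo) (p q : ℕ) : ℂ :=
  T (lp.single 2 q 1) p

/-- `T` is block diagonal, with all diagonal blocks equal to one and the same `n × n` matrix.
For fixed `n ≥ 1` these operators form a unital copy `1 ⊗ Mₙ` of `Mₙ(ℂ)` in the bounded operators on
`ℓ²(ℕ)`, and the copy of `Mₙ` lies unitally in the copy of `Mₘ` whenever `n ∣ m`. -/
def IsBlockPeriodic (n : ℕ) (T : EllTwo →L[ℂ] EllTwo) : Prop :=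
  ∀ p q : ℕ, matrixEntry T p q =
    if p / n = q / n then matrixEntry T (p % n) (q % n) else 0

/-- The norm closure of the union of the copies of all the matrix algebras `Mₙ(ℂ)`, `n ≥ 1`. -/
noncomputable def uhfSubalgebra : StarSubalgebra ℂ (EllTwo →L[ℂ] EllTwo) :=
  (StarAlgebra.adjoin ℂ {T | ∃ n : ℕ, 0 < n ∧ IsBlockPeriodic n T}).topologicalClosure

instance uhfSubalgebra.isClosed : IsClosed (uhfSubalgebra : Set (EllTwo →L[ℂ] EllTwo)) :=
  StarSubalgebra.isClosed_topologicalClosure _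

/-- The universal UHF algebra `𝒬`, realised as the inductive limit of all matrix algebras
`Mₙ(ℂ)` (ordered by divisibility, with unital inclusions) inside the operators on `ℓ²(ℕ)`. -/
def UniversalUHF : Type := uhfSubalgebra

namespace UniversalUHF

noncomputable instance : CStarAlgebra UniversalUHF :=
  inferInstanceAs (CStarAlgebra uhfSubalgebra)

noncomputable instance : PartialOrder UniversalUHF := CStarAlgebra.spectralOrder _

instance : StarOrderedRing UniversalUHF := CStarAlgebra.spectralOrderedRing _

/-- The underlying operator on `ℓ²(ℕ)`. -/
def toOperator (a : UniversalUHF) : EllTwo →L[ℂ] EllTwo := (a : uhfSubalgebra).1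

/-- The unique tracial state of `𝒬`: the limit of the normalised traces of the upper left
`N! × N!` corners. On the copy of `Mₙ` it is the normalised trace (all terms with `n ∣ N!` agree),
and the functionals involved are contractive, so that the limit exists on all of `𝒬`. -/
noncomputable def trace (a : UniversalUHF) : ℂ :=
  limUnder atTop fun N : ℕ =>
    ((N.factorial : ℂ))⁻¹ * ∑ p ∈ Finset.range N.factorial, matrixEntry a.toOperator p p

end UniversalUHF

/-! ### Recursive subhomogeneous decompositions -/

/-- The C*-algebra `M_r(A)`. -/
abbrev CMat (r : ℕ) (A : Type*) : Type _ := CStarMatrix (Fin r) (Fin r) A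

/-- A recursive subhomogeneous decomposition of the unital C*-algebra `B` with `R` steps (over
compact metrizable spaces). The stages are numbered `0, …, R`, where stage `0` is the zero algebra;
for `l : Fin R` the stage `l + 1` is the pullback of the stage `l` and `C(X l, M_{r l})` over
`C(Ω l, M_{r l})`. In particular the first of the closed sets `Ω l` is empty (as `φ` is unital), and
stage `1` is `C(X 0, M_{r 0})`. -/
structure RSHDecomposition.{u, v} (B : Type u) [CStarAlgebra B] (R : ℕ) where
  X : Fin R → Type v
  [topX : ∀ l, TopologicalSpace (X l)]
  [compactX : ∀ l, CompactSpace (X l)]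
  [metrizableX : ∀ l, TopologicalSpace.MetrizableSpace (X l)]
  Ω : ∀ l, Set (X l)
  isClosed_Ω : ∀ l, IsClosed (Ω l)
  r : Fin R → ℕ
  r_pos : ∀ l, 0 < r l
  stage : Fin (R + 1) → Type v
  [cstarStage : ∀ j, CStarAlgebra (stage j)]
  /-- the unital homomorphisms along which one glues -/
  φ : ∀ l : Fin R, stage l.castSucc →⋆ₐ[ℂ] C(Ω l, CMat (r l) ℂ)
  /-- the canonical map from the pullback to the previous stage -/
  down : ∀ l : Fin R, stage l.succ →⋆ₐ[ℂ] stage l.castSucc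
  /-- the canonical map from the pullback to the matrix valued functions -/
  coord : ∀ l : Fin R, stage l.succ →⋆ₐ[ℂ] C(X l, CMat (r l) ℂ)
  comm : ∀ (l : Fin R) (b : stage l.succ), φ l (down l b) = (coord l b).restrict (Ω l)
  pullback : ∀ (l : Fin R) (a : stage l.castSucc) (f : C(X l, CMat (r l) ℂ)),
    φ l a = f.restrict (Ω l) → ∃! b : stage l.succ, down l b = a ∧ coord l b = f
  stage_zero : Subsingleton (stage 0)
  equiv : B ≃⋆ₐ[ℂ] stage (Fin.last R)

namespace RSHDecomposition

attribute [instance] topX compactX metrizableX cstarStage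

variable {B : Type*} [CStarAlgebra B] {R : ℕ}

section Basic

variable (D : RSHDecomposition B R)

theorem down_surjective (l : Fin R) : Function.Surjective (D.down l) := by
  intro a
  obtain ⟨g, hg⟩ := (TietzeExtension.of_tvs ℂ (E := Fin (D.r l) → Fin (D.r l) → ℂ)
    ).exists_restrict_eq' (D.Ω l) (D.isClosed_Ω l) (D.φ l a)
  obtain ⟨b, ⟨hb, -⟩, -⟩ := D.pullback l a g hg.symm
  exact ⟨b, hb⟩

/-- The canonical quotient map from `B` to a stage. -/
noncomputable def ψ : ∀ j : Fin (R + 1), B →⋆ₐ[ℂ] D.stage j :=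
  Fin.reverseInduction (motive := fun j => B →⋆ₐ[ℂ] D.stage j)
    (D.equiv : B →⋆ₐ[ℂ] D.stage (Fin.last R)) fun l f => (D.down l).comp f

/-- The `l`-th component of the canonical embedding of `B` into `⨁ C(X l, M_{r l})`. -/
noncomputable def ι (l : Fin R) : B →⋆ₐ[ℂ] C(D.X l, CMat (D.r l) ℂ) :=
  (D.coord l).comp (D.ψ l.succ)

/-- Projections can be lifted along the decomposition. -/
def ProjectionsLift : Prop :=
  ∀ (l : Fin R) (N : ℕ) (p : CStarMatrix (Fin N) (Fin N) (D.stage l.castSucc)),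
    IsStarProjection p →
      ∃ q : CStarMatrix (Fin N) (Fin N) (D.stage l.succ), IsStarProjection q ∧ q.map (D.down l) = p

end Basic

/-! ### The weights of a tracial state -/

section Weights

variable (D : RSHDecomposition B R)

theorem exists_strictlyPositive (l : Fin R) :
    ∃ h : C(D.X l, ℝ), ∀ x, 0 ≤ h x ∧ h x ≤ 1 ∧ (h x = 0 ↔ x ∈ D.Ω l) := by
  let _ := TopologicalSpace.metrizableSpaceMetric (D.X l)
  rcases (D.Ω l).eq_empty_or_nonempty with h0 | h0
  · exact ⟨1, fun x => by simp [h0]⟩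
  · refine ⟨⟨fun x => min (Metric.infDist x (D.Ω l)) 1,
      (Metric.continuous_infDist_pt _).min continuous_const⟩, fun x => ⟨?_, ?_, ?_⟩⟩
    · exact le_min Metric.infDist_nonneg zero_le_one
    · exact min_le_right _ _
    · rw [(D.isClosed_Ω l).mem_iff_infDist_zero h0]
      constructor
      · intro h
        by_contra h'
        have h1 : 0 < Metric.infDist x (D.Ω l) := lt_of_le_of_ne Metric.infDist_nonneg (Ne.symm h')
        have h2 : 0 < min (Metric.infDist x (D.Ω l)) 1 := lt_min h1 one_pos
        exact h2.ne' h
      · intro h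
        simp [h]

/-- A strictly positive element `h`, `0 ≤ h ≤ 1`, of `C₀(X l ∖ Ω l)`. -/
noncomputable def h (l : Fin R) : C(D.X l, ℝ) := (D.exists_strictlyPositive l).choose

theorem h_spec (l : Fin R) (x : D.X l) :
    0 ≤ D.h l x ∧ D.h l x ≤ 1 ∧ (D.h l x = 0 ↔ x ∈ D.Ω l) :=
  (D.exists_strictlyPositive l).choose_spec x

/-- The function `h ^ (1 / (n + 1)) ⊗ 1` in `C(X l, M_{r l})`. -/
noncomputable def rootFun (l : Fin R) (n : ℕ) : C(D.X l, CMat (D.r l) ℂ) where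
  toFun x := (((D.h l x) ^ ((1 : ℝ) / (n + 1)) : ℝ) : ℂ) • 1
  continuous_toFun := by
    refine Continuous.smul (Complex.continuous_ofReal.comp ?_) continuous_const
    exact (D.h l).continuous.rpow_const fun x => Or.inr (by positivity)

theorem exists_root (l : Fin R) (n : ℕ) :
    ∃! b : D.stage l.succ, D.down l b = 0 ∧ D.coord l b = D.rootFun l n := by
  refine D.pullback l 0 _ ?_
  rw [map_zero]
  ext x : 1
  have h0 : D.h l x = 0 := (D.h_spec l x).2.2.2 x.2
  have h1 : (0 : ℝ) ^ ((1 : ℝ) / (n + 1)) = 0 := Real.zero_rpow (by positivity)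
  change 0 = (((D.h l x) ^ ((1 : ℝ) / (n + 1)) : ℝ) : ℂ) • (1 : CMat (D.r l) ℂ)
  rw [h0, h1, Complex.ofReal_zero, zero_smul]

/-- The element `h ^ (1 / (n + 1)) ⊗ 1` of `C₀(X l ∖ Ω l) ⊗ M_{r l}`, as an element of the stage
`l + 1`. -/
noncomputable def root (l : Fin R) (n : ℕ) : D.stage l.succ := (D.exists_root l n).choose

/-- Given a functional `t` on the stage `l + 1`, the functional
`b ↦ lim_n t ((h ^ (1 / n) ⊗ 1) b)`. -/
noncomputable def barFun (l : Fin R) (t : D.stage l.succ → ℂ) (b : D.stage l.succ) : ℂ :=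
  limUnder atTop fun n : ℕ => t (D.root l n * b)

/-- The functionals `τ_j` on the stages: `τ_R = τ`, and
`τ_l (b) = τ_{l + 1} (b') - \bar τ_{l + 1} (b')` for any lift `b'` of `b`. -/
noncomputable def stageFun (τ : TracialState B) : ∀ j : Fin (R + 1), D.stage j → ℂ :=
  Fin.reverseInduction (motive := fun j => D.stage j → ℂ)
    (fun b => τ.toLin (D.equiv.symm b))
    fun l t b => t (Function.surjInv (D.down_surjective l) b)
      - D.barFun l t (Function.surjInv (D.down_surjective l) b)

/-- The weights of a tracial state with respect to the decomposition (the value at the stage `0` is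
`0`). -/
noncomputable def weight (τ : TracialState B) (l : Fin R) : ℂ :=
  D.stageFun τ l.succ 1 - D.stageFun τ l.castSucc 1

end Weights

/-! ### The tensor product `B ⊗ 𝒬` -/

section Tensor

variable (D : RSHDecomposition B R)

/-- The elementary tensor `b ⊗ q`, as an element of
`⨁ C(X l, M_{r l}) ⊗ 𝒬 = ⨁ C(X l, M_{r l}(𝒬))`. -/
noncomputable def pureTensor (b : B) (q : UniversalUHF) :
    ∀ l, C(D.X l, CMat (D.r l) UniversalUHF) := fun l =>
  { toFun := fun x => CStarMatrix.ofMatrix fun i j => (D.ι l b x i j) • q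
    continuous_toFun := by
      refine continuous_pi fun i => continuous_pi fun j => ?_
      refine Continuous.smul ?_ continuous_const
      have h1 : Continuous fun x => D.ι l b x := (D.ι l b).continuous
      exact (continuous_apply j).comp ((continuous_apply i).comp h1) }

/-- The closed star subalgebra of `⨁ C(X l, M_{r l}(𝒬))` generated by the elementary tensors
`b ⊗ q`. -/
noncomputable def tensorSubalgebra :
    StarSubalgebra ℂ (∀ l, C(D.X l, CMat (D.r l) UniversalUHF)) :=
  (StarAlgebra.adjoin ℂ
    (Set.range fun bq : B × UniversalUHF => D.pureTensor bq.1 bq.2)).topologicalClosure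

instance tensorSubalgebra.isClosed :
    IsClosed (D.tensorSubalgebra : Set (∀ l, C(D.X l, CMat (D.r l) UniversalUHF))) :=
  StarSubalgebra.isClosed_topologicalClosure _

/-- The C*-algebra `B ⊗ 𝒬`: as `B` embeds in `⨁ C(X l, M_{r l})`, the (spatial) tensor product is
the closed linear span of the elementary tensors in `⨁ C(X l, M_{r l}(𝒬))`. -/
def TensorUHF : Type _ := D.tensorSubalgebra

noncomputable instance : CStarAlgebra D.TensorUHF :=
  inferInstanceAs (CStarAlgebra D.tensorSubalgebra)

/-- The elementary tensor `b ⊗ q` in `B ⊗ 𝒬`. -/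
noncomputable def tmul (b : B) (q : UniversalUHF) : D.TensorUHF :=
  (⟨D.pureTensor b q, StarSubalgebra.le_topologicalClosure _
    (StarAlgebra.subset_adjoin ℂ _ ⟨(b, q), rfl⟩)⟩ : D.tensorSubalgebra)

end Tensor

end RSHDecomposition

/-! ### Order zero maps -/

/-- Complete positivity (with respect to the usual order of a C*-algebra). -/
def IsCompletelyPositive {A C : Type*} [CStarAlgebra A] [CStarAlgebra C] (σ : A →ₗ[ℂ] C) : Prop :=
  letI := CStarAlgebra.spectralOrder A
  letI := CStarAlgebra.spectralOrder C
  haveI := CStarAlgebra.spectralOrderedRing A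
  haveI := CStarAlgebra.spectralOrderedRing C
  ∃ f : CompletelyPositiveMap A C, f.toLinearMap = σ

/-- Isometric completely positive maps of order zero, i.e. preserving orthogonality of positive
elements. -/
structure IsIsometricOrderZero {A C : Type*} [CStarAlgebra A] [CStarAlgebra C]
    (σ : A →ₗ[ℂ] C) : Prop where
  completelyPositive : IsCompletelyPositive σ
  orderZero : ∀ a b : A, (∃ c, a = star c * c) → (∃ c, b = star c * c) →
    a * b = 0 → σ a * σ b = 0
  isometric : ∀ a : A, ‖σ a‖ = ‖a‖

/-- The homomorphism into a product with given components. -/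
def piStarAlgHom {ι A : Type*} {C : ι → Type*} [CStarAlgebra A] [∀ l, CStarAlgebra (C l)]
    (f : ∀ l, A →⋆ₐ[ℂ] C l) : A →⋆ₐ[ℂ] ∀ l, C l where
  toFun a l := f l a
  map_one' := by ext l; simp
  map_mul' a b := by ext l; simp
  map_zero' := by ext l; simp
  map_add' a b := by ext l; simp
  commutes' c := by ext l; simp [Algebra.algebraMap_eq_smul_one]
  map_star' a := by ext l; simp [map_star]

/-! ### Excisors and bridges -/

/-- The data `(E, ρ, σ, κ)` underlying a weighted excisor: a finite dimensional C*-algebra `E`,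
unital homomorphisms `ρ : B → E` and `κ : E → 𝒬`, and a linear map `σ : E → B ⊗ 𝒬`. -/
structure ExcisorData {B : Type*} [CStarAlgebra B] {R : ℕ} (D : RSHDecomposition B R) where
  E : Type
  [cstarE : CStarAlgebra E]
  finiteDim : FiniteDimensional ℂ E
  ρ : B →⋆ₐ[ℂ] E
  σ : E →ₗ[ℂ] D.TensorUHF
  κ : E →⋆ₐ[ℂ] UniversalUHF

namespace ExcisorData

attribute [instance] cstarE

variable {B : Type*} [CStarAlgebra B] {R : ℕ} {D : RSHDecomposition B R}

/-- Compatibility with the decomposition: `E = ⨁ E_l` in such a way that each component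
`ρ_l : B → E_l` factors through the restriction of matrix valued functions to some compact subset
of `X l ∖ Ω l`. -/
def IsCompatible (V : ExcisorData D) : Prop :=
  ∃ (E' : Fin R → Type) (_ : ∀ l, CStarAlgebra (E' l)) (e : V.E ≃⋆ₐ[ℂ] ∀ l, E' l),
    ∀ l, ∃ K : Set (D.X l), IsCompact K ∧ K ⊆ (D.Ω l)ᶜ ∧
      ∃ ρ' : C(K, CMat (D.r l) ℂ) →⋆ₐ[ℂ] E' l,
        ∀ b : B, e (V.ρ b) l = ρ' ((D.ι l b).restrict K)

/-- `(E, ρ, σ, κ)` is a weighted `(F, η)`-excisor, compatible with the decomposition. -/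
structure IsWeightedExcisor (F : Finset B) (η : ℝ) (V : ExcisorData D) : Prop where
  orderZero : IsIsometricOrderZero V.σ
  excises : ∀ b ∈ F, ‖V.σ 1 * D.tmul b 1 - V.σ (V.ρ b)‖ < η
  compatible : V.IsCompatible

/-- One step of a bridge. -/
structure Step (F : Finset B) (η : ℝ) (V W : ExcisorData D) : Prop where
  left : V.IsWeightedExcisor F η
  right : W.IsWeightedExcisor F η
  close : ∀ b ∈ F, ‖V.κ (V.ρ b) - W.κ (W.ρ b)‖ < η

/-- There is an `(F, η)`-bridge: a finite chain (of at least one step) of compatible weighted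
`(F, η)`-excisors leading from `V` to `W`. -/
def Bridge (F : Finset B) (η : ℝ) (V W : ExcisorData D) : Prop :=
  Relation.TransGen (Step F η) V W

/-- `E = E_x`, `ρ = ρ_x` and `κ = κ_x` for the point `x ∈ X l`: the evaluation `B → M_{r l}` at `x`
is the composition of the surjection `ρ` with an embedding `i : E → M_{r l}` (so that `E` is the
image of the evaluation and `ρ` is a sum of pairwise inequivalent irreducible representations),
and `κ` is `i` followed by a unital embedding of `M_{r l}` in `𝒬`. -/
def IsPoint (l : Fin R) (x : D.X l) (V : ExcisorData D) : Prop :=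
  Function.Surjective V.ρ ∧
    ∃ (i : V.E →⋆ₐ[ℂ] CMat (D.r l) ℂ) (j : CMat (D.r l) ℂ →⋆ₐ[ℂ] UniversalUHF),
      Function.Injective i ∧ (∀ b : B, i (V.ρ b) = D.ι l b x) ∧ V.κ = j.comp i

/-- Pairwise orthogonality: there are pairwise orthogonal projections `q l ∈ 𝒬` such that the image
of `σ_l` lies in `B ⊗ q l 𝒬 q l = (1 ⊗ q l) (B ⊗ 𝒬) (1 ⊗ q l)`. -/
def PairwiseOrthogonal (V : Fin R → ExcisorData D) : Prop :=
  ∃ q : Fin R → UniversalUHF, (∀ l, IsStarProjection (q l)) ∧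
    (∀ l m, l ≠ m → q l * q m = 0) ∧
    ∀ (l : Fin R) (e : (V l).E), D.tmul 1 (q l) * (V l).σ e * D.tmul 1 (q l) = (V l).σ e

/-- The homomorphism `γ ∘ ⨁ κ_l` on `⨁ E_l`, for a unital homomorphism `γ : ⨁ 𝒬 → 𝒬`. -/
noncomputable def sumκ (V : Fin R → ExcisorData D) (γ : (Fin R → UniversalUHF) →⋆ₐ[ℂ] UniversalUHF) :
    (∀ l, (V l).E) →⋆ₐ[ℂ] UniversalUHF :=
  γ.comp (piStarAlgHom fun l => (V l).κ.comp (Pi.evalStarAlgHom ℂ (fun l => (V l).E) l))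

/-- `(⨁ E_l, ⨁ ρ_l, ⨁ σ_l, κ)`, for a given unital homomorphism `κ : ⨁ E_l → 𝒬`. -/
noncomputable def sum (V : Fin R → ExcisorData D) (κ : (∀ l, (V l).E) →⋆ₐ[ℂ] UniversalUHF) :
    ExcisorData D where
  E := ∀ l, (V l).E
  finiteDim := by
    have := fun l => (V l).finiteDim
    infer_instance
  ρ := piStarAlgHom fun l => (V l).ρ
  σ := ∑ l, (V l).σ ∘ₗ LinearMap.proj l
  κ := κ

end ExcisorData

/-- The decomposition is `(F, η)`-connected. -/
def RSHDecomposition.IsConnected {B : Type*} [CStarAlgebra B] {R : ℕ} (D : RSHDecomposition B R)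
    (F : Finset B) (η : ℝ) : Prop :=
  ∀ (l : Fin R) (x y : D.X l) (V W : ExcisorData D),
    V.IsWeightedExcisor F η → W.IsWeightedExcisor F η → V.IsPoint l x → W.IsPoint l y →
      V.Bridge F η W

/-! A bridge sees an excisor only through the homomorphism κ ∘ ρ : B → 𝒬, because a step compares
only these compositions. An excisor in the middle of a chain may therefore be replaced by any other
one with the same composition (`HomBridge.bridge`), and the work is done with homomorphisms. The
diagonal embeddings 𝒬ⁿ → 𝒬 (`UniversalUHF.diag`) and their analogues for B ⊗ 𝒬 turn finite families
of excisors into orthogonal sums, and families of bridges into bridges between the sums.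

Fix x_l ∈ X_l ∖ Ω_l for every l. Evaluation at x_l is onto M_{r_l} and can be excised
(`exists_excising_map`). A word in the letters 1, …, R gives the diagonal sum of the corresponding
evaluations. Two homomorphisms of ⨁ M_{r_l} into a standard matrix algebra of 𝒬 with equal traces on
the central summands are conjugate by a unitary which can be joined to 1. Subdividing the path gives
a bridge (`homBridge_of_isMatricial`), so up to bridges a word is determined by its letter counts.
Concatenating words shows that the pairs (k, k') of count vectors joined by a bridge are closed
under addition. Hence the differences k - k' form a subgroup H of ℤ^R, and all of its elements have
coordinate sum 0.

Relations in H come from points. For y ∈ Ω_l, evaluation at y is a sum of evaluations at points of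
lower levels, occupying ranks c_k. Connectedness moves y to x_l, and each of those points to the
base point of its level, so r_l copies of the letter l are joined to the word which has c_k letters
for the k-th point (`wordBridge_of_eval`).

K-theory enters by duality. Let d ∈ ℕ^R annihilate H. Then there is a projection in a matrix algebra
over B whose trace at every point of X_l is d_l r_l. It is built stage by stage: the relations at
the points of Ω_l say that the correct traces on lower levels force the correct trace on Ω_l, and a
lifted projection can be corrected away from a clopen set containing Ω_l
(`exists_projection_stage`). A tracial state τ takes the value ∑ d_l y^τ_l on this projection
(`toLin_eq_sum_weight`). Since τ₀ and τ₁ agree on K₀, every such d annihilates y^{τ₀} - y^{τ₁}. This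
difference thus lies in the real span of H, and both weight vectors are approximated by frequencies
a/N, a'/N of natural vectors with a - a' ∈ H (`exists_natural_weights`).

Finally a - a' = k - k' with a bridge between k and k', which need not give a bridge between a and
a'. After adding k' + 1 it does: a + (k' + 1) = k + (a' + 1) and a' + (k' + 1) = k' + (a' + 1). This
is the role of the common summand κ̄. The embeddings γ₀, γ₁, γ̃ repeat the summands of ⨁ 𝒬 according
to words with counts a, a' and k' + 1 (`exists_words`). -/

/-! ### Block isometries on `ℓ²(ℕ)` -/

section BlockIsometry

open scoped InnerProductSpace

/-- The standard basis vectors of `ℓ²(ℕ)`. -/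
noncomputable def ellTwoBasis (p : ℕ) : EllTwo := lp.single 2 p 1

theorem ellTwoBasis_apply (p q : ℕ) : ellTwoBasis p q = if q = p then 1 else 0 := by
  rw [ellTwoBasis, lp.single_apply, Pi.single_apply]

theorem inner_ellTwoBasis (p : ℕ) (x : EllTwo) : ⟪ellTwoBasis p, x⟫_ℂ = x p := by
  rw [ellTwoBasis, lp.inner_single_left]
  simp

theorem orthonormal_ellTwoBasis : Orthonormal ℂ ellTwoBasis := by
  rw [orthonormal_iff_ite]
  intro i j
  rw [inner_ellTwoBasis, ellTwoBasis_apply]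

theorem ellTwo_ext {S T : EllTwo →L[ℂ] EllTwo}
    (h : ∀ q, S (ellTwoBasis q) = T (ellTwoBasis q)) : S = T := by
  refine lp.ext_continuousLinearMap (by simp) fun i => ?_
  ext
  exact congrArg (fun v : EllTwo => v _) (h i)

variable (n : ℕ) [NeZero n] (a : ℕ)

theorem orthonormal_block : Orthonormal ℂ fun p => ellTwoBasis (p * n + a) :=
  orthonormal_ellTwoBasis.comp _ fun p q h => by
    have := Nat.pos_of_neZero n
    simpa [this.ne'] using h

/-- The isometry `e_p ↦ e_{p n + a}`. -/
noncomputable def blockIso : EllTwo →L[ℂ] EllTwo :=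
  ((orthonormal_block n a).orthogonalFamily.linearIsometry).toContinuousLinearMap

theorem blockIso_basis (p : ℕ) : blockIso n a (ellTwoBasis p) = ellTwoBasis (p * n + a) := by
  rw [blockIso, LinearIsometry.coe_toContinuousLinearMap, ellTwoBasis,
    OrthogonalFamily.linearIsometry_apply_single]
  simp

variable {a} in
theorem star_blockIso_basis (ha : a < n) (p : ℕ) :
    star (blockIso n a) (ellTwoBasis p) = if p % n = a then ellTwoBasis (p / n) else 0 := by
  have hn := Nat.pos_of_neZero n
  ext q
  rw [← inner_ellTwoBasis, ContinuousLinearMap.star_eq_adjoint,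
    ContinuousLinearMap.adjoint_inner_right, blockIso_basis, inner_ellTwoBasis, ellTwoBasis_apply]
  by_cases h : p % n = a
  · rw [if_pos h, ellTwoBasis_apply]
    congr 1
    rw [eq_iff_iff]
    constructor
    · rintro rfl
      rw [mul_comm, Nat.mul_add_div hn, Nat.div_eq_of_lt ha, add_zero]
    · rintro rfl
      rw [← h, mul_comm, Nat.div_add_mod]
  · rw [if_neg h, if_neg]
    · rfl
    · rintro rfl
      apply h
      rw [mul_comm, Nat.mul_add_mod, Nat.mod_eq_of_lt ha]

variable {a} in
theorem blockIso_apply (ha : a < n) (x : EllTwo) (p : ℕ) :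
    blockIso n a x p = if p % n = a then x (p / n) else 0 := by
  rw [← inner_ellTwoBasis, ← ContinuousLinearMap.adjoint_inner_left,
    ← ContinuousLinearMap.star_eq_adjoint, star_blockIso_basis n ha]
  split_ifs
  · rw [inner_ellTwoBasis]
  · rw [inner_zero_left]

/-- With `sum_blockIso_mul_star` these are the Cuntz relations for the n block isometries; matrix
units, corners and diagonal embeddings are all formed from them. -/
theorem star_blockIso_mul {a b : ℕ} (ha : a < n) (hb : b < n) :
    star (blockIso n a) * blockIso n b = if a = b then 1 else 0 := by
  have hn := Nat.pos_of_neZero n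
  refine ellTwo_ext fun q => ?_
  rw [mul_apply_eq_comp, blockIso_basis, star_blockIso_basis n ha, mul_comm q,
    Nat.mul_add_mod, Nat.mod_eq_of_lt hb, Nat.mul_add_div hn, Nat.div_eq_of_lt hb, add_zero]
  by_cases h : a = b
  · simp [h]
  · simp [h, Ne.symm h]

theorem sum_blockIso_mul_star : ∑ a : Fin n, blockIso n a * star (blockIso n a) = 1 := by
  have hn := Nat.pos_of_neZero n
  refine ellTwo_ext fun q => ?_
  rw [sum_apply, Finset.sum_eq_single ⟨q % n, Nat.mod_lt _ hn⟩]
  · rw [mul_apply_eq_comp, star_blockIso_basis n (Nat.mod_lt _ hn), if_pos rfl,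
      blockIso_basis, mul_comm, Nat.div_add_mod]
    rfl
  · intro b _ hb
    rw [mul_apply_eq_comp, star_blockIso_basis n b.2, if_neg, map_zero]
    rintro h
    exact hb (Fin.ext h.symm)
  · simp

/-- Composing block isometries concatenates digits in a mixed radix expansion. This makes the
standard copies of the matrix algebras for different sizes compatible. -/
theorem blockIso_mul_blockIso (m : ℕ) [NeZero m] (b : ℕ) :
    blockIso n a * blockIso m b = blockIso (m * n) (b * n + a) := by
  refine ellTwo_ext fun q => ?_
  rw [mul_apply_eq_comp, blockIso_basis, blockIso_basis, blockIso_basis]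
  congr 1
  ring

theorem matrixEntry_block {a b : ℕ} (ha : a < n) (hb : b < n) (T : EllTwo →L[ℂ] EllTwo) (p q : ℕ) :
    matrixEntry (blockIso n a * T * star (blockIso n b)) p q =
      if p % n = a ∧ q % n = b then matrixEntry T (p / n) (q / n) else 0 := by
  change (blockIso n a * T * star (blockIso n b)) (ellTwoBasis q) p = _
  rw [mul_apply_eq_comp, mul_apply_eq_comp, star_blockIso_basis n hb,
    blockIso_apply n ha]
  by_cases h1 : p % n = a <;> by_cases h2 : q % n = b <;> simp [h1, h2]
  rfl

/-- An entry of the compressed operator depends on the last digit in base n and on an entry of T at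
the quotients by n, so the period N becomes n N. -/
theorem isBlockPeriodic_block {a b : ℕ} (ha : a < n) (hb : b < n) {N : ℕ}
    {T : EllTwo →L[ℂ] EllTwo} (hT : IsBlockPeriodic N T) :
    IsBlockPeriodic (n * N) (blockIso n a * T * star (blockIso n b)) := by
  intro p q
  rw [matrixEntry_block n ha hb, matrixEntry_block n ha hb, hT (p / n) (q / n)]
  simp only [Nat.mod_mul_right_mod, Nat.mod_mul_right_div_self, Nat.div_div_eq_div_mul]
  split_ifs <;> simp_all

theorem isBlockPeriodic_one : IsBlockPeriodic 1 (1 : EllTwo →L[ℂ] EllTwo) := by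
  intro p q
  have h : ∀ p q, matrixEntry 1 p q = if p = q then 1 else 0 := fun p q => by
    change ellTwoBasis q p = _
    rw [ellTwoBasis_apply]
  simp [h, Nat.mod_one]

theorem block_mem_uhf {a b : ℕ} (ha : a < n) (hb : b < n) :
    blockIso n a * star (blockIso n b) ∈ uhfSubalgebra := by
  refine StarSubalgebra.le_topologicalClosure _ (StarAlgebra.subset_adjoin ℂ _ ⟨n * 1, ?_, ?_⟩)
  · simpa using Nat.pos_of_neZero n
  · simpa using isBlockPeriodic_block n ha hb isBlockPeriodic_one

/-- Compression by an isometry is multiplicative, so it suffices to treat the generators, where the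
period is multiplied by n, and to pass to the closure. -/
theorem conj_mem_uhf {a : ℕ} (ha : a < n) {T : EllTwo →L[ℂ] EllTwo} (hT : T ∈ uhfSubalgebra) :
    blockIso n a * T * star (blockIso n a) ∈ uhfSubalgebra := by
  have key : ∀ T ∈ StarAlgebra.adjoin ℂ {T | ∃ n : ℕ, 0 < n ∧ IsBlockPeriodic n T},
      blockIso n a * T * star (blockIso n a) ∈ uhfSubalgebra := by
    intro T hT
    induction hT using StarAlgebra.adjoin_induction with
    | mem x hx =>
      obtain ⟨N, hN, hx⟩ := hx
      exact StarSubalgebra.le_topologicalClosure _ (StarAlgebra.subset_adjoin ℂ _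
        ⟨n * N, Nat.mul_pos (Nat.pos_of_neZero n) hN, isBlockPeriodic_block n ha ha hx⟩)
    -- Compression is not unital: scalars become multiples of a diagonal matrix unit.
    | algebraMap r =>
      rw [Algebra.algebraMap_eq_smul_one, mul_smul_comm, mul_one, smul_mul_assoc]
      exact uhfSubalgebra.smul_mem (block_mem_uhf n ha ha) r
    | add x y _ _ hx hy => rw [mul_add, add_mul]; exact add_mem hx hy
    | mul x y _ _ hx hy =>
      convert mul_mem hx hy using 1
      have h := star_blockIso_mul n ha ha
      rw [if_pos rfl] at h
      calc blockIso n a * (x * y) * star (blockIso n a)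
          = blockIso n a * x * 1 * y * star (blockIso n a) := by simp only [mul_assoc, one_mul]
        _ = _ := by rw [← h]; simp only [mul_assoc]
    | star x _ hx =>
      convert star_mem hx using 1
      simp [mul_assoc]
  have hc : IsClosed {T : EllTwo →L[ℂ] EllTwo |
      blockIso n a * T * star (blockIso n a) ∈ uhfSubalgebra} :=
    uhfSubalgebra.isClosed.preimage (by fun_prop)
  exact closure_minimal (s := (StarAlgebra.adjoin ℂ {T | ∃ n : ℕ, 0 < n ∧ IsBlockPeriodic n T} :
    Set (EllTwo →L[ℂ] EllTwo))) (fun T hT => key T hT) hc hT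

end BlockIsometry

/-! ### Matrix units and diagonal embeddings -/

namespace UniversalUHF

/-- The inclusion of `𝒬` in the operators on `ℓ²(ℕ)`. -/
noncomputable def incl : UniversalUHF →⋆ₐ[ℂ] (EllTwo →L[ℂ] EllTwo) := uhfSubalgebra.subtype

theorem incl_injective : Function.Injective incl := Subtype.val_injective

theorem incl_eq (a : UniversalUHF) : incl a = a.toOperator := rfl

variable (n : ℕ) [NeZero n]

/-- The matrix units of the standard copy of `Mₙ` in `𝒬`. -/
noncomputable def unit (i j : Fin n) : UniversalUHF :=
  (⟨blockIso n i * star (blockIso n j), block_mem_uhf n i.2 j.2⟩ : uhfSubalgebra)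

theorem incl_unit (i j : Fin n) : incl (unit n i j) = blockIso n i * star (blockIso n j) := rfl

theorem unit_mul (i j k l : Fin n) : unit n i j * unit n k l = if j = k then unit n i l else 0 := by
  apply incl_injective
  rw [map_mul, incl_unit, incl_unit, mul_assoc, ← mul_assoc (star _),
    star_blockIso_mul n j.2 k.2]
  by_cases h : j = k
  · simp [h, incl_unit]
  · have h' : ¬ (j : ℕ) = k := fun h' => h (Fin.ext h')
    simp [h, h']

theorem star_unit (i j : Fin n) : star (unit n i j) = unit n j i := by
  apply incl_injective
  rw [map_star, incl_unit, incl_unit, star_mul, star_star]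

theorem sum_unit : ∑ i, unit n i i = 1 := by
  apply incl_injective
  rw [map_sum, map_one]
  exact sum_blockIso_mul_star n

/-- The compression `x ↦ V x V*` with the `k`-th block isometry. -/
noncomputable def cornerFun (k : Fin n) (x : UniversalUHF) : UniversalUHF :=
  (⟨blockIso n k * incl x * star (blockIso n k), conj_mem_uhf n k.2 x.2⟩ : uhfSubalgebra)

theorem incl_cornerFun (k : Fin n) (x : UniversalUHF) :
    incl (cornerFun n k x) = blockIso n k * incl x * star (blockIso n k) := rfl

/-- The corner embedding `𝒬 → 𝒬` onto the `k`-th diagonal corner. -/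
noncomputable def corner (k : Fin n) : UniversalUHF →⋆ₙₐ[ℂ] UniversalUHF where
  toFun := cornerFun n k
  map_smul' c x := by
    apply incl_injective
    simp [incl_cornerFun]
  map_zero' := by
    apply incl_injective
    simp [incl_cornerFun]
  map_add' x y := by
    apply incl_injective
    simp only [map_add, incl_cornerFun, mul_add, add_mul]
  map_mul' x y := by
    apply incl_injective
    simp only [map_mul, incl_cornerFun]
    have h := star_blockIso_mul n k.2 k.2
    rw [if_pos rfl] at h
    calc blockIso n k * (incl x * incl y) * star (blockIso n k)
        = blockIso n k * incl x * 1 * incl y * star (blockIso n k) := by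
          simp only [mul_assoc, one_mul]
      _ = _ := by rw [← h]; simp only [mul_assoc]
  map_star' x := by
    apply incl_injective
    simp [map_star, incl_cornerFun, mul_assoc]

theorem incl_corner (k : Fin n) (x : UniversalUHF) :
    incl (corner n k x) = blockIso n k * incl x * star (blockIso n k) := rfl

theorem corner_injective (k : Fin n) : Function.Injective (corner n k) := by
  intro x y h
  apply incl_injective
  have h1 := congrArg (fun z => star (blockIso n k) * incl z * blockIso n k) h
  have h2 := star_blockIso_mul n k.2 k.2
  rw [if_pos rfl] at h2
  have h3 : ∀ x, star (blockIso n k) * incl (corner n k x) * blockIso n k = incl x := fun x => by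
    rw [incl_corner]
    calc _ = (star (blockIso n k) * blockIso n k) * incl x * (star (blockIso n k) * blockIso n k) :=
          by simp only [mul_assoc]
      _ = _ := by rw [h2, one_mul, mul_one]
  simpa only [h3] using h1

theorem corner_one (k : Fin n) : corner n k 1 = unit n k k := by
  apply incl_injective
  rw [incl_corner, map_one, mul_one, incl_unit]

theorem corner_mul_corner {k l : Fin n} (h : k ≠ l) (x y : UniversalUHF) :
    corner n k x * corner n l y = 0 := by
  rw [← mul_one x, map_mul, ← one_mul y, map_mul (corner n l), corner_one, corner_one, mul_assoc,
    ← mul_assoc (unit n k k), unit_mul, if_neg h, zero_mul, mul_zero]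

/-- The diagonal embedding `𝒬ⁿ → Mₙ(𝒬) ≅ 𝒬`. -/
noncomputable def diag : (Fin n → UniversalUHF) →⋆ₐ[ℂ] UniversalUHF where
  toFun x := ∑ k, corner n k (x k)
  map_one' := by simp only [Pi.one_apply, corner_one, sum_unit]
  map_mul' x y := by
    rw [Finset.sum_mul_sum]
    refine Finset.sum_congr rfl fun k _ => ?_
    rw [Finset.sum_eq_single k (fun l _ hl => corner_mul_corner n hl.symm _ _) (by simp),
      ← map_mul, Pi.mul_apply]
  map_zero' := by simp
  map_add' x y := by simp [Finset.sum_add_distrib]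
  commutes' c := by
    simp only [Algebra.algebraMap_eq_smul_one, Pi.smul_apply, Pi.one_apply, map_smul, corner_one,
      ← Finset.smul_sum, sum_unit]
  map_star' x := by simp [map_star]

theorem diag_apply (x : Fin n → UniversalUHF) : diag n x = ∑ k, corner n k (x k) := rfl

theorem diag_injective : Function.Injective (diag n) := by
  rw [injective_iff_map_eq_zero]
  intro x hx
  ext1 k
  apply corner_injective n k
  have h : corner n k 1 * diag n x = corner n k (x k) := by
    rw [diag_apply, Finset.mul_sum, Finset.sum_eq_single k
      (fun l _ hl => corner_mul_corner n hl.symm _ _) (by simp), ← map_mul, one_mul]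
  rw [← h, hx, mul_zero, Pi.zero_apply, map_zero]

/-- The standard embedding of `Mₙ` in `𝒬`. -/
noncomputable def ofMat : CMat n ℂ →⋆ₐ[ℂ] UniversalUHF where
  toFun a := ∑ i, ∑ j, a i j • unit n i j
  map_one' := by
    rw [← sum_unit n]
    refine Finset.sum_congr rfl fun i _ => ?_
    rw [Finset.sum_eq_single i]
    · simp
    · intro j _ h; simp [CStarMatrix.one_apply_ne h.symm]
    · simp
  map_mul' a b := by
    simp only [Finset.sum_mul_sum, CStarMatrix.mul_apply, Finset.sum_smul]
    refine Finset.sum_congr rfl fun i _ => ?_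
    simp only [smul_mul_smul_comm, unit_mul, smul_ite, smul_zero]
    have h : ∀ j : Fin n, ∑ x : Fin n, ∑ x_1 : Fin n,
        (if x = j then (a i x * b j x_1) • unit n i x_1 else 0) =
        ∑ x_1 : Fin n, (a i j * b j x_1) • unit n i x_1 := fun j => by
      rw [Finset.sum_eq_single j (fun x _ hx => by simp [hx]) (by simp)]
      simp
    simp only [h]
    rw [Finset.sum_comm]
  map_zero' := by simp
  map_add' a b := by simp [add_smul, Finset.sum_add_distrib]
  commutes' c := by
    rw [Algebra.algebraMap_eq_smul_one, Algebra.algebraMap_eq_smul_one, ← sum_unit n,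
      Finset.smul_sum]
    refine Finset.sum_congr rfl fun i _ => ?_
    rw [Finset.sum_eq_single i]
    · simp
    · intro j _ h; simp [CStarMatrix.one_apply_ne h.symm]
    · simp
  map_star' a := by
    simp only [star_sum, star_smul, star_unit, CStarMatrix.star_apply]
    rw [Finset.sum_comm]

theorem ofMat_apply (a : CMat n ℂ) : ofMat n a = ∑ i, ∑ j, a i j • unit n i j := rfl

/-- The diagonal entries depend only on the index modulo n. Once N ≥ n, the number n divides N!, and
the averages defining the trace are constant. -/
theorem trace_diag_indicator (s : Fin n → Prop) [DecidablePred s] :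
    (diag n fun k => if s k then 1 else 0).trace =
      ((Finset.univ.filter s).card : ℂ) / n := by
  have hn := Nat.pos_of_neZero n
  have hent : ∀ p, matrixEntry (diag n fun k => if s k then 1 else 0).toOperator p p =
      if s ⟨p % n, Nat.mod_lt _ hn⟩ then 1 else 0 := by
    intro p
    rw [← incl_eq, diag_apply, map_sum]
    have hsum : ∀ (f : Fin n → (EllTwo →L[ℂ] EllTwo)), matrixEntry (∑ k, f k) p p =
        ∑ k, matrixEntry (f k) p p := fun f => by
      simp only [matrixEntry, sum_apply]
      rw [lp.coeFn_sum, Finset.sum_apply]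
    rw [hsum, Finset.sum_eq_single ⟨p % n, Nat.mod_lt _ hn⟩]
    · rw [incl_corner, matrixEntry_block n (Nat.mod_lt _ hn) (Nat.mod_lt _ hn), if_pos ⟨rfl, rfl⟩]
      split_ifs
      · rw [map_one]
        change ellTwoBasis _ _ = _
        simp [ellTwoBasis_apply]
      · rw [map_zero]; rfl
    · intro k _ hk
      rw [incl_corner, matrixEntry_block n k.2 k.2, if_neg]
      rintro ⟨h, -⟩
      exact hk (Fin.ext h.symm)
    · simp
  have hblock : ∀ m : ℕ, ∑ p ∈ Finset.range (m * n),
      (if s ⟨p % n, Nat.mod_lt _ hn⟩ then (1 : ℂ) else 0) = m * (Finset.univ.filter s).card := by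
    intro m
    induction m with
    | zero => simp
    | succ m ih =>
      rw [Nat.succ_mul, Finset.sum_range_add, ih, Finset.sum_range]
      have h2 : ∀ x : Fin n, (⟨(m * n + x) % n, Nat.mod_lt _ hn⟩ : Fin n) = x := fun x => by
        ext
        simp [mul_comm m, Nat.mod_eq_of_lt x.2]
      simp only [h2, Finset.sum_boole]
      push_cast
      ring
  refine Tendsto.limUnder_eq (tendsto_const_nhds.congr' ?_)
  filter_upwards [eventually_ge_atTop n] with N hN
  obtain ⟨m, hm⟩ := Nat.dvd_factorial hn hN
  have hm0 : m ≠ 0 := by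
    rintro rfl
    exact N.factorial_ne_zero (by simpa using hm)
  have h1 : (m : ℂ) ≠ 0 := by exact_mod_cast hm0
  have h2 : (n : ℂ) ≠ 0 := by exact_mod_cast hn.ne'
  rw [hm, mul_comm n m, Finset.sum_congr rfl fun p _ => hent p, hblock]
  push_cast
  field_simp

/-- The corner embedding maps standard matrix units to standard matrix units of the larger size, so
a diagonal sum of matrix valued homomorphisms is again matrix valued. -/
theorem corner_unit (k : Fin n) (m : ℕ) [NeZero m] (i j : Fin m) :
    corner n k (unit m i j) = unit (m * n) (finProdFinEquiv (i, k)) (finProdFinEquiv (j, k)) := by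
  apply incl_injective
  rw [incl_corner, incl_unit, incl_unit]
  simp only [finProdFinEquiv_apply_val]
  rw [add_comm _ (n * _), mul_comm n, add_comm _ (n * _), mul_comm n, ← blockIso_mul_blockIso,
    ← blockIso_mul_blockIso, star_mul]
  simp only [mul_assoc]

/-- The unital inclusion of Mₙ in the standard copy of M_{mn}, obtained by inserting 1 = ∑ S_k S_k*
in the middle of S_i S_j*. -/
theorem unit_eq_sum (m : ℕ) [NeZero m] (i j : Fin n) :
    unit n i j = ∑ k : Fin m, unit (m * n) (finProdFinEquiv (k, i)) (finProdFinEquiv (k, j)) := by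
  apply incl_injective
  rw [incl_unit, map_sum]
  conv_lhs => rw [← mul_one (blockIso n i), ← sum_blockIso_mul_star m]
  rw [Finset.mul_sum, Finset.sum_mul]
  refine Finset.sum_congr rfl fun k _ => ?_
  rw [incl_unit]
  simp only [finProdFinEquiv_apply_val]
  rw [add_comm _ (n * _), mul_comm n, add_comm (j : ℕ), ← blockIso_mul_blockIso,
    ← blockIso_mul_blockIso, star_mul]
  simp only [mul_assoc]

end UniversalUHF

/-! ### Generalities on C*-algebras -/

theorem exists_eq_star_mul_self {A : Type*} [NonUnitalCStarAlgebra A] [PartialOrder A]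
    [StarOrderedRing A] {a : A} (h : 0 ≤ a) : ∃ b, a = star b * b :=
  CStarAlgebra.nonneg_iff_eq_star_mul_self.mp h

/-- A linear map preserving the unit, products and adjoints, as a homomorphism. -/
noncomputable def StarAlgHom.ofLinear {A C : Type*} [CStarAlgebra A] [CStarAlgebra C]
    (f : A →ₗ[ℂ] C) (h1 : f 1 = 1) (hm : ∀ a b, f (a * b) = f a * f b)
    (hs : ∀ a, f (star a) = star (f a)) : A →⋆ₐ[ℂ] C where
  toFun := f
  map_one' := h1
  map_mul' := hm
  map_zero' := map_zero f
  map_add' := map_add f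
  commutes' c := by
    rw [Algebra.algebraMap_eq_smul_one, map_smul, h1, Algebra.algebraMap_eq_smul_one]
  map_star' := hs

theorem pi_single_mul_single {A : Type*} [CStarAlgebra A] {n : ℕ} (k : Fin n) (x y : A) :
    (Pi.single k (x * y) : Fin n → A) = Pi.single k x * Pi.single k y := by
  ext1 j
  by_cases h : j = k
  · subst h; simp
  · simp [h]

theorem pi_single_star' {A : Type*} [CStarAlgebra A] {n : ℕ} (k : Fin n) (x : A) :
    (Pi.single k (star x) : Fin n → A) = star (Pi.single k x) := by
  ext1 j
  by_cases h : j = k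
  · subst h; simp
  · simp [h]

theorem continuous_pi_single {A : Type*} [CStarAlgebra A] {n : ℕ} (k : Fin n) :
    Continuous fun x : A => (Pi.single k x : Fin n → A) := by
  refine continuous_pi fun j => ?_
  by_cases h : j = k
  · subst h; simpa using continuous_id'
  · simpa [h] using continuous_const

/-! ### Diagonal embeddings of `B ⊗ 𝒬` -/

namespace RSHDecomposition

variable {B : Type*} [CStarAlgebra B] {R : ℕ} (D : RSHDecomposition B R)

/-- The C*-algebra `⨁ C(X l, M_{r l}(𝒬))`. -/
abbrev Ambient : Type _ := ∀ l, C(D.X l, CMat (D.r l) UniversalUHF)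

/-- The inclusion of `B ⊗ 𝒬` in `⨁ C(X l, M_{r l}(𝒬))`. -/
noncomputable def tensorIncl : D.TensorUHF →⋆ₐ[ℂ] D.Ambient := D.tensorSubalgebra.subtype

theorem tensorIncl_injective : Function.Injective D.tensorIncl := Subtype.val_injective

theorem tensorIncl_tmul (b : B) (q : UniversalUHF) :
    D.tensorIncl (D.tmul b q) = D.pureTensor b q := rfl

theorem pureTensor_apply (b : B) (q : UniversalUHF) (l : Fin R) (x : D.X l) (i j : Fin (D.r l)) :
    D.pureTensor b q l x i j = D.ι l b x i j • q := rfl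

theorem ambient_ext {a b : D.Ambient} (h : ∀ l x i j, a l x i j = b l x i j) : a = b :=
  funext fun l => ContinuousMap.ext fun x => CStarMatrix.ext (h l x)

theorem ι_one_apply (l : Fin R) (x : D.X l) : D.ι l 1 x = 1 := by
  have h : D.ι l 1 = 1 := (D.ι l).map_one'
  rw [h]; rfl

theorem ι_mul_apply (l : Fin R) (b b' : B) (x : D.X l) :
    D.ι l (b * b') x = D.ι l b x * D.ι l b' x := by
  have h : D.ι l (b * b') = D.ι l b * D.ι l b' := map_mul (D.ι l) b b'
  rw [h]; rfl

theorem ι_add_apply (l : Fin R) (b b' : B) (x : D.X l) :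
    D.ι l (b + b') x = D.ι l b x + D.ι l b' x := by
  have h : D.ι l (b + b') = D.ι l b + D.ι l b' := map_add (D.ι l) b b'
  rw [h]; rfl

theorem ι_smul_apply (l : Fin R) (c : ℂ) (b : B) (x : D.X l) :
    D.ι l (c • b) x = c • D.ι l b x := by
  have h : D.ι l (c • b) = c • D.ι l b := map_smul (D.ι l) c b
  rw [h]; rfl

theorem ι_star_apply (l : Fin R) (b : B) (x : D.X l) :
    D.ι l (star b) x = star (D.ι l b x) := by
  have h : D.ι l (star b) = star (D.ι l b) := map_star (D.ι l) b
  rw [h]; rfl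

variable (n : ℕ) [NeZero n]

/-- The diagonal embedding of `𝒬ⁿ` in `𝒬`, applied entrywise, as a linear map. -/
noncomputable def ambientDiagLin : (Fin n → D.Ambient) →ₗ[ℂ] D.Ambient where
  toFun c l :=
    { toFun := fun x => CStarMatrix.ofMatrix fun i j => UniversalUHF.diag n fun k => c k l x i j
      continuous_toFun := by
        refine continuous_pi fun i => continuous_pi fun j => ?_
        have h0 : Continuous (UniversalUHF.diag n) :=
          (NonUnitalStarAlgHom.isometry _ (UniversalUHF.diag_injective n)).continuous
        refine h0.comp (continuous_pi fun k => ?_)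
        exact (continuous_apply j).comp ((continuous_apply i).comp (c k l).continuous) }
  map_add' c d := by
    refine D.ambient_ext fun l x i j => ?_
    exact map_add (UniversalUHF.diag n) (fun k => c k l x i j) (fun k => d k l x i j)
  map_smul' r c := by
    refine D.ambient_ext fun l x i j => ?_
    exact map_smul (UniversalUHF.diag n) r (fun k => c k l x i j)

/-- The diagonal embedding of `𝒬ⁿ` in `𝒬`, applied entrywise. -/
noncomputable def ambientDiag : (Fin n → D.Ambient) →⋆ₐ[ℂ] D.Ambient :=
  StarAlgHom.ofLinear (D.ambientDiagLin n)
    (by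
      refine D.ambient_ext fun l x i j => ?_
      change UniversalUHF.diag n (fun k => (1 : CMat (D.r l) UniversalUHF) i j) =
        (1 : CMat (D.r l) UniversalUHF) i j
      rw [CStarMatrix.one_apply]
      split_ifs
      · exact map_one _
      · exact map_zero (UniversalUHF.diag n))
    (fun c d => by
      refine D.ambient_ext fun l x i j => ?_
      change UniversalUHF.diag n (fun k => (c k l x * d k l x) i j) = ∑ m,
        UniversalUHF.diag n (fun k => c k l x i m) * UniversalUHF.diag n (fun k => d k l x m j)
      simp only [← map_mul, ← map_sum]
      congr 1
      ext1 k
      rw [CStarMatrix.mul_apply, Finset.sum_apply]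
      rfl)
    (fun c => by
      refine D.ambient_ext fun l x i j => ?_
      exact map_star (UniversalUHF.diag n) (fun k => c k l x j i))

theorem ambientDiag_apply (c : Fin n → D.Ambient) (l : Fin R) (x : D.X l) (i j : Fin (D.r l)) :
    D.ambientDiag n c l x i j = UniversalUHF.diag n fun k => c k l x i j := rfl

theorem ambientDiag_injective : Function.Injective (D.ambientDiag n) := by
  intro c d h
  ext1 k
  refine D.ambient_ext fun l x i j => ?_
  have h1 : D.ambientDiag n c l x i j = D.ambientDiag n d l x i j := by rw [h]
  rw [ambientDiag_apply, ambientDiag_apply] at h1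
  exact congrFun (UniversalUHF.diag_injective n h1) k

theorem _root_.UniversalUHF.diag_single (k : Fin n) (q : UniversalUHF) :
    UniversalUHF.diag n (Pi.single k q) = UniversalUHF.corner n k q := by
  rw [UniversalUHF.diag_apply, Finset.sum_eq_single k]
  · rw [Pi.single_eq_same]
  · intro j _ hj
    rw [Pi.single_eq_of_ne hj, map_zero]
  · simp

theorem ambientDiag_single (k : Fin n) (b : B) (q : UniversalUHF) :
    D.ambientDiag n (Pi.single k (D.pureTensor b q)) =
      D.pureTensor b (UniversalUHF.corner n k q) := by
  refine D.ambient_ext fun l x i j => ?_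
  rw [ambientDiag_apply, pureTensor_apply, ← map_smul, ← UniversalUHF.diag_single]
  congr 1
  ext1 k'
  by_cases h : k' = k
  · subst h; simp [pureTensor_apply]
  · simp only [Pi.single_eq_of_ne h]; rfl

theorem pureTensor_one : D.pureTensor 1 1 = 1 := by
  refine D.ambient_ext fun l x i j => ?_
  rw [pureTensor_apply, ι_one_apply]
  change (1 : CMat (D.r l) ℂ) i j • (1 : UniversalUHF) = (1 : CMat (D.r l) UniversalUHF) i j
  rw [CStarMatrix.one_apply, CStarMatrix.one_apply]
  split_ifs <;> simp

/-- On elementary tensors the embedding acts only on the factor from 𝒬, by the corner embedding.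
Generators therefore stay in B ⊗ 𝒬, and continuity takes care of the closure. -/
theorem ambientDiag_single_mem (k : Fin n) {c : D.Ambient} (hc : c ∈ D.tensorSubalgebra) :
    D.ambientDiag n (Pi.single k c) ∈ D.tensorSubalgebra := by
  have key : ∀ c ∈ StarAlgebra.adjoin ℂ
      (Set.range fun bq : B × UniversalUHF => D.pureTensor bq.1 bq.2),
      D.ambientDiag n (Pi.single k c) ∈ D.tensorSubalgebra := by
    intro c hc
    induction hc using StarAlgebra.adjoin_induction with
    | mem x hx =>
      obtain ⟨⟨b, q⟩, rfl⟩ := hx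
      rw [ambientDiag_single]
      exact (D.tmul b _ : D.tensorSubalgebra).2
    | algebraMap r =>
      rw [Algebra.algebraMap_eq_smul_one, ← pureTensor_one, Pi.single_smul, map_smul,
        ambientDiag_single]
      exact D.tensorSubalgebra.smul_mem (D.tmul 1 _ : D.tensorSubalgebra).2 r
    | add x y _ _ hx hy => rw [Pi.single_add, map_add]; exact add_mem hx hy
    | mul x y _ _ hx hy => rw [pi_single_mul_single, map_mul]; exact mul_mem hx hy
    | star x _ hx => rw [pi_single_star', map_star]; exact star_mem hx
  have hcont : Continuous fun c : D.Ambient => D.ambientDiag n (Pi.single k c) :=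
    (NonUnitalStarAlgHom.isometry _ (D.ambientDiag_injective n)).continuous.comp
      (continuous_pi_single k)
  exact closure_minimal (s := (StarAlgebra.adjoin ℂ
    (Set.range fun bq : B × UniversalUHF => D.pureTensor bq.1 bq.2) : Set D.Ambient))
    (fun T hT => key T hT) (tensorSubalgebra.isClosed D |>.preimage hcont) hc

theorem ambientDiag_mem {c : Fin n → D.Ambient} (hc : ∀ k, c k ∈ D.tensorSubalgebra) :
    D.ambientDiag n c ∈ D.tensorSubalgebra := by
  rw [← Finset.univ_sum_single c, map_sum]
  exact sum_mem fun k _ => D.ambientDiag_single_mem n k (hc k)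

/-- The diagonal embedding of `(B ⊗ 𝒬)ⁿ` in `B ⊗ 𝒬` as a function. -/
noncomputable def tensorDiagFun (c : Fin n → D.TensorUHF) : D.TensorUHF :=
  (⟨D.ambientDiag n fun k => D.tensorIncl (c k),
    D.ambientDiag_mem n fun k => (c k : D.tensorSubalgebra).2⟩ : D.tensorSubalgebra)

theorem tensorIncl_tensorDiagFun (c : Fin n → D.TensorUHF) :
    D.tensorIncl (D.tensorDiagFun n c) =
      D.ambientDiag n (piStarAlgHom (fun k => D.tensorIncl.comp (Pi.evalStarAlgHom ℂ _ k)) c) := rfl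

/-- The diagonal embedding of `(B ⊗ 𝒬)ⁿ` in `B ⊗ 𝒬`. -/
noncomputable def tensorDiag : (Fin n → D.TensorUHF) →⋆ₐ[ℂ] D.TensorUHF :=
  StarAlgHom.ofLinear
    { toFun := D.tensorDiagFun n
      map_add' := fun c d => by
        apply D.tensorIncl_injective
        simp only [tensorIncl_tensorDiagFun, map_add]
      map_smul' := fun r c => by
        apply D.tensorIncl_injective
        simp only [tensorIncl_tensorDiagFun, map_smul, RingHom.id_apply] }
    (by
      apply D.tensorIncl_injective
      change D.tensorIncl (D.tensorDiagFun n 1) = _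
      simp only [tensorIncl_tensorDiagFun, map_one])
    (fun c d => by
      apply D.tensorIncl_injective
      change D.tensorIncl (D.tensorDiagFun n (c * d)) =
        D.tensorIncl (D.tensorDiagFun n c * D.tensorDiagFun n d)
      simp only [tensorIncl_tensorDiagFun, map_mul])
    (fun c => by
      apply D.tensorIncl_injective
      change D.tensorIncl (D.tensorDiagFun n (star c)) = D.tensorIncl (star (D.tensorDiagFun n c))
      simp only [tensorIncl_tensorDiagFun, map_star])

theorem tensorIncl_tensorDiag (c : Fin n → D.TensorUHF) :
    D.tensorIncl (D.tensorDiag n c) = D.ambientDiag n fun k => D.tensorIncl (c k) := rfl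

theorem tensorDiag_injective : Function.Injective (D.tensorDiag n) := by
  intro c d h
  ext1 k
  apply D.tensorIncl_injective
  have h1 := congrArg D.tensorIncl h
  rw [tensorIncl_tensorDiag, tensorIncl_tensorDiag] at h1
  exact congrFun (D.ambientDiag_injective n h1) k

theorem norm_tensorDiag (c : Fin n → D.TensorUHF) : ‖D.tensorDiag n c‖ = ‖c‖ :=
  NonUnitalStarAlgHom.norm_map (D.tensorDiag n) (D.tensorDiag_injective n) c

theorem tensorDiag_tmul (b : B) (q : Fin n → UniversalUHF) :
    D.tensorDiag n (fun k => D.tmul b (q k)) = D.tmul b (UniversalUHF.diag n q) := by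
  apply D.tensorIncl_injective
  rw [tensorIncl_tensorDiag]
  refine D.ambient_ext fun l x i j => ?_
  rw [ambientDiag_apply]
  simp only [tensorIncl_tmul, pureTensor_apply]
  rw [← map_smul]
  rfl

theorem tensorDiag_single_tmul (k : Fin n) (b : B) (q : UniversalUHF) :
    D.tensorDiag n (Pi.single k (D.tmul b q)) = D.tmul b (UniversalUHF.corner n k q) := by
  rw [← UniversalUHF.diag_single, ← tensorDiag_tmul]
  congr 1
  ext1 k'
  by_cases h : k' = k
  · subst h; simp
  · simp only [Pi.single_eq_of_ne h]
    apply D.tensorIncl_injective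
    rw [map_zero, tensorIncl_tmul]
    refine D.ambient_ext fun l x i j => ?_
    rw [pureTensor_apply, smul_zero]
    rfl

theorem tmul_mul_tmul (b b' : B) (q q' : UniversalUHF) :
    D.tmul b q * D.tmul b' q' = D.tmul (b * b') (q * q') := by
  apply D.tensorIncl_injective
  rw [map_mul]
  refine D.ambient_ext fun l x i j => ?_
  simp only [tensorIncl_tmul, pureTensor_apply]
  change (D.pureTensor b q l x * D.pureTensor b' q' l x) i j = _
  rw [CStarMatrix.mul_apply, ι_mul_apply, CStarMatrix.mul_apply, Finset.sum_smul]
  refine Finset.sum_congr rfl fun m _ => ?_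
  rw [pureTensor_apply, pureTensor_apply, smul_mul_smul_comm]

theorem star_tmul (b : B) (q : UniversalUHF) : star (D.tmul b q) = D.tmul (star b) (star q) := by
  apply D.tensorIncl_injective
  rw [map_star]
  refine D.ambient_ext fun l x i j => ?_
  simp only [tensorIncl_tmul, pureTensor_apply]
  change star (D.pureTensor b q l x j i) = _
  rw [pureTensor_apply, star_smul, ι_star_apply]
  rfl

theorem tmul_one_one : D.tmul 1 1 = 1 := by
  apply D.tensorIncl_injective
  rw [tensorIncl_tmul, pureTensor_one, map_one]

theorem tmul_add (b b' : B) (q : UniversalUHF) :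
    D.tmul (b + b') q = D.tmul b q + D.tmul b' q := by
  apply D.tensorIncl_injective
  rw [map_add]
  refine D.ambient_ext fun l x i j => ?_
  rw [tensorIncl_tmul, pureTensor_apply, ι_add_apply]
  exact add_smul _ _ _

theorem tmul_smul (c : ℂ) (b : B) (q : UniversalUHF) : D.tmul (c • b) q = c • D.tmul b q := by
  apply D.tensorIncl_injective
  rw [map_smul]
  refine D.ambient_ext fun l x i j => ?_
  rw [tensorIncl_tmul, pureTensor_apply, ι_smul_apply]
  exact smul_assoc c (D.ι l b x i j) q

end RSHDecomposition

/-! ### Completely positive maps -/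

section CompletelyPositive

variable {A A' C C' : Type*} [CStarAlgebra A] [CStarAlgebra A'] [CStarAlgebra C] [CStarAlgebra C']

theorem IsCompletelyPositive.comp_hom {σ : A →ₗ[ℂ] C} (h : IsCompletelyPositive σ)
    (π : A' →⋆ₐ[ℂ] A) : IsCompletelyPositive (σ ∘ₗ (π : A' →ₗ[ℂ] A)) := by
  let _ := CStarAlgebra.spectralOrder A
  let _ := CStarAlgebra.spectralOrder C
  have := CStarAlgebra.spectralOrderedRing A
  have := CStarAlgebra.spectralOrderedRing C
  let _ := CStarAlgebra.spectralOrder A'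
  have := CStarAlgebra.spectralOrderedRing A'
  obtain ⟨f, rfl⟩ := h
  exact ⟨{ toLinearMap := f.toLinearMap ∘ₗ (π : A' →ₗ[ℂ] A)
           map_cstarMatrix_nonneg' := fun k M hM => f.map_cstarMatrix_nonneg' k _
             (CompletelyPositiveMapClass.map_cstarMatrix_nonneg' π k M hM) }, rfl⟩

theorem IsCompletelyPositive.hom_comp {σ : A →ₗ[ℂ] C} (h : IsCompletelyPositive σ)
    (π : C →⋆ₐ[ℂ] C') : IsCompletelyPositive ((π : C →ₗ[ℂ] C') ∘ₗ σ) := by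
  let _ := CStarAlgebra.spectralOrder A
  let _ := CStarAlgebra.spectralOrder C
  have := CStarAlgebra.spectralOrderedRing A
  have := CStarAlgebra.spectralOrderedRing C
  let _ := CStarAlgebra.spectralOrder C'
  have := CStarAlgebra.spectralOrderedRing C'
  obtain ⟨f, rfl⟩ := h
  exact ⟨{ toLinearMap := (π : C →ₗ[ℂ] C') ∘ₗ f.toLinearMap
           map_cstarMatrix_nonneg' := fun k M hM =>
             CompletelyPositiveMapClass.map_cstarMatrix_nonneg' π k _
               (f.map_cstarMatrix_nonneg' k M hM) }, rfl⟩

/-- A map all of whose amplifications send `star N * N` to a sum of elements `star T * T` is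
completely positive. -/
theorem IsCompletelyPositive.of_eq_sum {σ : A →ₗ[ℂ] C} {ι : Type*} [Fintype ι]
    (η : ι → A →ₗ[ℂ] C) (h : ∀ a b : A, σ (star a * b) = ∑ m, star (η m a) * η m b) :
    IsCompletelyPositive σ := by
  let _ := CStarAlgebra.spectralOrder A
  let _ := CStarAlgebra.spectralOrder C
  have := CStarAlgebra.spectralOrderedRing A
  have := CStarAlgebra.spectralOrderedRing C
  refine ⟨{ toLinearMap := σ, map_cstarMatrix_nonneg' := fun k M hM => ?_ }, rfl⟩
  obtain ⟨N, rfl⟩ := exists_eq_star_mul_self hM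
  have h2 : (star N * N).map σ = ∑ m, star (N.map (η m)) * N.map (η m) := by
    ext i j
    have h3 : ∀ f : ι → CStarMatrix (Fin k) (Fin k) C, (∑ m, f m) i j = ∑ m, f m i j := fun f => by
      exact Matrix.sum_apply i j Finset.univ f
    rw [h3, CStarMatrix.map_apply, CStarMatrix.mul_apply, map_sum]
    simp only [CStarMatrix.mul_apply, CStarMatrix.star_apply, h, CStarMatrix.map_apply]
    rw [Finset.sum_comm]
  change 0 ≤ (star N * N).map σ
  rw [h2]
  exact Finset.sum_nonneg fun m _ => star_mul_self_nonneg _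

/-- Positivity of a matrix over a product is tested by writing it as N* N. The matrices N found in
the components assemble to one over the product. -/
theorem IsCompletelyPositive.pi {ι : Type*} [Fintype ι] {F : ι → Type*} [∀ k, CStarAlgebra (F k)]
    {σ : ∀ k, A →ₗ[ℂ] F k} (h : ∀ k, IsCompletelyPositive (σ k)) :
    IsCompletelyPositive (LinearMap.pi σ) := by
  classical
  let _ := CStarAlgebra.spectralOrder A
  have := CStarAlgebra.spectralOrderedRing A
  let _ := CStarAlgebra.spectralOrder (∀ k, F k)
  have := CStarAlgebra.spectralOrderedRing (∀ k, F k)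
  refine ⟨{ toLinearMap := LinearMap.pi σ, map_cstarMatrix_nonneg' := fun m M hM => ?_ }, rfl⟩
  have hN : ∀ k, ∃ N : CStarMatrix (Fin m) (Fin m) (F k), M.map (σ k) = star N * N := fun k => by
    let _ := CStarAlgebra.spectralOrder (F k)
    have := CStarAlgebra.spectralOrderedRing (F k)
    obtain ⟨f, hf⟩ := h k
    obtain ⟨N, hN⟩ := exists_eq_star_mul_self (f.map_cstarMatrix_nonneg' m M hM)
    refine ⟨N, ?_⟩
    rw [← hN, ← hf]
  choose N hN using hN
  have h2 : M.map (LinearMap.pi σ) =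
      star (CStarMatrix.ofMatrix fun i j k => N k i j : CStarMatrix (Fin m) (Fin m) (∀ k, F k)) *
        CStarMatrix.ofMatrix fun i j k => N k i j := by
    ext i j k
    have h3 : (M.map (σ k)) i j = (star (N k) * N k) i j := by rw [hN]
    rw [CStarMatrix.mul_apply] at h3 ⊢
    rw [Finset.sum_apply]
    exact h3
  change 0 ≤ M.map (LinearMap.pi σ)
  rw [h2]
  exact star_mul_self_nonneg _

end CompletelyPositive

/-! ### Orthogonal sums of order zero maps -/

section OrderZero

variable {B : Type*} [CStarAlgebra B] {R : ℕ} {D : RSHDecomposition B R} {n : ℕ} [NeZero n]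

theorem norm_tensorDiag_single (k : Fin n) (c : D.TensorUHF) :
    ‖D.tensorDiag n (Pi.single k c)‖ = ‖c‖ := by
  rw [D.norm_tensorDiag, Pi.norm_single]

theorem tmul_one_eq_tensorDiag (b : B) :
    D.tmul b 1 = D.tensorDiag n fun _ => D.tmul b 1 := by
  rw [D.tensorDiag_tmul n b fun _ => 1]
  congr 1
  exact (map_one _).symm

/-- The diagonal sum of linear maps to `B ⊗ 𝒬`. -/
noncomputable def diagMap {E : Fin n → Type*} [∀ k, CStarAlgebra (E k)]
    (σ : ∀ k, E k →ₗ[ℂ] D.TensorUHF) : (∀ k, E k) →ₗ[ℂ] D.TensorUHF :=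
  (D.tensorDiag n : _ →ₗ[ℂ] D.TensorUHF) ∘ₗ
    LinearMap.pi fun k => σ k ∘ₗ (Pi.evalStarAlgHom ℂ E k : _ →ₗ[ℂ] E k)

theorem diagMap_apply {E : Fin n → Type*} [∀ k, CStarAlgebra (E k)]
    (σ : ∀ k, E k →ₗ[ℂ] D.TensorUHF) (e : ∀ k, E k) :
    diagMap σ e = D.tensorDiag n fun k => σ k (e k) := rfl

theorem StarAlgHom.mul_sub_apply {C C' : Type*} [CStarAlgebra C] [CStarAlgebra C']
    (f : C →⋆ₐ[ℂ] C') (a b c : C) : f a * f b - f c = f (a * b - c) := by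
  rw [map_sub, map_mul]

/-- The element b ⊗ 1 is itself diagonal with constant entries. The excision defect of a diagonal
sum is thus the diagonal sum of the defects, and its norm is their maximum: the tolerance does not
grow. -/
theorem diagMap_excise {E : Fin n → Type*} [∀ k, CStarAlgebra (E k)]
    (σ : ∀ k, E k →ₗ[ℂ] D.TensorUHF) (b : B) (e : ∀ k, E k) :
    diagMap σ 1 * D.tmul b 1 - diagMap σ e =
      D.tensorDiag n fun k => σ k 1 * D.tmul b 1 - σ k (e k) := by
  have h : D.tensorDiag n (fun k => σ k 1) * D.tensorDiag n (fun _ => D.tmul b 1) -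
      D.tensorDiag n (fun k => σ k (e k)) = D.tensorDiag n fun k =>
        σ k 1 * D.tmul b 1 - σ k (e k) :=
    StarAlgHom.mul_sub_apply (D.tensorDiag n) _ _ _
  rwa [← tmul_one_eq_tensorDiag] at h

theorem IsIsometricOrderZero.diagMap {E : Fin n → Type*} [∀ k, CStarAlgebra (E k)]
    {σ : ∀ k, E k →ₗ[ℂ] D.TensorUHF} (h : ∀ k, IsIsometricOrderZero (σ k)) :
    IsIsometricOrderZero (diagMap σ) where
  completelyPositive := (IsCompletelyPositive.pi fun k =>
    (h k).completelyPositive.comp_hom _).hom_comp _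
  orderZero := by
    rintro a b ⟨c, hc⟩ ⟨d, hd⟩ hab
    rw [diagMap_apply, diagMap_apply, ← map_mul]
    convert map_zero (D.tensorDiag n) using 2
    ext1 k
    exact (h k).orderZero (a k) (b k) ⟨c k, congrFun hc k⟩ ⟨d k, congrFun hd k⟩ (congrFun hab k)
  isometric a := by
    rw [diagMap_apply, D.norm_tensorDiag, Pi.norm_def, Pi.norm_def]
    congr 2
    ext1 k
    exact NNReal.eq ((h k).isometric (a k))

/-- The composition of a linear map to `B ⊗ 𝒬` with the embedding of the `k`-th corner. -/
noncomputable def cornerMap {E : Type*} [CStarAlgebra E] (k : Fin n) (σ : E →ₗ[ℂ] D.TensorUHF) :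
    E →ₗ[ℂ] D.TensorUHF :=
  (D.tensorDiag n : _ →ₗ[ℂ] D.TensorUHF) ∘ₗ LinearMap.pi fun j => if j = k then σ else 0

theorem cornerMap_apply {E : Type*} [CStarAlgebra E] (k : Fin n) (σ : E →ₗ[ℂ] D.TensorUHF)
    (e : E) : cornerMap k σ e = D.tensorDiag n (Pi.single k (σ e)) := by
  change D.tensorDiag n _ = _
  congr 1
  ext1 j
  by_cases hj : j = k
  · subst hj; simp
  · simp [hj]

theorem IsIsometricOrderZero.cornerMap {E : Type*} [CStarAlgebra E] (k : Fin n)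
    {σ : E →ₗ[ℂ] D.TensorUHF} (h : IsIsometricOrderZero σ) :
    IsIsometricOrderZero (cornerMap k σ) where
  completelyPositive := by
    refine (IsCompletelyPositive.pi fun j => ?_).hom_comp _
    split_ifs
    · exact h.completelyPositive
    -- The components other than the k-th are zero maps, written as empty sums.
    · exact IsCompletelyPositive.of_eq_sum (ι := Fin 0) (fun _ => 0) fun a b => by simp
  orderZero a b ha hb hab := by
    rw [cornerMap_apply, cornerMap_apply, ← map_mul, ← pi_single_mul_single,
      h.orderZero a b ha hb hab, Pi.single_zero, map_zero]
  isometric a := by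
    rw [cornerMap_apply, norm_tensorDiag_single, h.isometric]

end OrderZero

/-! ### Orthogonal sums of excisors -/

namespace ExcisorData

variable {B : Type*} [CStarAlgebra B] {R : ℕ} {D : RSHDecomposition B R}

/-- The homomorphism `κ ∘ ρ`. -/
noncomputable def total (V : ExcisorData D) : B →⋆ₐ[ℂ] UniversalUHF := V.κ.comp V.ρ

/-- The same excisor with another weight homomorphism. -/
noncomputable def withκ (V : ExcisorData D) (κ : V.E →⋆ₐ[ℂ] UniversalUHF) : ExcisorData D where
  E := V.E
  finiteDim := V.finiteDim
  ρ := V.ρ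
  σ := V.σ
  κ := κ

/-- No condition on a weighted excisor involves κ. This freedom is used for moving κ along paths of
unitaries. -/
theorem IsWeightedExcisor.withκ {F : Finset B} {η : ℝ} {V : ExcisorData D}
    (h : V.IsWeightedExcisor F η) (κ : V.E →⋆ₐ[ℂ] UniversalUHF) :
    (V.withκ κ).IsWeightedExcisor F η :=
  ⟨h.orderZero, h.excises, h.compatible⟩

variable {n : ℕ} [NeZero n]

/-- The diagonal sum of finitely many excisors, with a given weight homomorphism. -/
noncomputable def diagSum (V : Fin n → ExcisorData D)
    (κ : (∀ k, (V k).E) →⋆ₐ[ℂ] UniversalUHF) : ExcisorData D where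
  E := ∀ k, (V k).E
  finiteDim := by
    have := fun k => (V k).finiteDim
    infer_instance
  ρ := piStarAlgHom fun k => (V k).ρ
  σ := diagMap fun k => (V k).σ
  κ := κ

/-- At the index l the components of all summands are collected, and the union of their finitely
many compact sets is used; the given factorisations are precomposed with restriction. -/
theorem IsCompatible.diagSum {V : Fin n → ExcisorData D} (h : ∀ k, (V k).IsCompatible)
    (κ : (∀ k, (V k).E) →⋆ₐ[ℂ] UniversalUHF) : (diagSum V κ).IsCompatible := by
  choose E' instE e he using h
  choose K hK hKΩ ρ' hρ' using he
  have hcpt : ∀ l, CompactSpace ↥(⋃ k, K k l) := fun l =>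
    isCompact_iff_compactSpace.mp (isCompact_iUnion fun k => hK k l)
  refine ⟨fun l => ∀ k, E' k l, fun l => instCStarAlgebraForall,
    StarAlgEquiv.ofBijective (piStarAlgHom fun l => piStarAlgHom fun k =>
      ((Pi.evalStarAlgHom ℂ (E' k) l).comp (e k : (V k).E →⋆ₐ[ℂ] _)).comp
        (Pi.evalStarAlgHom ℂ (fun k => (V k).E) k)) ⟨?_, ?_⟩, fun l => ⟨⋃ k, K k l, ?_, ?_, ?_⟩⟩
  · intro a b hab
    refine funext fun k => ?_
    apply (e k).injective
    ext1 l
    exact congrFun (congrFun hab l) k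
  · intro c
    refine ⟨fun k => (e k).symm fun l => c l k, ?_⟩
    ext l k
    exact congrFun ((e k).apply_symm_apply fun l => c l k) l
  · exact isCompact_iUnion fun k => hK k l
  · exact Set.iUnion_subset fun k => hKΩ k l
  · refine ⟨piStarAlgHom (A := C(↥(⋃ k, K k l), CMat (D.r l) ℂ)) fun k => (ρ' k l).comp (ContinuousMap.compStarAlgHom' ℂ _
      ⟨Set.inclusion (Set.subset_iUnion (fun k => K k l) k), continuous_inclusion _⟩), fun b => ?_⟩
    ext k
    exact hρ' k l b

theorem IsWeightedExcisor.diagSum {F : Finset B} {η : ℝ} (hη : 0 < η) {V : Fin n → ExcisorData D}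
    (h : ∀ k, (V k).IsWeightedExcisor F η) (κ : (∀ k, (V k).E) →⋆ₐ[ℂ] UniversalUHF) :
    (diagSum V κ).IsWeightedExcisor F η where
  orderZero := IsIsometricOrderZero.diagMap fun k => (h k).orderZero
  excises b hb := by
    change ‖diagMap (fun k => (V k).σ) 1 * D.tmul b 1 -
        diagMap (fun k => (V k).σ) (piStarAlgHom (fun k => (V k).ρ) b)‖ < η
    rw [diagMap_excise, D.norm_tensorDiag]
    exact (pi_norm_lt_iff hη).2 fun k => (h k).excises b hb
  compatible := IsCompatible.diagSum (fun k => (h k).compatible) κ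

/-- The excisor `V`, moved to the `k`-th of `n` orthogonal corners of `B ⊗ 𝒬`. -/
noncomputable def toCorner (n : ℕ) [NeZero n] (k : Fin n) (V : ExcisorData D) : ExcisorData D where
  E := V.E
  finiteDim := V.finiteDim
  ρ := V.ρ
  σ := cornerMap k V.σ
  κ := V.κ

/-- This identifies the direct sum of excisors required in the proposition with the diagonal sum,
for which the excisor properties are known. -/
theorem sum_toCorner [NeZero R] (V : Fin R → ExcisorData D)
    (κ : (∀ k, (V k).E) →⋆ₐ[ℂ] UniversalUHF) :
    sum (fun l => (V l).toCorner R l) κ = diagSum V κ := by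
  have h : (∑ l, cornerMap l (V l).σ ∘ₗ LinearMap.proj l : (∀ l, (V l).E) →ₗ[ℂ] D.TensorUHF) =
      diagMap fun l => (V l).σ := by
    refine LinearMap.ext fun e => ?_
    rw [LinearMap.sum_apply]
    simp only [LinearMap.comp_apply, cornerMap_apply, LinearMap.proj_apply]
    rw [← map_sum, Finset.univ_sum_single]
    rfl
  unfold sum diagSum
  congr 1

theorem pairwiseOrthogonal_toCorner [NeZero R] (V : Fin R → ExcisorData D) :
    PairwiseOrthogonal fun l => (V l).toCorner R l := by
  refine ⟨fun l => UniversalUHF.unit R l l, fun l => ⟨?_, UniversalUHF.star_unit R l l⟩,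
    fun l m h => ?_, fun l e => ?_⟩
  · rw [IsIdempotentElem, UniversalUHF.unit_mul, if_pos rfl]
  · rw [UniversalUHF.unit_mul, if_neg h]
  · have h : cornerMap l (V l).σ e = D.tensorDiag R (Pi.single l ((V l).σ e)) :=
      cornerMap_apply l _ e
    change D.tmul 1 (UniversalUHF.unit R l l) * cornerMap l (V l).σ e *
      D.tmul 1 (UniversalUHF.unit R l l) = cornerMap l (V l).σ e
    rw [h, ← UniversalUHF.corner_one, ← D.tensorDiag_single_tmul, ← map_mul, ← map_mul,
      ← pi_single_mul_single, ← pi_single_mul_single, D.tmul_one_one, one_mul, mul_one]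

theorem IsWeightedExcisor.toCorner {F : Finset B} {η : ℝ} {V : ExcisorData D}
    (h : V.IsWeightedExcisor F η) (k : Fin n) : (V.toCorner n k).IsWeightedExcisor F η where
  orderZero := h.orderZero.cornerMap k
  excises b hb := by
    have h2 : cornerMap k V.σ 1 * D.tmul b 1 - cornerMap k V.σ (V.ρ b) =
        D.tensorDiag n (Pi.single k (V.σ 1 * D.tmul b 1 - V.σ (V.ρ b))) := by
      rw [cornerMap_apply, cornerMap_apply, tmul_one_eq_tensorDiag (n := n), ← map_mul, ← map_sub]
      congr 1
      ext1 j
      by_cases hj : j = k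
      · subst hj
        simp only [Pi.sub_apply, Pi.mul_apply, Pi.single_eq_same]
        rw [← tmul_one_eq_tensorDiag]
      · simp [hj]
    change ‖cornerMap k V.σ 1 * D.tmul b 1 - cornerMap k V.σ (V.ρ b)‖ < η
    rw [h2, norm_tensorDiag_single]
    exact h.excises b hb
  compatible := h.compatible

end ExcisorData

/-! ### Bridges between homomorphisms -/

section Bridges

variable {B : Type*} [CStarAlgebra B] {R : ℕ} (D : RSHDecomposition B R) (F : Finset B) (η : ℝ)

/-- The homomorphism `θ : B → 𝒬` is `κ ∘ ρ` for a weighted excisor. -/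
def Excised (θ : B →⋆ₐ[ℂ] UniversalUHF) : Prop :=
  ∃ V : ExcisorData D, V.IsWeightedExcisor F η ∧ V.total = θ

/-- Excised homomorphisms which are `η`-close on `F`. -/
def HomStep (θ θ' : B →⋆ₐ[ℂ] UniversalUHF) : Prop :=
  Excised D F η θ ∧ Excised D F η θ' ∧ ∀ b ∈ F, ‖θ b - θ' b‖ < η

/-- Chains of homomorphisms with successive members `η`-close on `F`. -/
def HomBridge : (B →⋆ₐ[ℂ] UniversalUHF) → (B →⋆ₐ[ℂ] UniversalUHF) → Prop :=
  Relation.TransGen (HomStep D F η)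

variable {D F η}

theorem ExcisorData.IsWeightedExcisor.excised {V : ExcisorData D} (h : V.IsWeightedExcisor F η) :
    Excised D F η V.total := ⟨V, h, rfl⟩

theorem HomStep.symm {θ θ' : B →⋆ₐ[ℂ] UniversalUHF} (h : HomStep D F η θ θ') :
    HomStep D F η θ' θ :=
  ⟨h.2.1, h.1, fun b hb => by rw [norm_sub_rev]; exact h.2.2 b hb⟩

theorem HomBridge.symm {θ θ' : B →⋆ₐ[ℂ] UniversalUHF} (h : HomBridge D F η θ θ') :
    HomBridge D F η θ' θ := by
  induction h with
  | single h => exact .single h.symm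
  | tail _ h ih => exact Relation.TransGen.head h.symm ih

theorem HomBridge.trans {θ θ' θ'' : B →⋆ₐ[ℂ] UniversalUHF} (h : HomBridge D F η θ θ')
    (h' : HomBridge D F η θ' θ'') : HomBridge D F η θ θ'' :=
  Relation.TransGen.trans h h'

theorem Excised.refl {θ : B →⋆ₐ[ℂ] UniversalUHF} (h : Excised D F η θ) (hη : 0 < η) :
    HomBridge D F η θ θ :=
  .single ⟨h, h, fun b _ => by simpa using hη⟩

theorem HomBridge.left {θ θ' : B →⋆ₐ[ℂ] UniversalUHF} (h : HomBridge D F η θ θ') :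
    Excised D F η θ := by
  induction h with
  | single h => exact h.1
  | tail _ _ ih => exact ih

theorem HomBridge.right {θ θ' : B →⋆ₐ[ℂ] UniversalUHF} (h : HomBridge D F η θ θ') :
    Excised D F η θ' := h.symm.left

theorem ExcisorData.Bridge.hom {V W : ExcisorData D} (h : V.Bridge F η W) :
    HomBridge D F η V.total W.total :=
  Relation.TransGen.lift ExcisorData.total
    (fun _ _ h => ⟨h.left.excised, h.right.excised, h.close⟩) _ _ h

/-- The conditions on consecutive members of a chain of excisors involve only their homomorphisms κ
∘ ρ. Any excisors realising the intermediate homomorphisms will do, and the two ends can be chosen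
freely among those with the given compositions. -/
theorem HomBridge.bridge {V W : ExcisorData D} (hV : V.IsWeightedExcisor F η)
    (hW : W.IsWeightedExcisor F η) (h : HomBridge D F η V.total W.total) : V.Bridge F η W := by
  suffices H : ∀ θ, HomBridge D F η V.total θ → ∀ W : ExcisorData D, W.IsWeightedExcisor F η →
      W.total = θ → V.Bridge F η W from H _ h W hW rfl
  intro θ hθ
  induction hθ with
  | single h =>
    rintro W hW rfl
    exact .single ⟨hV, hW, h.2.2⟩
  | tail _ h ih =>
    rintro W hW rfl
    obtain ⟨U, hU, rfl⟩ := h.1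
    exact (ih U hU rfl).tail ⟨hU, hW, h.2.2⟩

/-- The diagonal sum of `n` homomorphisms to `𝒬`. -/
noncomputable def diagHom {A : Type*} [CStarAlgebra A] (n : ℕ) [NeZero n]
    (θ : Fin n → (A →⋆ₐ[ℂ] UniversalUHF)) : A →⋆ₐ[ℂ] UniversalUHF :=
  (UniversalUHF.diag n).comp (piStarAlgHom θ)

theorem diagHom_apply {A : Type*} [CStarAlgebra A] (n : ℕ) [NeZero n]
    (θ : Fin n → (A →⋆ₐ[ℂ] UniversalUHF)) (a : A) :
    diagHom n θ a = UniversalUHF.diag n fun k => θ k a := rfl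

variable {n : ℕ} [NeZero n]

theorem Excised.diagHom (hη : 0 < η) {θ : Fin n → (B →⋆ₐ[ℂ] UniversalUHF)}
    (h : ∀ k, Excised D F η (θ k)) : Excised D F η (diagHom n θ) := by
  choose V hV hθ using h
  refine ⟨ExcisorData.diagSum V ((UniversalUHF.diag n).comp (piStarAlgHom fun k =>
    (V k).κ.comp (Pi.evalStarAlgHom ℂ (fun k => (V k).E) k))), .diagSum hη hV _, ?_⟩
  ext b
  rw [diagHom_apply]
  simp only [← hθ]
  rfl

theorem HomStep.diagHom (hη : 0 < η) {θ θ' : Fin n → (B →⋆ₐ[ℂ] UniversalUHF)}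
    (h : ∀ k, HomStep D F η (θ k) (θ' k)) : HomStep D F η (diagHom n θ) (diagHom n θ') := by
  refine ⟨.diagHom hη fun k => (h k).1, .diagHom hη fun k => (h k).2.1, fun b hb => ?_⟩
  rw [diagHom_apply, diagHom_apply, ← map_sub,
    NonUnitalStarAlgHom.norm_map _ (UniversalUHF.diag_injective n)]
  exact (pi_norm_lt_iff hη).2 fun k => (h k).2.2 b hb

/-- Only one summand moves at a time, since bridges for different summands may have different
lengths. The others rest, which is a step because 0 < η. -/
theorem HomBridge.diagHom_update (hη : 0 < η) {θ : Fin n → (B →⋆ₐ[ℂ] UniversalUHF)}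
    (hθ : ∀ k, Excised D F η (θ k)) (k : Fin n) {θ₁ θ₂ : B →⋆ₐ[ℂ] UniversalUHF}
    (h : HomBridge D F η θ₁ θ₂) :
    HomBridge D F η (diagHom n (Function.update θ k θ₁)) (diagHom n (Function.update θ k θ₂)) := by
  refine Relation.TransGen.lift (fun θ₁ => _root_.diagHom n (Function.update θ k θ₁))
    (fun θ₁ θ₂ h => ?_) _ _ h
  refine HomStep.diagHom hη fun j => ?_
  by_cases hj : j = k
  · subst hj; simpa using h
  · simp only [Function.update_of_ne hj]
    exact ⟨hθ j, hθ j, fun b _ => by simpa using hη⟩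

theorem HomBridge.diagHom (hη : 0 < η) {θ θ' : Fin n → (B →⋆ₐ[ℂ] UniversalUHF)}
    (h : ∀ k, HomBridge D F η (θ k) (θ' k)) :
    HomBridge D F η (diagHom n θ) (diagHom n θ') := by
  suffices H : ∀ s : Finset (Fin n), HomBridge D F η (_root_.diagHom n θ)
      (_root_.diagHom n (s.piecewise θ' θ)) by simpa using H Finset.univ
  intro s
  induction s using Finset.induction_on with
  | empty => simpa using (Excised.diagHom hη fun k => (h k).left).refl hη
  | insert k s hk ih =>
    refine ih.trans ?_
    rw [Finset.piecewise_insert]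
    have h1 : s.piecewise θ' θ = Function.update (s.piecewise θ' θ) k (θ k) := by
      rw [eq_comm, Function.update_eq_self_iff]
      simp [hk]
    rw [h1, Function.update_idem]
    refine HomBridge.diagHom_update hη (fun j => ?_) k (h k)
    by_cases hj : j ∈ s
    · simpa [hj] using (h j).right
    · simpa [hj] using (h j).left

end Bridges

/-! ### Order zero maps on matrix algebras -/

section RowOrderZero

variable {C C' : Type*} [CStarAlgebra C] [CStarAlgebra C'] {r : ℕ}

/-- The rows of the product of a scalar matrix with the column `Y`. -/
noncomputable def rowMap (Y : Fin r → C) (m : Fin r) : CMat r ℂ →ₗ[ℂ] C where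
  toFun a := ∑ j, a m j • Y j
  map_add' a b := by simp [add_smul, Finset.sum_add_distrib]
  map_smul' c a := by simp [Finset.smul_sum, smul_smul]

theorem rowMap_apply (Y : Fin r → C) (m : Fin r) (a : CMat r ℂ) :
    rowMap Y m a = ∑ j, a m j • Y j := rfl

theorem rowMap_one (Y : Fin r → C) (m : Fin r) : rowMap Y m 1 = Y m := by
  rw [rowMap_apply, Finset.sum_eq_single m]
  · simp
  · intro j _ hj; simp [CStarMatrix.one_apply_ne hj.symm]
  · simp

/-- The map `a ↦ ∑ a i j • Y i* k Y j`. -/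
noncomputable def compressMap (Y : Fin r → C) (k : C) : CMat r ℂ →ₗ[ℂ] C :=
  ∑ m, (LinearMap.mulLeft ℂ (star (Y m) * k)) ∘ₗ rowMap Y m

theorem compressMap_apply (Y : Fin r → C) (k : C) (a : CMat r ℂ) :
    compressMap Y k a = ∑ m, star (Y m) * k * rowMap Y m a := by
  rw [compressMap, LinearMap.sum_apply]; rfl

theorem compressMap_star_mul (Y : Fin r → C) (k : C) (a b : CMat r ℂ) :
    compressMap Y k (star a * b) = ∑ m, star (rowMap Y m a) * k * rowMap Y m b := by
  simp only [compressMap_apply, rowMap_apply, star_sum, star_smul, Finset.sum_mul, Finset.mul_sum,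
    CStarMatrix.mul_apply, CStarMatrix.star_apply, Finset.sum_smul, mul_smul_comm, smul_mul_assoc,
    Finset.smul_sum, smul_smul]
  rw [Finset.sum_congr rfl fun m _ => Finset.sum_comm, Finset.sum_comm]
  refine Finset.sum_congr rfl fun m _ => ?_
  rw [Finset.sum_comm]
  refine Finset.sum_congr rfl fun i _ => Finset.sum_congr rfl fun j _ => ?_
  rw [mul_comm]

theorem star_compressMap (Y : Fin r → C) {k : C} (hk : star k = k) (a : CMat r ℂ) :
    star (compressMap Y k a) = compressMap Y k (star a) := by
  have h1 := compressMap_star_mul Y k a 1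
  rw [mul_one] at h1
  rw [h1, compressMap_apply, star_sum]
  refine Finset.sum_congr rfl fun m _ => ?_
  rw [rowMap_one, star_mul, star_mul, star_star, hk, mul_assoc]

variable {Y : Fin r → C} {g : C} (hY : ∀ i j, Y i * star (Y j) = if i = j then g else 0)

include hY

/-- The multiplicative law of an order zero map, φ(a) φ(b) = φ(1) φ(ab), in the form in which the
defect g = Y i (Y i)* is placed in the middle. Orthogonality preservation is immediate from it. -/
theorem compressMap_mul (a b : CMat r ℂ) :
    compressMap Y 1 a * compressMap Y 1 b = compressMap Y g (a * b) := by
  have h1 : ∀ m n, rowMap Y m a * star (Y n) = a m n • g := fun m n => by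
    rw [rowMap_apply, Finset.sum_mul, Finset.sum_eq_single n]
    · rw [smul_mul_assoc, hY, if_pos rfl]
    · intro j _ hj; rw [smul_mul_assoc, hY, if_neg hj, smul_zero]
    · simp
  have h2 : ∀ m, ∑ n, a m n • rowMap Y n b = rowMap Y m (a * b) := fun m => by
    simp only [rowMap_apply, Finset.smul_sum, smul_smul, CStarMatrix.mul_apply, Finset.sum_smul]
    rw [Finset.sum_comm]
  rw [compressMap_apply, compressMap_apply, compressMap_apply, Finset.sum_mul]
  refine Finset.sum_congr rfl fun m _ => ?_
  rw [← h2, Finset.mul_sum, Finset.mul_sum]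
  refine Finset.sum_congr rfl fun n _ => ?_
  rw [mul_one, mul_one, mul_assoc, ← mul_assoc (rowMap Y m a), h1]
  simp only [smul_mul_assoc, mul_smul_comm, mul_assoc]

theorem mul_compressMap_mul (a : CMat r ℂ) (k l : Fin r) :
    Y k * compressMap Y 1 a * star (Y l) = a k l • (g * g) := by
  rw [compressMap_apply, Finset.mul_sum, Finset.sum_mul, Finset.sum_eq_single k]
  · rw [mul_one, ← mul_assoc, hY, if_pos rfl, rowMap_apply, Finset.mul_sum, Finset.sum_mul,
      Finset.sum_eq_single l]
    · rw [mul_assoc, smul_mul_assoc, hY, if_pos rfl, mul_smul_comm]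
    · intro j _ hj; rw [mul_assoc, smul_mul_assoc, hY, if_neg hj, smul_zero, mul_zero]
    · simp
  · intro j _ hj; rw [mul_one, ← mul_assoc, hY, if_neg hj.symm, zero_mul, zero_mul]
  · simp

/-- If the common square `g` of the `Y i` is a nonzero projection, then `a ↦ ∑ a i j • Y i* Y j` is
isometric. -/
theorem norm_compressMap_of_proj (hg : star g = g) (hgg : g * g = g) (hg0 : g ≠ 0)
    (a : CMat r ℂ) : ‖compressMap Y 1 a‖ = ‖a‖ := by
  -- Since Y m (Y m)* is the projection g, the element g Y m - Y m times its adjoint vanishes. The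
  -- factor g in `compressMap_mul` is then absorbed, and the map becomes a homomorphism.
  have hgY : ∀ m, g * Y m = Y m := fun m => by
    have h1 : (g * Y m - Y m) * star (g * Y m - Y m) = 0 := by
      have h2 : Y m * star (Y m) = g := by rw [hY, if_pos rfl]
      rw [star_sub, star_mul, hg, sub_mul, mul_sub, mul_sub, mul_assoc g, ← mul_assoc (Y m), h2,
        mul_assoc g, h2]
      simp only [hgg, sub_self]
    exact sub_eq_zero.mp (CStarRing.mul_star_self_eq_zero_iff _ |>.mp h1)
  have hg1 : compressMap Y g = compressMap Y 1 := by
    ext a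
    rw [compressMap_apply, compressMap_apply]
    refine Finset.sum_congr rfl fun m _ => ?_
    have h3 : star (Y m) * g = star (Y m) := by
      rw [← hg, ← star_mul, hgY]
    rw [h3, mul_one]
  let φ : CMat r ℂ →⋆ₙₐ[ℂ] C :=
    { toFun := compressMap Y 1
      map_smul' := fun c a => map_smul _ c a
      map_zero' := map_zero _
      map_add' := map_add _
      map_mul' := fun a b => by rw [compressMap_mul hY, hg1]
      map_star' := fun a => (star_compressMap Y (star_one _) a).symm }
  have hφ : Function.Injective φ := by
    rw [injective_iff_map_eq_zero]
    intro a ha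
    have ha' : compressMap Y 1 a = 0 := ha
    ext i j
    have h := mul_compressMap_mul hY a i j
    rw [ha', mul_zero, zero_mul, hgg] at h
    exact (smul_eq_zero.mp h.symm).resolve_right hg0
  exact NonUnitalStarAlgHom.norm_map φ hφ a

/-- As 0 ≤ g ≤ 1, the multiplicative law gives ‖φ(b)‖² ≤ ‖φ(b* b)‖. For b = 1 this bounds φ(1) by 1,
and a* a ≤ ‖a‖² together with positivity gives the rest. -/
theorem norm_compressMap_le {k : C} (hk : g = star k * k) (hg1 : ‖g‖ ≤ 1) (a : CMat r ℂ) :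
    ‖compressMap Y 1 a‖ ≤ ‖a‖ := by
  let _ := CStarAlgebra.spectralOrder C
  have := CStarAlgebra.spectralOrderedRing C
  have hgsa : star g = g := by rw [hk, star_mul, star_star]
  have hg0 : 0 ≤ g := by rw [hk]; exact star_mul_self_nonneg k
  have hle : g ≤ 1 := (CStarAlgebra.norm_le_one_iff_of_nonneg g hg0).mp hg1
  have h1 : ∀ b : CMat r ℂ, compressMap Y g (star b * b) ≤ compressMap Y 1 (star b * b) := by
    intro b
    rw [compressMap_star_mul, compressMap_star_mul]
    refine Finset.sum_le_sum fun m _ => ?_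
    exact star_left_conjugate_le_conjugate hle _
  have hpos : ∀ b : CMat r ℂ, 0 ≤ compressMap Y 1 (star b * b) := by
    intro b
    rw [compressMap_star_mul]
    refine Finset.sum_nonneg fun m _ => ?_
    rw [mul_one]
    exact star_mul_self_nonneg _
  have hpos' : ∀ b : CMat r ℂ, 0 ≤ compressMap Y g (star b * b) := by
    intro b
    rw [compressMap_star_mul]
    refine Finset.sum_nonneg fun m _ => ?_
    exact star_left_conjugate_nonneg hg0 _
  have hsq : ∀ b : CMat r ℂ, ‖compressMap Y 1 b‖ * ‖compressMap Y 1 b‖ ≤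
      ‖compressMap Y 1 (star b * b)‖ := by
    intro b
    rw [← CStarRing.norm_star_mul_self, star_compressMap Y (star_one _), compressMap_mul hY]
    exact CStarAlgebra.norm_le_norm_of_nonneg_of_le (hpos' b) (h1 b)
  -- A number t ≥ 0 with t² ≤ t is at most 1.
  have hone : ‖compressMap Y 1 1‖ ≤ 1 := by
    have h := hsq 1
    rw [star_one, mul_one] at h
    by_contra hc
    push Not at hc
    nlinarith
  have hle2 : compressMap Y 1 (star a * a) ≤ (‖a‖ ^ 2 : ℝ) • compressMap Y 1 1 := by
    have h4 : star a * a ≤ algebraMap ℝ (CMat r ℂ) (‖a‖ ^ 2) := by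
      rw [pow_two, ← CStarRing.norm_star_mul_self]
      exact IsSelfAdjoint.le_algebraMap_norm_self (IsSelfAdjoint.star_mul_self a)
    obtain ⟨c, hc⟩ := exists_eq_star_mul_self (sub_nonneg.mpr h4)
    have h5 := hpos c
    rw [← hc, map_sub, sub_nonneg] at h5
    refine h5.trans (le_of_eq ?_)
    have h6 : algebraMap ℝ (CMat r ℂ) (‖a‖ ^ 2) = ((‖a‖ ^ 2 : ℝ) : ℂ) • 1 := by
      rw [Algebra.algebraMap_eq_smul_one]
      ext i j
      change (‖a‖ ^ 2 : ℝ) • (1 : CMat r ℂ) i j = ((‖a‖ ^ 2 : ℝ) : ℂ) • (1 : CMat r ℂ) i j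
      rw [Complex.coe_smul]
    rw [h6, LinearMap.map_smul, Complex.coe_smul]
  have h6 : ‖compressMap Y 1 a‖ * ‖compressMap Y 1 a‖ ≤ ‖a‖ * ‖a‖ := by
    refine (hsq a).trans ((CStarAlgebra.norm_le_norm_of_nonneg_of_le (hpos a) hle2).trans ?_)
    rw [norm_smul, Real.norm_of_nonneg (by positivity), pow_two]
    exact mul_le_of_le_one_right (by positivity) hone
  exact (mul_self_le_mul_self_iff (norm_nonneg _) (norm_nonneg _)).mpr h6

/-- The norm is bounded below by passing to a quotient in which g becomes a nonzero projection:
there the map is an injective homomorphism, hence isometric. -/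
theorem isIsometricOrderZero_compressMap {k : C} (hk : g = star k * k) (hg1 : ‖g‖ ≤ 1)
    (Ψ : C →⋆ₐ[ℂ] C') (hΨ : Ψ g * Ψ g = Ψ g) (hΨ0 : Ψ g ≠ 0) :
    IsIsometricOrderZero (compressMap Y 1) where
  completelyPositive := IsCompletelyPositive.of_eq_sum (rowMap Y) fun a b => by
    rw [compressMap_star_mul]
    simp only [mul_one]
  orderZero a b _ _ hab := by rw [compressMap_mul hY, hab, map_zero]
  isometric a := by
    refine le_antisymm (norm_compressMap_le hY hk hg1 a) ?_
    have h1 : Ψ (compressMap Y 1 a) = compressMap (fun i => Ψ (Y i)) 1 a := by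
      simp only [compressMap_apply, rowMap_apply, map_sum, map_mul, map_star, map_smul, map_one]
    rw [← norm_compressMap_of_proj (Y := fun i => Ψ (Y i)) (g := Ψ g) (fun i j => ?_) ?_ hΨ hΨ0 a,
      ← h1]
    · exact NonUnitalStarAlgHom.norm_apply_le Ψ _
    · rw [← map_star]
      exact congrArg Ψ (by rw [hk, star_mul, star_star])
    · rw [← map_star, ← map_mul, hY]
      split_ifs <;> simp

end RowOrderZero

/-! ### Approximate units and coisometries -/

section Lifting

variable {A C : Type*} [CStarAlgebra A] [CStarAlgebra C]

/-- Finitely many elements of the kernel of a homomorphism are almost annihilated by a contraction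
which is mapped to `1`. -/
theorem exists_almost_annihilator (ρ : A →⋆ₐ[ℂ] C) {ι : Type*} (t : Finset ι) (s : ι → A)
    (hs : ∀ i ∈ t, ρ (s i) = 0) {δ : ℝ} (hδ : 0 < δ) :
    ∃ e : A, star e = e ∧ ‖e‖ ≤ 1 ∧ ρ e = 1 ∧ ∀ i ∈ t, ‖e * s i‖ < δ := by
  let _ := CStarAlgebra.spectralOrder A
  have := CStarAlgebra.spectralOrderedRing A
  set P := ∑ i ∈ t, s i * star (s i) with hP
  have hP0 : 0 ≤ P := Finset.sum_nonneg fun i _ => mul_star_self_nonneg _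
  have hρP : ρ P = 0 := by
    rw [hP, map_sum]
    exact Finset.sum_eq_zero fun i hi => by rw [map_mul, hs i hi, zero_mul]
  -- With e = (1 + c P)⁻¹ one has ‖e s i‖² ≤ ‖e P e‖ ≤ 1 / c, because x / (1 + c x)² ≤ 1 / c for x ≥
  -- 0. The choice of c makes this δ² / 2 < δ².
  set c : ℝ := 2 / δ ^ 2 with hc
  have hc0 : 0 < c := by positivity
  have hspec : ∀ x ∈ spectrum ℝ P, 0 ≤ x := fun x hx => spectrum_nonneg_of_nonneg hP0 hx
  have hpos : ∀ x ∈ spectrum ℝ P, 0 < 1 + c * x := fun x hx => by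
    have := hspec x hx
    positivity
  have hcont : ContinuousOn (fun x : ℝ => (1 + c * x)⁻¹) (spectrum ℝ P) :=
    ContinuousOn.inv₀ (by fun_prop) fun x hx => (hpos x hx).ne'
  have hsa : IsSelfAdjoint P := IsSelfAdjoint.of_nonneg hP0
  set e := cfc (fun x : ℝ => (1 + c * x)⁻¹) P with he
  have hesa : star e = e := cfc_predicate (R := ℝ) (p := IsSelfAdjoint) _ P
  refine ⟨e, hesa, norm_cfc_le zero_le_one fun x hx => ?_, ?_, fun i hi => ?_⟩
  · have h1 := hspec x hx
    rw [Real.norm_of_nonneg (inv_nonneg.mpr (hpos x hx).le)]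
    exact inv_le_one_of_one_le₀ (by nlinarith)
  · have h1 : Continuous ρ := by
      have : Continuous fun a => ρ a := by
        refine AddMonoidHomClass.continuous_of_bound ρ 1 fun a => ?_
        rw [one_mul]
        exact NonUnitalStarAlgHom.norm_apply_le ρ a
      exact this
    rw [he, StarAlgHomClass.map_cfc ρ _ P hcont h1 hsa (by rw [hρP]; exact IsSelfAdjoint.zero _),
      hρP, cfc_apply_zero]
    simp
  · have h1 : (e * s i) * star (e * s i) ≤ e * P * e := by
      rw [star_mul, hesa, ← mul_assoc, mul_assoc e (s i)]
      have h2 : s i * star (s i) ≤ P :=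
        Finset.single_le_sum (f := fun i => s i * star (s i))
          (fun i _ => mul_star_self_nonneg _) hi
      have h3 := star_left_conjugate_le_conjugate h2 e
      rwa [hesa] at h3
    have h4 : ‖e * P * e‖ ≤ c⁻¹ := by
      have h5 : e * P * e = cfc (fun x : ℝ => (1 + c * x)⁻¹ * x * (1 + c * x)⁻¹) P := by
        rw [cfc_mul (fun x : ℝ => (1 + c * x)⁻¹ * x) (fun x : ℝ => (1 + c * x)⁻¹) P
          (hcont.mul continuousOn_id) hcont,
          cfc_mul (fun x : ℝ => (1 + c * x)⁻¹) (fun x : ℝ => x) P hcont continuousOn_id,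
          cfc_id' ℝ P]
      rw [h5]
      refine norm_cfc_le (by positivity) fun x hx => ?_
      have h6 := hspec x hx
      have h7 := hpos x hx
      rw [Real.norm_of_nonneg (by positivity), ← div_eq_inv_mul, ← div_eq_mul_inv, div_div,
        div_le_iff₀ (by positivity), ← div_eq_inv_mul, le_div_iff₀ hc0]
      nlinarith [mul_nonneg hc0.le h6]
    have h8 : ‖e * s i‖ ^ 2 ≤ c⁻¹ := by
      rw [pow_two, ← CStarRing.norm_self_mul_star]
      exact (CStarAlgebra.norm_le_norm_of_nonneg_of_le (mul_star_self_nonneg _) h1).trans h4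
    have h9 : c⁻¹ < δ ^ 2 := by
      rw [hc, inv_div]
      have : 0 < δ ^ 2 := by positivity
      linarith
    exact lt_of_pow_lt_pow_left₀ 2 hδ.le (h8.trans_lt h9)

/-- A self-adjoint preimage `w` of a symmetry can be changed such that it is the first entry of a
coisometric row. -/
theorem exists_sq_add_sq_eq_one (φ : A →⋆ₐ[ℂ] C) {w : A} (hw : star w = w)
    (hφ : φ w * φ w = 1) :
    ∃ u v : A, star u = u ∧ star v = v ∧ u * u + v * v = 1 ∧ φ u = φ w ∧ φ v = 0 := by
  have hcont : Continuous φ := by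
    have : Continuous fun a => φ a := by
      refine AddMonoidHomClass.continuous_of_bound φ 1 fun a => ?_
      rw [one_mul]
      exact NonUnitalStarAlgHom.norm_apply_le φ a
    exact this
  have hpos : ∀ x : ℝ, 1 + x ^ 2 ≠ 0 := fun x => by positivity
  have hf : Continuous fun x : ℝ => 2 * x / (1 + x ^ 2) := by
    refine Continuous.div (by fun_prop) (by fun_prop) hpos
  have hg : Continuous fun x : ℝ => (1 - x ^ 2) / (1 + x ^ 2) := by
    refine Continuous.div (by fun_prop) (by fun_prop) hpos
  have hwsa : IsSelfAdjoint w := hw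
  have hφw : IsSelfAdjoint (φ w) := hwsa.map φ
  have hspec : ∀ x ∈ spectrum ℝ (φ w), x ^ 2 = 1 := by
    intro x hx
    have h1 : cfc (fun x : ℝ => x ^ 2) (φ w) = 1 := by
      rw [cfc_pow_id (R := ℝ) (φ w) 2, pow_two, hφ]
    have h2 : x ^ 2 ∈ spectrum ℝ (cfc (fun x : ℝ => x ^ 2) (φ w)) := by
      rw [cfc_map_spectrum (R := ℝ) (fun x => x ^ 2) (φ w)]
      exact ⟨x, hx, rfl⟩
    rw [h1] at h2
    by_contra h3
    refine h2 (spectrum.mem_resolventSet_iff.mpr ?_)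
    have h4 : algebraMap ℝ C (x ^ 2) - 1 = algebraMap ℝ C (x ^ 2 - 1) := by simp
    rw [h4]
    exact (IsUnit.mk0 _ (sub_ne_zero.mpr h3)).map (algebraMap ℝ C)
  -- The rational parametrisation of the circle. At x = ±1, the only possible spectral values of the
  -- image of w, it takes the values (x, 0).
  refine ⟨cfc (fun x : ℝ => 2 * x / (1 + x ^ 2)) w, cfc (fun x : ℝ => (1 - x ^ 2) / (1 + x ^ 2)) w,
    cfc_predicate (R := ℝ) (p := IsSelfAdjoint) _ w,
    cfc_predicate (R := ℝ) (p := IsSelfAdjoint) _ w, ?_, ?_, ?_⟩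
  · rw [← cfc_mul _ _ w hf.continuousOn hf.continuousOn,
      ← cfc_mul _ _ w hg.continuousOn hg.continuousOn,
      ← cfc_add w (fun x : ℝ => 2 * x / (1 + x ^ 2) * (2 * x / (1 + x ^ 2)))
        (fun x : ℝ => (1 - x ^ 2) / (1 + x ^ 2) * ((1 - x ^ 2) / (1 + x ^ 2)))
        (hf.mul hf).continuousOn (hg.mul hg).continuousOn, ← cfc_one ℝ w]
    refine cfc_congr fun x _ => ?_
    have := hpos x
    simp only [Pi.one_apply]
    field_simp
    ring
  · rw [StarAlgHomClass.map_cfc φ _ w hf.continuousOn hcont hwsa hφw]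
    conv_rhs => rw [← cfc_id' ℝ (φ w)]
    refine cfc_congr fun x hx => ?_
    simp only [hspec x hx]
    ring
  · rw [StarAlgHomClass.map_cfc φ _ w hg.continuousOn hcont hwsa hφw]
    rw [← cfc_zero ℝ (φ w)]
    refine cfc_congr fun x hx => ?_
    simp only [hspec x hx]
    simp

end Lifting

/-! ### Matrix units and coisometric lifts -/

/-- The matrix units of `M_r`. -/
def matUnit (r : ℕ) (s t : Fin r) : CMat r ℂ :=
  CStarMatrix.ofMatrix fun p q => if p = s ∧ q = t then 1 else 0

theorem matUnit_apply {r : ℕ} (s t p q : Fin r) :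
    matUnit r s t p q = if p = s ∧ q = t then 1 else 0 := rfl

theorem star_matUnit {r : ℕ} (s t : Fin r) : star (matUnit r s t) = matUnit r t s := by
  ext p q
  rw [CStarMatrix.star_apply, matUnit_apply, matUnit_apply]
  simp only [and_comm, apply_ite star, star_one, star_zero]

theorem matUnit_mul {r : ℕ} (s t : Fin r) (a : CMat r ℂ) (p q : Fin r) :
    (matUnit r s t * a) p q = if p = s then a t q else 0 := by
  rw [CStarMatrix.mul_apply, Finset.sum_eq_single t]
  · simp [matUnit_apply]
  · intro j _ hj; simp [matUnit_apply, hj]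
  · simp

theorem matUnit_mul_matUnit {r : ℕ} (s t u v : Fin r) :
    matUnit r s t * matUnit r u v = if t = u then matUnit r s v else 0 := by
  ext p q
  rw [matUnit_mul, matUnit_apply]
  split_ifs <;> simp_all [matUnit_apply]

theorem CStarMatrix.finset_sum_apply {A ι : Type*} [AddCommMonoid A] {m n : Type*} (t : Finset ι)
    (f : ι → CStarMatrix m n A) (i : m) (j : n) : (∑ k ∈ t, f k) i j = ∑ k ∈ t, f k i j :=
  Matrix.sum_apply i j t f

theorem sum_matUnit (r : ℕ) : ∑ s, matUnit r s s = 1 := by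
  ext p q
  rw [CStarMatrix.finset_sum_apply, Finset.sum_eq_single p]
  · simp [matUnit_apply, CStarMatrix.one_apply, eq_comm]
  · intro j _ hj; simp [matUnit_apply, hj.symm]
  · simp

/-- The homomorphism between matrix algebras given by the entrywise application of a homomorphism. -/
noncomputable def CStarMatrix.mapHom {A C : Type*} [CStarAlgebra A] [CStarAlgebra C]
    [PartialOrder A] [StarOrderedRing A] [PartialOrder C] [StarOrderedRing C] (r : ℕ)
    (f : A →⋆ₐ[ℂ] C) : CMat r A →⋆ₐ[ℂ] CMat r C :=
  StarAlgHom.ofLinear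
    { toFun := fun a => CStarMatrix.ofMatrix fun i j => f (a i j)
      map_add' := fun a b => CStarMatrix.ext fun i j => map_add f _ _
      map_smul' := fun c a => CStarMatrix.ext fun i j => map_smul f _ _ }
    (CStarMatrix.ext fun i j => by
      change f ((1 : CMat r A) i j) = (1 : CMat r C) i j
      rw [CStarMatrix.one_apply, CStarMatrix.one_apply, apply_ite f, map_one, map_zero])
    (fun a b => CStarMatrix.ext fun i j => by
      change f ((a * b) i j) = ∑ k, f (a i k) * f (b k j)
      rw [CStarMatrix.mul_apply, map_sum]
      simp only [map_mul])
    (fun a => CStarMatrix.ext fun i j => map_star f _)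

theorem CStarMatrix.mapHom_apply {A C : Type*} [CStarAlgebra A] [CStarAlgebra C]
    [PartialOrder A] [StarOrderedRing A] [PartialOrder C] [StarOrderedRing C] (r : ℕ)
    (f : A →⋆ₐ[ℂ] C) (a : CMat r A) (i j : Fin r) : CStarMatrix.mapHom r f a i j = f (a i j) := rfl

section Coisometry

variable {A : Type*} [CStarAlgebra A] {r : ℕ} (ρ : A →⋆ₐ[ℂ] CMat r ℂ)

/-- A surjection onto a matrix algebra is implemented by a coisometric matrix. -/
theorem exists_coisometry (hρ : Function.Surjective ρ) :
    ∃ U : Fin r → Fin (r + r) → A,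
      (∀ i j, ∑ s, U i s * star (U j s) = if i = j then 1 else 0) ∧
      ∀ (b : A) (m : Fin r) (s : Fin (r + r)), ρ (U m s) * ρ b = ∑ j, ρ b m j • ρ (U j s) := by
  let _ := CStarAlgebra.spectralOrder A
  have := CStarAlgebra.spectralOrderedRing A
  choose a ha using fun i s : Fin r => hρ (matUnit r s i)
  -- A self-adjoint lift of the flip W with entries W i s = e_{s i} in M_r(M_r), which is a
  -- symmetry. The flip satisfies W m s · b = ∑ j, b m j • W j s, which is the required intertwining
  -- relation. The columns from v which complete u to a coisometry vanish under ρ and do not disturb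
  -- it.
  let w : CMat r A := CStarMatrix.ofMatrix fun i s => (2⁻¹ : ℂ) • (a i s + star (a s i))
  have hw : star w = w := by
    ext i s
    change star ((2⁻¹ : ℂ) • (a s i + star (a i s))) = (2⁻¹ : ℂ) • (a i s + star (a s i))
    rw [star_smul, star_add, star_star, add_comm]
    simp
  have hφw : ∀ i s, CStarMatrix.mapHom r ρ w i s = matUnit r s i := fun i s => by
    change ρ ((2⁻¹ : ℂ) • (a i s + star (a s i))) = _
    rw [map_smul, map_add, map_star, ha, ha, star_matUnit, ← two_smul ℂ, smul_smul]
    norm_num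
  have hsq : CStarMatrix.mapHom r ρ w * CStarMatrix.mapHom r ρ w = 1 := by
    ext1 i j
    rw [CStarMatrix.mul_apply, CStarMatrix.one_apply]
    simp only [hφw, matUnit_mul_matUnit]
    split_ifs
    · exact sum_matUnit r
    · simp
  obtain ⟨u, v, hu, hv, huv, h1, h2⟩ := exists_sq_add_sq_eq_one (CStarMatrix.mapHom r ρ) hw hsq
  refine ⟨fun i => Fin.append (u i) (v i), fun i j => ?_, fun b m s => ?_⟩
  · rw [Fin.sum_univ_add]
    simp only [Fin.append_left, Fin.append_right]
    have h3 : (u * u + v * v) i j = (1 : CMat r A) i j := by rw [huv]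
    have h4 : ∀ z : CMat r A, star z = z → ∀ s, star (z j s) = z s j := fun z hz s => by
      conv_rhs => rw [← hz]
      rfl
    simp only [h4 u hu, h4 v hv]
    rw [CStarMatrix.one_apply] at h3
    rw [← h3]
    rfl
  · have hl : ∀ i s, ρ (u i s) = matUnit r s i := fun i s => by
      rw [← CStarMatrix.mapHom_apply, h1, hφw]
    have hr : ∀ i s, ρ (v i s) = 0 := fun i s => by
      rw [← CStarMatrix.mapHom_apply, h2]; rfl
    refine Fin.addCases (fun s => ?_) (fun s => ?_) s
    · simp only [Fin.append_left, hl]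
      ext p q
      rw [CStarMatrix.finset_sum_apply, matUnit_mul, Finset.sum_eq_single q]
      · rw [CStarMatrix.smul_apply, matUnit_apply]; simp
      · intro j _ hj
        rw [CStarMatrix.smul_apply, matUnit_apply]; simp [hj.symm]
      · simp
    · simp only [Fin.append_right, hr]
      simp

end Coisometry

/-! ### Point evaluations -/

namespace RSHDecomposition

variable {B : Type*} [CStarAlgebra B] {R : ℕ} (D : RSHDecomposition B R)

theorem ψ_last : D.ψ (Fin.last R) = (D.equiv : B →⋆ₐ[ℂ] D.stage (Fin.last R)) :=
  Fin.reverseInduction_last ..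

theorem ψ_castSucc (l : Fin R) : D.ψ l.castSucc = (D.down l).comp (D.ψ l.succ) :=
  Fin.reverseInduction_castSucc ..

theorem ψ_surjective (j : Fin (R + 1)) : Function.Surjective (D.ψ j) := by
  induction j using Fin.reverseInduction with
  | last => rw [ψ_last]; exact D.equiv.surjective
  | cast l ih => rw [ψ_castSucc]; exact (D.down_surjective l).comp ih

/-- A matrix valued function which vanishes on `Ω l`, as an element of the stage `l + 1`. -/
theorem exists_ideal_lift (l : Fin R) (f : C(D.X l, CMat (D.r l) ℂ)) (hf : ∀ x ∈ D.Ω l, f x = 0) :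
    ∃ b : D.stage l.succ, D.down l b = 0 ∧ D.coord l b = f := by
  obtain ⟨b, hb, -⟩ := D.pullback l 0 f (by
    rw [map_zero]
    ext1 x
    exact (hf x x.2).symm)
  exact ⟨b, hb⟩

/-- The evaluation at a point of `X l`. -/
noncomputable def evalAt (l : Fin R) (x : D.X l) : B →⋆ₐ[ℂ] CMat (D.r l) ℂ :=
  StarAlgHom.ofLinear
    { toFun := fun b => D.ι l b x
      map_add' := fun a b => D.ι_add_apply l a b x
      map_smul' := fun c b => D.ι_smul_apply l c b x }
    (D.ι_one_apply l x) (fun a b => D.ι_mul_apply l a b x) (fun a => D.ι_star_apply l a x)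

theorem evalAt_apply (l : Fin R) (x : D.X l) (b : B) : D.evalAt l x b = D.ι l b x := rfl

/-- Functions vanishing on Ω l extend by 0 to elements of the pullback, so a suitable multiple of h
times a constant matrix attains any value at x. -/
theorem evalAt_surjective (l : Fin R) {x : D.X l} (hx : x ∉ D.Ω l) :
    Function.Surjective (D.evalAt l x) := by
  intro a
  have hne : D.h l x ≠ 0 := fun h => hx ((D.h_spec l x).2.2.1 h)
  obtain ⟨b, -, hb⟩ := D.exists_ideal_lift l
    ⟨fun y => ((D.h l y / D.h l x : ℝ) : ℂ) • a, by
      refine Continuous.smul (Complex.continuous_ofReal.comp ?_) continuous_const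
      exact (D.h l).continuous.div_const _⟩ (fun y hy => by
        change ((D.h l y / D.h l x : ℝ) : ℂ) • a = 0
        rw [(D.h_spec l y).2.2.2 hy]; simp)
  obtain ⟨c, rfl⟩ := D.ψ_surjective l.succ b
  refine ⟨c, ?_⟩
  have h1 : D.ι l c = D.coord l (D.ψ l.succ c) := rfl
  rw [evalAt_apply, h1, hb]
  change ((D.h l x / D.h l x : ℝ) : ℂ) • a = a
  rw [div_self hne]
  simp

/-- The inclusion of `B` in `B ⊗ 𝒬`. -/
noncomputable def inclLeft : B →⋆ₐ[ℂ] D.TensorUHF :=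
  StarAlgHom.ofLinear
    { toFun := fun b => D.tmul b 1
      map_add' := fun a b => D.tmul_add a b 1
      map_smul' := fun c b => D.tmul_smul c b 1 }
    D.tmul_one_one (fun a b => by
      change D.tmul (a * b) 1 = D.tmul a 1 * D.tmul b 1
      rw [tmul_mul_tmul, mul_one])
    (fun a => by
      change D.tmul (star a) 1 = star (D.tmul a 1)
      rw [star_tmul, star_one])

theorem norm_tmul_one_le (b : B) : ‖D.tmul b 1‖ ≤ ‖b‖ :=
  NonUnitalStarAlgHom.norm_apply_le D.inclLeft b

theorem sum_tmul {ι : Type*} (t : Finset ι) (b : ι → B) (q : UniversalUHF) :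
    D.tmul (∑ i ∈ t, b i) q = ∑ i ∈ t, D.tmul (b i) q :=
  map_sum (⟨⟨fun b => D.tmul b q, by
    have h := D.tmul_smul 0 0 q
    rwa [zero_smul, zero_smul] at h⟩, fun a b => D.tmul_add a b q⟩ : B →+ D.TensorUHF) b t

theorem zero_tmul (q : UniversalUHF) : D.tmul 0 q = 0 := by
  have h := D.tmul_smul 0 0 q
  rwa [zero_smul, zero_smul] at h

theorem tmul_zero (b : B) : D.tmul b 0 = 0 := by
  apply D.tensorIncl_injective
  rw [map_zero, tensorIncl_tmul]
  refine D.ambient_ext fun l x i j => ?_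
  rw [pureTensor_apply, smul_zero]
  rfl

theorem sub_tmul (a b : B) (q : UniversalUHF) :
    D.tmul (a - b) q = D.tmul a q - D.tmul b q := by
  rw [eq_sub_iff_add_eq, ← tmul_add, sub_add_cancel]

theorem norm_one_tmul_unit_le (n : ℕ) [NeZero n] (i j : Fin n) :
    ‖D.tmul 1 (UniversalUHF.unit n i j)‖ ≤ 1 := by
  have h1 : IsStarProjection (D.tmul 1 (UniversalUHF.unit n i i)) := by
    refine ⟨?_, ?_⟩
    · rw [IsIdempotentElem, tmul_mul_tmul, UniversalUHF.unit_mul, if_pos rfl, mul_one]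
    · rw [IsSelfAdjoint, star_tmul, UniversalUHF.star_unit, star_one]
  have h2 : ‖D.tmul 1 (UniversalUHF.unit n i j)‖ * ‖D.tmul 1 (UniversalUHF.unit n i j)‖ ≤ 1 := by
    rw [← CStarRing.norm_self_mul_star, star_tmul, tmul_mul_tmul, UniversalUHF.star_unit,
      UniversalUHF.unit_mul, if_pos rfl, star_one, mul_one]
    exact h1.norm_le
  nlinarith [norm_nonneg (D.tmul 1 (UniversalUHF.unit n i j))]

theorem norm_tmul_unit_le (n : ℕ) [NeZero n] (b : B) (i j : Fin n) :
    ‖D.tmul b (UniversalUHF.unit n i j)‖ ≤ ‖b‖ := by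
  have h : D.tmul b (UniversalUHF.unit n i j) = D.tmul b 1 * D.tmul 1 (UniversalUHF.unit n i j) := by
    rw [tmul_mul_tmul, mul_one, one_mul]
  rw [h]
  refine (norm_mul_le _ _).trans ((mul_le_mul (D.norm_tmul_one_le b)
    (D.norm_one_tmul_unit_le n i j) (norm_nonneg _) (norm_nonneg _)).trans_eq (mul_one _))

/-- The evaluation of elements of `B ⊗ 𝒬` at a point of `X l`. -/
noncomputable def tensorEval (l : Fin R) (x : D.X l) : D.TensorUHF →⋆ₐ[ℂ] CMat (D.r l) UniversalUHF :=
  StarAlgHom.ofLinear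
    { toFun := fun c => D.tensorIncl c l x
      map_add' := fun a b => by
        rw [map_add]; rfl
      map_smul' := fun c b => by
        rw [map_smul]; rfl }
    (by
      change D.tensorIncl 1 l x = 1
      rw [map_one]; rfl)
    (fun a b => by
      change D.tensorIncl (a * b) l x = D.tensorIncl a l x * D.tensorIncl b l x
      rw [map_mul]; rfl)
    (fun a => by
      change D.tensorIncl (star a) l x = star (D.tensorIncl a l x)
      rw [map_star]; rfl)

theorem tensorEval_tmul (l : Fin R) (x : D.X l) (b : B) (q : UniversalUHF) (i j : Fin (D.r l)) :
    D.tensorEval l x (D.tmul b q) i j = D.evalAt l x b i j • q := rfl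

/-- The corner embedding is injective, so it is enough that 1 ≠ 0 in 𝒬. The values 1 and 0 of the
trace distinguish them. -/
theorem _root_.UniversalUHF.unit_self_ne_zero (n : ℕ) [NeZero n] (k : Fin n) :
    UniversalUHF.unit n k k ≠ 0 := by
  intro h
  rw [← UniversalUHF.corner_one, ← map_zero (UniversalUHF.corner n k)] at h
  have h1 := UniversalUHF.corner_injective n k h
  have h2 := UniversalUHF.trace_diag_indicator (n := 1) fun _ => True
  have h3 := UniversalUHF.trace_diag_indicator (n := 1) fun _ => False
  simp only [if_true, if_false] at h2 h3
  rw [h1] at h2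
  rw [h2] at h3
  simp at h3

end RSHDecomposition

section PointExcisor

variable {B : Type*} [CStarAlgebra B] {R : ℕ} (D : RSHDecomposition B R)

/-- The evaluation at a point of `X l ∖ Ω l` can be excised. -/
theorem RSHDecomposition.exists_excising_map (F : Finset B) {η : ℝ} (hη : 0 < η) (l : Fin R)
    {x : D.X l} (hx : x ∉ D.Ω l) :
    ∃ σ : CMat (D.r l) ℂ →ₗ[ℂ] D.TensorUHF, IsIsometricOrderZero σ ∧
      ∀ b ∈ F, ‖σ 1 * D.tmul b 1 - σ (D.evalAt l x b)‖ < η := by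
  have hr0 : 0 < D.r l := D.r_pos l
  obtain ⟨N, hN, U, hU, hUb⟩ : ∃ (N : ℕ) (_ : NeZero N) (U : Fin (D.r l) → Fin N → B),
      (∀ i j, ∑ s, U i s * star (U j s) = if i = j then 1 else 0) ∧
      ∀ (b : B) (m : Fin (D.r l)) (s : Fin N),
        D.evalAt l x (U m s) * D.evalAt l x b =
          ∑ j, D.evalAt l x b m j • D.evalAt l x (U j s) :=
    ⟨D.r l + D.r l, ⟨by omega⟩, exists_coisometry (D.evalAt l x) (D.evalAt_surjective l hx)⟩
  -- The failure of the coisometry U to intertwine b with its value at x. It lies in the kernel of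
  -- the evaluation, so that e can make it small.
  let Δ : B → Fin (D.r l) → Fin N → B := fun b m s =>
    U m s * b - ∑ j, D.evalAt l x b m j • U j s
  set M : ℝ := D.r l * N with hM
  have hM0 : 0 < M := by
    have h1 : (0 : ℝ) < D.r l := by exact_mod_cast hr0
    have h2 : (0 : ℝ) < N := by exact_mod_cast Nat.pos_of_ne_zero (NeZero.ne N)
    positivity
  -- The tolerance η / M is for a double sum with M = r N terms.
  obtain ⟨e, he, hen, hρe, hes⟩ := exists_almost_annihilator (D.evalAt l x)
    (F ×ˢ (Finset.univ : Finset (Fin (D.r l) × Fin N))) (fun i => Δ i.1 i.2.1 i.2.2)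
    (fun i _ => by
      simp only [Δ, map_sub, map_mul, map_sum, map_smul]
      exact sub_eq_zero.mpr (hUb _ _ _))
    (δ := η / M) (by positivity)
  -- The matrix units e_{0 s} of 𝒬 combine the N columns of e U into one column of elements of B ⊗
  -- 𝒬, so that U U* = 1 becomes Y i (Y j)* = δ_{ij} e² ⊗ e_{00}.
  let Y : Fin (D.r l) → D.TensorUHF := fun i => ∑ s, D.tmul (e * U i s) (UniversalUHF.unit N 0 s)
  have hY : ∀ i j, Y i * star (Y j) =
      if i = j then D.tmul (e * e) (UniversalUHF.unit N 0 0) else 0 := fun i j => by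
    have h1 : Y i * star (Y j) =
        ∑ s, D.tmul (e * (U i s * star (U j s)) * e) (UniversalUHF.unit N 0 0) := by
      simp only [Y, star_sum, Finset.sum_mul, Finset.mul_sum, D.star_tmul, D.tmul_mul_tmul,
        UniversalUHF.star_unit, UniversalUHF.unit_mul, star_mul, he]
      rw [Finset.sum_comm]
      refine Finset.sum_congr rfl fun s _ => ?_
      rw [Finset.sum_eq_single s]
      · rw [if_pos rfl]
        simp only [mul_assoc]
      · intro t _ ht
        rw [if_neg ht.symm]
        exact D.tmul_zero _
      · simp
    rw [h1, ← D.sum_tmul, ← Finset.sum_mul, ← Finset.mul_sum, hU]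
    split_ifs
    · rw [mul_one]
    · rw [mul_zero, zero_mul, D.zero_tmul]
  have hk : D.tmul (e * e) (UniversalUHF.unit N 0 0) =
      star (D.tmul e (UniversalUHF.unit N 0 0)) * D.tmul e (UniversalUHF.unit N 0 0) := by
    rw [D.star_tmul, D.tmul_mul_tmul, he, UniversalUHF.star_unit, UniversalUHF.unit_mul, if_pos rfl]
  have hee : ‖e * e‖ ≤ 1 := (norm_mul_le _ _).trans (mul_le_one₀ hen (norm_nonneg _) hen)
  have hg1 := (D.norm_tmul_unit_le N (e * e) 0 0).trans hee
  -- As e has the value 1 at x, evaluation at x turns e² ⊗ e_{00} into the nonzero projection 1 ⊗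
  -- e_{00}, as needed for the lower norm bound.
  have hΨe : ∀ c : B, D.evalAt l x c = 1 → D.tensorEval l x (D.tmul c (UniversalUHF.unit N 0 0)) =
      D.tensorEval l x (D.tmul 1 (UniversalUHF.unit N 0 0)) := fun c hc => by
    ext1 i j
    rw [D.tensorEval_tmul, D.tensorEval_tmul, hc, map_one]
  have hee1 : D.evalAt l x (e * e) = 1 := by rw [map_mul, hρe, mul_one]
  refine ⟨compressMap Y 1, isIsometricOrderZero_compressMap hY hk hg1 (D.tensorEval l x) ?_ ?_,
    fun b hb => ?_⟩
  · rw [hΨe _ hee1, ← map_mul, D.tmul_mul_tmul, UniversalUHF.unit_mul, if_pos rfl, mul_one]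
  · rw [hΨe _ hee1]
    intro h
    have h1 : D.tensorEval l x (D.tmul 1 (UniversalUHF.unit N 0 0)) ⟨0, hr0⟩ ⟨0, hr0⟩ =
      (0 : CMat (D.r l) UniversalUHF) ⟨0, hr0⟩ ⟨0, hr0⟩ := by rw [h]
    rw [D.tensorEval_tmul, map_one, CStarMatrix.one_apply_eq, one_smul] at h1
    exact UniversalUHF.unit_self_ne_zero N 0 h1
  · have hYn : ∀ m, ‖star (Y m)‖ ≤ 1 := fun m => by
      have h1 : ‖Y m‖ * ‖Y m‖ ≤ 1 := by
        rw [← CStarRing.norm_self_mul_star, hY, if_pos rfl]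
        exact hg1
      rw [norm_star]
      nlinarith [norm_nonneg (Y m)]
    -- The excision defect only contains the elements e Δ, multiplied by the contractions (Y m)*.
    have hdiff : compressMap Y 1 1 * D.tmul b 1 - compressMap Y 1 (D.evalAt l x b) =
        ∑ m, star (Y m) * ∑ s, D.tmul (e * Δ b m s) (UniversalUHF.unit N 0 s) := by
      rw [compressMap_apply, compressMap_apply, Finset.sum_mul, ← Finset.sum_sub_distrib]
      refine Finset.sum_congr rfl fun m _ => ?_
      rw [mul_one, rowMap_one, mul_assoc, ← mul_sub]
      congr 1
      simp only [Y, rowMap_apply, Finset.sum_mul, D.tmul_mul_tmul, mul_one, Finset.smul_sum]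
      rw [Finset.sum_comm, ← Finset.sum_sub_distrib]
      refine Finset.sum_congr rfl fun s _ => ?_
      simp only [Δ, mul_sub, D.sub_tmul, Finset.mul_sum, D.sum_tmul, mul_smul_comm, D.tmul_smul,
        mul_assoc]
    rw [hdiff]
    have hbound : ∀ m, ‖star (Y m) * ∑ s, D.tmul (e * Δ b m s) (UniversalUHF.unit N 0 s)‖ <
        N * (η / M) := fun m => by
      refine (norm_mul_le _ _).trans_lt ((mul_le_of_le_one_left (norm_nonneg _)
        (hYn m)).trans_lt ((norm_sum_le _ _).trans_lt ?_))
      refine (Finset.sum_lt_sum_of_nonempty (g := fun _ : Fin N => η / M) ⟨0, Finset.mem_univ _⟩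
        fun s _ => ?_).trans_eq (by simp)
      exact (D.norm_tmul_unit_le N _ 0 s).trans_lt
        (hes (b, m, s) (Finset.mem_product.mpr ⟨hb, Finset.mem_univ _⟩))
    refine (norm_sum_le _ _).trans_lt ?_
    refine (Finset.sum_lt_sum_of_nonempty (g := fun _ : Fin (D.r l) => N * (η / M))
      ⟨⟨0, hr0⟩, Finset.mem_univ _⟩ fun m _ => hbound m).trans_eq ?_
    rw [Finset.sum_const, Finset.card_univ, Fintype.card_fin, nsmul_eq_mul, ← mul_assoc, ← hM]
    field_simp

variable {D}

/-- The component at the index `l` of the direct sum decomposition of `E` which is concentrated in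
the index `l`. -/
abbrev ConcentratedAt (l : Fin R) (E : Type) (m : Fin R) : Type := {_u : Unit // m = l} → E

/-- The isomorphism of `E` with the direct sum of `ConcentratedAt l E`. -/
noncomputable def concentratedEquiv (l : Fin R) (E : Type) [CStarAlgebra E] :
    E ≃⋆ₐ[ℂ] ∀ m, ConcentratedAt l E m :=
  StarAlgEquiv.ofBijective
    (piStarAlgHom fun m => piStarAlgHom fun _ : {_u : Unit // m = l} => StarAlgHom.id ℂ E)
    ⟨fun _ _ h => congrFun (congrFun h l) ⟨(), rfl⟩, fun c => ⟨c l ⟨(), rfl⟩, by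
      ext m ⟨u, rfl⟩
      rfl⟩⟩

/-- The homomorphism into the zero algebra. -/
noncomputable def zeroAlgHom (A C : Type*) [CStarAlgebra A] [CStarAlgebra C] [Subsingleton C] :
    A →⋆ₐ[ℂ] C :=
  StarAlgHom.ofLinear 0 (Subsingleton.elim _ _) (fun _ _ => Subsingleton.elim _ _)
    fun _ => Subsingleton.elim _ _

/-- The evaluation of matrix valued functions on the set `{x}`. -/
noncomputable def evalSingleton {X : Type*} [TopologicalSpace X] (x : X) (r : ℕ) :
    C(({x} : Set X), CMat r ℂ) →⋆ₐ[ℂ] CMat r ℂ where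
  toFun f := f ⟨x, rfl⟩
  map_one' := rfl
  map_mul' _ _ := rfl
  map_zero' := rfl
  map_add' _ _ := rfl
  commutes' _ := rfl
  map_star' _ := rfl

namespace ExcisorData

variable (D) in
/-- The excisor of the evaluation at a point. -/
noncomputable def ofPoint (l : Fin R) (x : D.X l) (σ : CMat (D.r l) ℂ →ₗ[ℂ] D.TensorUHF)
    (κ : CMat (D.r l) ℂ →⋆ₐ[ℂ] UniversalUHF) : ExcisorData D where
  E := CMat (D.r l) ℂ
  finiteDim := inferInstanceAs (FiniteDimensional ℂ (Matrix (Fin (D.r l)) (Fin (D.r l)) ℂ))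
  ρ := D.evalAt l x
  σ := σ
  κ := κ

/-- The compact set is {x} at the index l and empty at the other indices, where the component of E
is the zero algebra. -/
theorem isCompatible_ofPoint {l : Fin R} {x : D.X l} (hx : x ∉ D.Ω l)
    (σ : CMat (D.r l) ℂ →ₗ[ℂ] D.TensorUHF) (κ : CMat (D.r l) ℂ →⋆ₐ[ℂ] UniversalUHF) :
    (ofPoint D l x σ κ).IsCompatible := by
  refine ⟨ConcentratedAt l (CMat (D.r l) ℂ), fun m => inferInstance, concentratedEquiv l _,
    fun m => ?_⟩
  by_cases h : m = l
  · subst h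
    have : CompactSpace ({x} : Set (D.X m)) := isCompact_iff_compactSpace.mp isCompact_singleton
    refine ⟨{x}, isCompact_singleton, Set.singleton_subset_iff.mpr hx,
      piStarAlgHom (A := C(({x} : Set (D.X m)), CMat (D.r m) ℂ))
        fun _ => evalSingleton x (D.r m), fun b => ?_⟩
    rfl
  · have h1 : IsEmpty {_u : Unit // m = l} := ⟨fun u => h u.2⟩
    have : CompactSpace (∅ : Set (D.X m)) := isCompact_iff_compactSpace.mp isCompact_empty
    exact ⟨∅, isCompact_empty, Set.empty_subset _,
      zeroAlgHom C((∅ : Set (D.X m)), CMat (D.r m) ℂ) (ConcentratedAt l (CMat (D.r l) ℂ) m),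
      fun b => Subsingleton.elim _ _⟩

theorem isPoint_ofPoint {l : Fin R} {x : D.X l} (hx : x ∉ D.Ω l)
    (σ : CMat (D.r l) ℂ →ₗ[ℂ] D.TensorUHF) (κ : CMat (D.r l) ℂ →⋆ₐ[ℂ] UniversalUHF) :
    (ofPoint D l x σ κ).IsPoint l x :=
  ⟨D.evalAt_surjective l hx, StarAlgHom.id ℂ _, κ, Function.injective_id, fun _ => rfl, rfl⟩

theorem exists_ofPoint (F : Finset B) {η : ℝ} (hη : 0 < η) {l : Fin R} {x : D.X l}
    (hx : x ∉ D.Ω l) : ∃ σ : CMat (D.r l) ℂ →ₗ[ℂ] D.TensorUHF,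
      ∀ κ, (ofPoint D l x σ κ).IsWeightedExcisor F η := by
  obtain ⟨σ, h1, h2⟩ := D.exists_excising_map F hη l hx
  exact ⟨σ, fun κ => ⟨h1, h2, isCompatible_ofPoint hx σ κ⟩⟩

end ExcisorData

end PointExcisor

/-! ### Homomorphisms of pullbacks into finite dimensional algebras -/

section Pullback

variable {X : Type*} [TopologicalSpace X] [CompactSpace X] {r : ℕ}

/-- The matrix valued function `g ⊗ m`. -/
noncomputable def tensorFun (g : C(X, ℂ)) (m : CMat r ℂ) : C(X, CMat r ℂ) :=
  ⟨fun x => g x • m, g.continuous.smul continuous_const⟩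

theorem tensorFun_apply (g : C(X, ℂ)) (m : CMat r ℂ) (x : X) : tensorFun g m x = g x • m := rfl

theorem exists_urysohn [T2Space X] {s t : Set X} (hs : IsClosed s) (ht : IsClosed t)
    (hst : Disjoint s t) :
    ∃ g : C(X, ℂ), (∀ x ∈ s, g x = 0) ∧ (∀ x ∈ t, g x = 1) ∧ star g = g := by
  obtain ⟨f, hf0, hf1, -⟩ := exists_continuous_zero_one_of_isClosed hs ht hst
  refine ⟨⟨fun x => (f x : ℂ), Complex.continuous_ofReal.comp f.continuous⟩, fun x hx => ?_,
    fun x hx => ?_, ?_⟩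
  · simp [hf0 hx]
  · simp [hf1 hx]
  · ext x; simp

/-- `S` behaves like the pullback of `T` and `C(X, M_r)` over `C(Ω, M_r)`. -/
structure IsPullback {S T : Type*} [CStarAlgebra S] [CStarAlgebra T] (Ω : Set X)
    (down : S →⋆ₐ[ℂ] T) (coord : S →⋆ₐ[ℂ] C(X, CMat r ℂ)) : Prop where
  closed : IsClosed Ω
  surj : Function.Surjective down
  inj : ∀ b b' : S, down b = down b' → (∀ x, coord b x = coord b' x) → b = b'
  zero : ∀ b : S, down b = 0 → ∀ x ∈ Ω, coord b x = 0
  lift : ∀ f : C(X, CMat r ℂ), (∀ x ∈ Ω, f x = 0) → ∃ b, down b = 0 ∧ coord b = f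

namespace IsPullback

variable {S T A : Type*} [CStarAlgebra S] [CStarAlgebra T] [CStarAlgebra A] {Ω : Set X}
  {down : S →⋆ₐ[ℂ] T} {coord : S →⋆ₐ[ℂ] C(X, CMat r ℂ)}

theorem coord_mul (b c : S) (x : X) : coord (b * c) x = coord b x * coord c x := by
  rw [map_mul]; rfl

theorem coord_star (b : S) (x : X) : coord (star b) x = star (coord b x) := by
  rw [map_star]; rfl

theorem coord_add (b c : S) (x : X) : coord (b + c) x = coord b x + coord c x := by
  rw [map_add]; rfl

theorem coord_sub (b c : S) (x : X) : coord (b - c) x = coord b x - coord c x := by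
  rw [map_sub]; rfl

theorem coord_zero (x : X) : coord 0 x = 0 := by
  rw [map_zero]; rfl

theorem coord_sum {ι : Type*} (t : Finset ι) (b : ι → S) (x : X) :
    coord (∑ i ∈ t, b i) x = ∑ i ∈ t, coord (b i) x := by
  rw [map_sum, ContinuousMap.sum_apply]

variable (h : IsPullback Ω down coord) (ψ : S →⋆ₙₐ[ℂ] A)

include h

/-- A pullback embeds isometrically in T ⊕ C(X, M_r), and the first component of b is 0. -/
theorem norm_le {b : S} (hb : down b = 0) : ‖ψ b‖ ≤ ‖coord b‖ := by
  have h1 : Function.Injective (down.prod coord) := fun b c hbc =>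
    h.inj b c (congrArg Prod.fst hbc) fun x =>
      congrArg (fun z : T × C(X, CMat r ℂ) => z.2 x) hbc
  have h2 : ‖down.prod coord b‖ = ‖b‖ := NonUnitalStarAlgHom.norm_map _ h1 b
  have h3 : down.prod coord b = (0, coord b) := Prod.ext hb rfl
  refine (NonUnitalStarAlgHom.norm_apply_le ψ b).trans ?_
  rw [← h2, h3, Prod.norm_def, norm_zero]
  exact max_le (norm_nonneg (coord b)) le_rfl

theorem eq_zero {b : S} (hb : down b = 0) (hb' : ∀ x, coord b x = 0) : b = 0 :=
  h.inj b 0 (by rw [hb, map_zero]) fun x => by rw [hb', coord_zero]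

theorem lift_tensorFun (g : C(X, ℂ)) (hg : ∀ x ∈ Ω, g x = 0) (m : CMat r ℂ) :
    ∃ b, down b = 0 ∧ ∀ x, coord b x = g x • m := by
  obtain ⟨b, hb, hb'⟩ := h.lift (tensorFun g m) fun x hx => by
    rw [tensorFun_apply, hg x hx, zero_smul]
  exact ⟨b, hb, fun x => by rw [hb']; rfl⟩

/-- The ideal of all functions `g` which vanish on `Ω` with `ψ (g ⊗ m) = 0` for all `m`. -/
noncomputable def kerIdeal : Ideal C(X, ℂ) where
  carrier := {g | (∀ x ∈ Ω, g x = 0) ∧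
    ∀ (m : CMat r ℂ) (b : S), down b = 0 → (∀ x, coord b x = g x • m) → ψ b = 0}
  zero_mem' := ⟨fun _ _ => rfl, fun m b hb hb' => by
    rw [h.eq_zero hb fun x => by rw [hb']; exact zero_smul ℂ m, map_zero]⟩
  add_mem' {g g'} hg hg' := ⟨fun x hx => by
      rw [ContinuousMap.add_apply, hg.1 x hx, hg'.1 x hx, add_zero], fun m b hb hb' => by
    obtain ⟨c, hc, hc'⟩ := h.lift_tensorFun g hg.1 m
    obtain ⟨d, hd, hd'⟩ := h.lift_tensorFun g' hg'.1 m
    have : b = c + d := h.inj _ _ (by rw [map_add, hc, hd, hb, add_zero]) fun x => by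
      rw [hb', coord_add, hc', hd', ContinuousMap.add_apply, add_smul]
    rw [this, map_add, hg.2 m c hc hc', hg'.2 m d hd hd', add_zero]⟩
  smul_mem' g' g hg := ⟨fun x hx => by
      rw [smul_eq_mul, ContinuousMap.mul_apply, hg.1 x hx, mul_zero], fun m b hb hb' => by
    -- The function g' need not vanish on Ω, so g' ⊗ 1 cannot be used as an element of S. Instead b
    -- b* is factored as (g' ḡ' ḡ ⊗ 1)(g ⊗ m m*), which lies in the kernel, and the C*-identity
    -- gives ψ b = 0.
    obtain ⟨c, hc, hc'⟩ := h.lift_tensorFun (g' * star g' * star g) (fun x hx => by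
      rw [ContinuousMap.mul_apply, ContinuousMap.star_apply g, hg.1 x hx, star_zero, mul_zero]) 1
    obtain ⟨d, hd, hd'⟩ := h.lift_tensorFun g hg.1 (m * star m)
    have h1 : b * star b = c * d := by
      refine h.inj _ _ (by rw [map_mul, map_mul, hb, hc, zero_mul, zero_mul]) fun x => ?_
      rw [coord_mul, coord_star, coord_mul, hb', hc', hd']
      simp only [smul_eq_mul, ContinuousMap.mul_apply, ContinuousMap.star_apply, star_smul,
        smul_mul_smul_comm, one_mul, star_mul']
      congr 1
      ring
    have h2 : ψ b * star (ψ b) = 0 := by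
      rw [← map_star, ← map_mul, h1, map_mul, hg.2 _ d hd hd', mul_zero]
    exact CStarRing.mul_star_self_eq_zero_iff _ |>.mp h2⟩

theorem isClosed_kerIdeal : IsClosed (h.kerIdeal ψ : Set C(X, ℂ)) := by
  rw [← isSeqClosed_iff_isClosed]
  intro u g hu hg
  have h0 : ∀ x ∈ Ω, g x = 0 := fun x hx => by
    have h1 : Tendsto (fun n => u n x) atTop (𝓝 (g x)) :=
      ((continuous_eval_const x).tendsto g).comp hg
    refine tendsto_nhds_unique h1 ?_
    simp only [(hu _).1 x hx]
    exact tendsto_const_nhds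
  refine ⟨h0, fun m b hb hb' => ?_⟩
  have h2 : ∀ n, ‖ψ b‖ ≤ ‖g - u n‖ * ‖m‖ := fun n => by
    obtain ⟨c, hc, hc'⟩ := h.lift_tensorFun (u n) (hu n).1 m
    have h3 : ψ b = ψ (b - c) := by rw [map_sub, (hu n).2 m c hc hc', sub_zero]
    rw [h3]
    refine (h.norm_le ψ (by rw [map_sub, hb, hc, sub_zero])).trans ?_
    refine (ContinuousMap.norm_le _ (by positivity)).mpr fun x => ?_
    rw [coord_sub, hb', hc', ← sub_smul, norm_smul]
    exact mul_le_mul_of_nonneg_right ((g - u n).norm_coe_le_norm x) (norm_nonneg m)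
  have h4 : Tendsto (fun n => ‖g - u n‖ * ‖m‖) atTop (𝓝 0) := by
    have h5 : Tendsto (fun n => ‖g - u n‖) atTop (𝓝 0) := by
      have := (tendsto_const_nhds (x := g)).sub hg
      rw [sub_self] at this
      exact tendsto_zero_iff_norm_tendsto_zero.mp this
    simpa using h5.mul_const ‖m‖
  exact norm_le_zero_iff.mp (ge_of_tendsto' h4 h2)

/-- The points outside of `Ω` which are seen by `ψ`. -/
def hull : Set X := {x | x ∉ Ω ∧ ∀ g ∈ h.kerIdeal ψ, g x = 0}

/-- A closed ideal of C(X) consists of all functions vanishing on its zero set, and a zero of the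
ideal is either in Ω or in the hull. -/
theorem mem_kerIdeal [T2Space X] {g : C(X, ℂ)} (hg : ∀ x ∈ Ω, g x = 0)
    (hg' : ∀ x ∈ h.hull ψ, g x = 0) : g ∈ h.kerIdeal ψ := by
  rw [← ContinuousMap.idealOfSet_ofIdeal_isClosed (h.isClosed_kerIdeal ψ),
    ContinuousMap.mem_idealOfSet]
  intro x hx
  by_cases h1 : x ∈ Ω
  · exact hg x h1
  · exact hg' x ⟨h1, ContinuousMap.notMem_setOfIdeal.mp hx⟩

/-- Split b into matrix entries: each entry function vanishes on Ω and on the hull, hence belongs to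
the ideal of ψ. -/
theorem eq_zero_of_hull [T2Space X] {b : S} (hb : down b = 0)
    (hb' : ∀ x ∈ h.hull ψ, coord b x = 0) : ψ b = 0 := by
  have hΩ : ∀ x ∈ Ω, coord b x = 0 := h.zero b hb
  let f : Fin r → Fin r → C(X, ℂ) := fun i j => ⟨fun y => coord b y i j,
    (continuous_apply j).comp ((continuous_apply i).comp (coord b).continuous)⟩
  have hf0 : ∀ i j, ∀ x ∈ Ω, f i j x = 0 := fun i j x hx => by
    change coord b x i j = 0
    rw [hΩ x hx]; rfl
  have hf : ∀ i j, f i j ∈ h.kerIdeal ψ := fun i j =>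
    h.mem_kerIdeal ψ (hf0 i j) fun x hx => by
      change coord b x i j = 0
      rw [hb' x hx]; rfl
  choose c hc hc' using fun i j => h.lift_tensorFun (f i j) (hf0 i j) (matUnit r i j)
  have h1 : b = ∑ i, ∑ j, c i j := by
    refine h.inj _ _ ?_ fun x => ?_
    · rw [hb, map_sum]
      exact (Finset.sum_eq_zero fun i _ => by
        rw [map_sum]; exact Finset.sum_eq_zero fun j _ => hc i j).symm
    · rw [coord_sum]
      simp only [coord_sum, hc']
      ext p q
      simp only [CStarMatrix.finset_sum_apply, CStarMatrix.smul_apply, matUnit_apply]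
      rw [Finset.sum_eq_single p, Finset.sum_eq_single q]
      · simp [f]
      · intro j _ hj; simp [hj.symm]
      · simp
      · intro i _ hi; simp [hi.symm]
      · simp
  rw [h1, map_sum]
  exact Finset.sum_eq_zero fun i _ => by
    rw [map_sum]
    exact Finset.sum_eq_zero fun j _ => (hf i j).2 _ _ (hc i j) (hc' i j)

/-- Cutting b with matrix units times a bump function g puts g² times each matrix entry of b into
the ideal of ψ; as g is 1 at x, the entry vanishes there. Only products with elements over 0 ∈ T are
needed, so b itself may be arbitrary. -/
theorem coord_eq_zero [T2Space X] {b : S}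
    (hb : ∀ c d : S, down c = 0 → down d = 0 → ψ (c * b * d) = 0) {x : X} (hx : x ∈ h.hull ψ) :
    coord b x = 0 := by
  obtain ⟨g, hg0, hg1, -⟩ := exists_urysohn h.closed (isClosed_singleton (x := x))
    (Set.disjoint_singleton_right.mpr hx.1)
  ext1 i j
  let f : C(X, ℂ) := ⟨fun y => coord b y i j,
    (continuous_apply j).comp ((continuous_apply i).comp (coord b).continuous)⟩
  have h1 : g * g * f ∈ h.kerIdeal ψ := by
    refine ⟨fun y hy => by rw [ContinuousMap.mul_apply, ContinuousMap.mul_apply, hg0 y hy]; simp,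
      fun m b' hb' hb'' => ?_⟩
    choose c hc hc' using fun s => h.lift_tensorFun g hg0 (matUnit r s i)
    choose d hd hd' using fun s => h.lift_tensorFun g hg0 (matUnit r j s * m)
    have h2 : b' = ∑ s, c s * b * d s := by
      refine h.inj _ _ ?_ fun y => ?_
      · rw [hb', map_sum]
        exact (Finset.sum_eq_zero fun s _ => by rw [map_mul, hd, mul_zero]).symm
      · have h3 : ∀ s, matUnit r s i * coord b y * matUnit r j s = f y • matUnit r s s := by
          intro s
          ext p q
          rw [mul_assoc, matUnit_mul, CStarMatrix.mul_apply, CStarMatrix.smul_apply, matUnit_apply,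
            Finset.sum_eq_single j]
          · simp only [matUnit_apply, true_and, smul_eq_mul, mul_ite, mul_one, mul_zero]
            split_ifs <;> simp_all [f]
          · intro k _ hk; simp [matUnit_apply, hk]
          · simp
        rw [hb'', coord_sum]
        have h4 : ∀ s, coord (c s * b * d s) y = (g * g * f) y • (matUnit r s s * m) := fun s => by
          rw [coord_mul, coord_mul, hc', hd', smul_mul_assoc, smul_mul_smul_comm, ← mul_assoc, h3,
            smul_mul_assoc, smul_smul]
          rfl
        simp only [h4]
        rw [← Finset.smul_sum, ← Finset.sum_mul, sum_matUnit, one_mul]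
    rw [h2, map_sum]
    exact Finset.sum_eq_zero fun s _ => hb _ _ (hc s) (hd s)
  have h5 := hx.2 _ h1
  rw [ContinuousMap.mul_apply, ContinuousMap.mul_apply, hg1 x rfl, one_mul, one_mul] at h5
  exact h5

/-- Functions separating finitely many points of the hull have linearly independent images under ψ,
so there are at most dim A such points. -/
theorem finite_hull [T2Space X] [FiniteDimensional ℂ A] (hr : 0 < r) : (h.hull ψ).Finite := by
  classical
  by_contra hinf
  obtain ⟨t, ht, htc⟩ := Set.Infinite.exists_subset_card_eq hinf (Module.finrank ℂ A + 1)
  have h1 : ∀ x : t, ∃ g : C(X, ℂ), (∀ y ∈ Ω, g y = 0) ∧ ∀ y : t, g y = if y = x then 1 else 0 := by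
    intro x
    obtain ⟨g, hg0, hg1, -⟩ := exists_urysohn (h.closed.union (t.erase x).finite_toSet.isClosed)
      (isClosed_singleton (x := (x : X))) (Set.disjoint_singleton_right.mpr (by
        simpa using (ht x.2).1))
    refine ⟨g, fun y hy => hg0 y (Or.inl hy), fun y => ?_⟩
    split_ifs with hyx
    · exact hg1 y (by rw [hyx]; rfl)
    · exact hg0 y (Or.inr (by simp [Subtype.coe_inj, hyx]))
  choose g hg0 hg1 using h1
  choose b hb hb' using fun x => h.lift_tensorFun (g x) (hg0 x) 1
  have hli : LinearIndependent ℂ fun x => ψ (b x) := by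
    rw [Fintype.linearIndependent_iff]
    intro c hc y
    have h2 : ψ (∑ x, c x • b x) = 0 := by rw [map_sum]; simpa using hc
    have h3 : coord (∑ x, c x • b x) y = 0 := by
      refine h.coord_eq_zero ψ (fun a a' _ _ => ?_) (ht y.2)
      rw [map_mul, map_mul, h2, mul_zero, zero_mul]
    have h4 : ∀ x, coord (c x • b x) y = (c x * g x y) • 1 := fun x => by
      rw [map_smul, mul_smul, ← hb']; rfl
    rw [coord_sum] at h3
    simp only [h4, hg1, mul_ite, mul_one, mul_zero, ite_smul, zero_smul, Finset.sum_ite_eq,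
      Finset.mem_univ, if_true] at h3
    have h5 := congrArg (fun z : CMat r ℂ => z ⟨0, hr⟩ ⟨0, hr⟩) h3
    simpa using h5
  have := hli.fintype_card_le_finrank
  rw [Fintype.card_coe, htc] at this
  omega

/-- A homomorphism of a pullback into a finite dimensional algebra is seen at finitely many points
and on the quotient. -/
theorem exists_ker_eq [T2Space X] [FiniteDimensional ℂ A] (hr : 0 < r) :
    ∃ (Z : Finset X) (ψ' : T →⋆ₙₐ[ℂ] A), (∀ x ∈ Z, x ∉ Ω) ∧
      ∀ b : S, ψ b = 0 ↔ (∀ x ∈ Z, coord b x = 0) ∧ ψ' (down b) = 0 := by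
  have hfin := h.finite_hull ψ hr
  -- The element u = g ⊗ 1 is central in S, and ψ u is a unit for the image of the ideal ker `down`.
  -- Thus ψ u is a projection commuting with the image of ψ.
  obtain ⟨g, hg0, hg1, hgs⟩ := exists_urysohn h.closed hfin.isClosed
    (Set.disjoint_right.mpr fun x hx => hx.1)
  obtain ⟨u, hu, hu'⟩ := h.lift_tensorFun g hg0 1
  have hcomm : ∀ b, b * u = u * b := fun b => h.inj _ _ (by
    rw [map_mul, map_mul, hu, mul_zero, zero_mul]) fun x => by
      rw [coord_mul, coord_mul, hu']
      simp
  have hus : star u = u := h.inj _ _ (by rw [map_star, hu, star_zero]) fun x => by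
    rw [coord_star, hu', star_smul, star_one, ← ContinuousMap.star_apply, hgs]
  have hker : ∀ b, down b = 0 → ψ (u * b) = ψ b := fun b hb => by
    rw [← sub_eq_zero, ← map_sub]
    refine h.eq_zero_of_hull ψ (by rw [map_sub, map_mul, hb, mul_zero, sub_zero]) fun x hx => ?_
    rw [coord_sub, coord_mul, hu', hg1 x hx, one_smul, one_mul, sub_self]
  have huu : ψ u * ψ u = ψ u := by rw [← map_mul, hker u hu]
  have hcomm' : ∀ b, ψ b * ψ u = ψ u * ψ b := fun b => by rw [← map_mul, hcomm, map_mul]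
  -- The complementary part (1 - ψ u) ψ is a homomorphism which kills the ideal, so it descends to
  -- the quotient T.
  let χ : S →ₗ[ℂ] A := 
    { toFun := fun b => ψ b - ψ u * ψ b
      map_add' := fun b c => by rw [map_add, mul_add]; abel
      map_smul' := fun c b => by
        rw [map_smul, mul_smul_comm, RingHom.id_apply, smul_sub] }
  have hχ : ∀ b, χ b = ψ b - ψ u * ψ b := fun b => rfl
  have hχ0 : ∀ b c, down b = down c → χ b = χ c := fun b c hbc => by
    rw [← sub_eq_zero, ← map_sub, hχ, ← map_mul, hker _ (by rw [map_sub, hbc, sub_self]), sub_self]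
  have hsinv := fun a => Function.surjInv_eq h.surj a
  let ψ' : T →⋆ₙₐ[ℂ] A :=
    { toFun := fun a => χ (Function.surjInv h.surj a)
      map_smul' := fun c a => by
        rw [hχ0 _ (c • Function.surjInv h.surj a) (by rw [map_smul, hsinv, hsinv]), map_smul]
        rfl
      map_zero' := by rw [hχ0 _ 0 (by rw [hsinv, map_zero]), map_zero]
      map_add' := fun a a' => by
        rw [hχ0 _ (Function.surjInv h.surj a + Function.surjInv h.surj a')
          (by rw [map_add, hsinv, hsinv, hsinv]), map_add]
      map_mul' := fun a a' => by
        rw [hχ0 _ (Function.surjInv h.surj a * Function.surjInv h.surj a')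
          (by rw [map_mul, hsinv, hsinv, hsinv]), hχ, hχ, hχ, map_mul]
        generalize Function.surjInv h.surj a = b
        generalize Function.surjInv h.surj a' = c
        have h1 : ψ b * (ψ u * ψ c) = ψ u * (ψ b * ψ c) := by rw [← mul_assoc, hcomm', mul_assoc]
        have h2 : ψ u * ψ b * (ψ u * ψ c) = ψ u * (ψ b * ψ c) := by
          rw [mul_assoc, h1, ← mul_assoc, huu]
        rw [sub_mul, mul_sub, mul_sub, h1, h2, mul_assoc]
        abel
      map_star' := fun a => by
        rw [hχ0 _ (star (Function.surjInv h.surj a)) (by rw [map_star, hsinv, hsinv]), hχ, hχ,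
          star_sub, star_mul, map_star, ← map_star ψ u, hus, ← map_star, hcomm'] }
  have hψ' : ∀ b, ψ' (down b) = ψ b - ψ u * ψ b := fun b => hχ0 _ _ (hsinv _)
  refine ⟨hfin.toFinset, ψ', fun x hx => (hfin.mem_toFinset.mp hx).1, fun b => ⟨fun hb => ?_, ?_⟩⟩
  · refine ⟨fun x hx => h.coord_eq_zero ψ (fun c d _ _ => ?_) (hfin.mem_toFinset.mp hx), ?_⟩
    · rw [map_mul, map_mul, hb, mul_zero, zero_mul]
    · rw [hψ', hb, mul_zero, sub_zero]
  · rintro ⟨hb1, hb2⟩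
    have h1 : ψ (u * b) = 0 := h.eq_zero_of_hull ψ (by rw [map_mul, hu, zero_mul]) fun x hx => by
      rw [coord_mul, hb1 x (hfin.mem_toFinset.mpr hx), mul_zero]
    rw [hψ', ← map_mul, h1, sub_zero] at hb2
    exact hb2

end IsPullback

end Pullback

/-! ### Homomorphisms of the stages and generic points -/

namespace RSHDecomposition

variable {B : Type*} [CStarAlgebra B] {R : ℕ} (D : RSHDecomposition B R)

theorem isPullback (l : Fin R) : IsPullback (D.Ω l) (D.down l) (D.coord l) where
  closed := D.isClosed_Ω l
  surj := D.down_surjective l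
  inj b b' h1 h2 := by
    obtain ⟨c, -, hc⟩ := D.pullback l (D.down l b) (D.coord l b) (D.comm l b)
    rw [hc b ⟨rfl, rfl⟩, hc b' ⟨h1.symm, ContinuousMap.ext fun x => (h2 x).symm⟩]
  zero b hb x hx := by
    have h := D.comm l b
    rw [hb, map_zero] at h
    exact (congrArg (fun f : C(D.Ω l, CMat (D.r l) ℂ) => f ⟨x, hx⟩) h).symm
  lift f hf := D.exists_ideal_lift l f hf

theorem ψ_eq_zero_of_le {i j : Fin (R + 1)} (hij : i ≤ j) {b : B} (hb : D.ψ j b = 0) :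
    D.ψ i b = 0 := by
  induction j using Fin.induction with
  | zero => rwa [Fin.le_zero_iff.mp hij]
  | succ l ih =>
    rcases hij.eq_or_lt with rfl | h
    · exact hb
    · refine ih (Fin.le_castSucc_iff.mpr h) ?_
      rw [ψ_castSucc]
      change D.down l (D.ψ l.succ b) = 0
      rw [hb, map_zero]

/-- Points of the spaces `X l ∖ Ω l`. -/
def GenericPoint : Type _ := {p : Σ l, D.X l // p.2 ∉ D.Ω p.1}

variable {D}

/-- The index `l` of a point of `X l ∖ Ω l`. -/
def GenericPoint.level (p : D.GenericPoint) : Fin R := p.1.1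

/-- The evaluation at a point of `X l ∖ Ω l`. -/
noncomputable def GenericPoint.eval (p : D.GenericPoint) : B →⋆ₐ[ℂ] CMat (D.r p.level) ℂ :=
  D.evalAt p.1.1 p.1.2

theorem GenericPoint.eval_surjective (p : D.GenericPoint) : Function.Surjective p.eval :=
  D.evalAt_surjective _ p.2

/-- The kernel of a homomorphism of a stage into a finite dimensional algebra is the joint kernel of
the evaluations at finitely many points. -/
theorem exists_genericPoints {A : Type*} [CStarAlgebra A] [FiniteDimensional ℂ A] (j : Fin (R + 1))
    (χ : D.stage j →⋆ₙₐ[ℂ] A) :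
    ∃ P : Finset D.GenericPoint, (∀ p ∈ P, p.level.castSucc < j) ∧
      ∀ b : B, χ (D.ψ j b) = 0 ↔ ∀ p ∈ P, p.eval b = 0 := by
  classical
  induction j using Fin.induction with
  | zero =>
    have := D.stage_zero
    exact ⟨∅, by simp, fun b => by simp [Subsingleton.elim (D.ψ 0 b) 0]⟩
  | succ l ih =>
    -- The homomorphism χ' on the previous stage need not be unital; therefore the induction runs
    -- over non-unital homomorphisms.
    obtain ⟨Z, χ', hZ, hχ'⟩ := (D.isPullback l).exists_ker_eq χ (D.r_pos l)
    obtain ⟨P, hP, hP'⟩ := ih χ'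
    let pt : {x // x ∈ Z} → D.GenericPoint := fun x => ⟨⟨l, x.1⟩, hZ x.1 x.2⟩
    refine ⟨P ∪ Z.attach.image pt, fun p hp => ?_, fun b => ?_⟩
    · rcases Finset.mem_union.mp hp with hp | hp
      · exact (hP p hp).trans Fin.castSucc_lt_succ
      · obtain ⟨x, -, rfl⟩ := Finset.mem_image.mp hp
        exact Fin.castSucc_lt_succ
    · have h1 : D.down l (D.ψ l.succ b) = D.ψ l.castSucc b := by rw [ψ_castSucc]; rfl
      rw [hχ', h1, hP']
      constructor
      · rintro ⟨h2, h3⟩ p hp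
        rcases Finset.mem_union.mp hp with hp | hp
        · exact h3 p hp
        · obtain ⟨x, -, rfl⟩ := Finset.mem_image.mp hp
          exact h2 x.1 x.2
      · refine fun h2 => ⟨fun x hx => ?_, fun p hp => h2 p (Finset.mem_union_left _ hp)⟩
        exact h2 (pt ⟨x, hx⟩) (Finset.mem_union_right _
          (Finset.mem_image.mpr ⟨⟨x, hx⟩, Finset.mem_attach _ _, rfl⟩))

end RSHDecomposition

/-! ### Evaluations at finitely many points -/

/-- Homomorphisms factor injectively through surjections with the same kernel. -/
theorem StarAlgHom.exists_factor {A A' C : Type*} [CStarAlgebra A] [CStarAlgebra A'] [CStarAlgebra C]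
    (π : A →⋆ₐ[ℂ] A') (hπ : Function.Surjective π) (ρ : A →⋆ₐ[ℂ] C)
    (h : ∀ a, ρ a = 0 ↔ π a = 0) :
    ∃ i : A' →⋆ₐ[ℂ] C, Function.Injective i ∧ ∀ a, i (π a) = ρ a := by
  have hs := fun a => Function.surjInv_eq hπ a
  have hρ : ∀ a b, π a = π b → ρ a = ρ b := fun a b hab => by
    rw [← sub_eq_zero, ← map_sub, h, map_sub, hab, sub_self]
  refine ⟨StarAlgHom.ofLinear
    { toFun := fun a => ρ (Function.surjInv hπ a)
      map_add' := fun a b => by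
        rw [hρ _ (Function.surjInv hπ a + Function.surjInv hπ b) (by rw [map_add, hs, hs, hs]),
          map_add]
      map_smul' := fun c a => by
        rw [hρ _ (c • Function.surjInv hπ a) (by rw [map_smul, hs, hs]), map_smul]
        rfl } ?_ (fun a b => ?_) fun a => ?_, ?_, fun a => hρ _ _ (hs _)⟩
  · change ρ (Function.surjInv hπ 1) = 1
    rw [hρ _ 1 (by rw [hs, map_one]), map_one]
  · change ρ (Function.surjInv hπ (a * b)) = ρ (Function.surjInv hπ a) * ρ (Function.surjInv hπ b)
    rw [hρ _ (Function.surjInv hπ a * Function.surjInv hπ b) (by rw [map_mul, hs, hs, hs]), map_mul]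
  · change ρ (Function.surjInv hπ (star a)) = star (ρ (Function.surjInv hπ a))
    rw [hρ _ (star (Function.surjInv hπ a)) (by rw [map_star, hs, hs]), map_star]
  · refine (injective_iff_map_eq_zero _).mpr fun a ha => ?_
    have ha' : ρ (Function.surjInv hπ a) = 0 := ha
    rwa [h, hs] at ha'

namespace RSHDecomposition

variable {B : Type*} [CStarAlgebra B] {R : ℕ} {D : RSHDecomposition B R}

/-- Vanishing in the previous stage makes b invisible at all points of lower levels
(`evalAt_eq_zero_of_lt`), so b peaks at x while it is controlled on t and below level l. -/
theorem exists_peak {l : Fin R} {x : D.X l} (hx : x ∉ D.Ω l) {t : Set (D.X l)} (ht : IsClosed t)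
    (hxt : x ∉ t) :
    ∃ b : B, D.ψ l.castSucc b = 0 ∧ D.evalAt l x b = 1 ∧ ∀ y ∈ t, D.evalAt l y b = 0 := by
  obtain ⟨g, hg0, hg1, -⟩ := exists_urysohn ((D.isClosed_Ω l).union ht)
    (isClosed_singleton (x := x)) (Set.disjoint_singleton_right.mpr (by simp [hx, hxt]))
  obtain ⟨c, hc, hc'⟩ := (D.isPullback l).lift_tensorFun g (fun y hy => hg0 y (Or.inl hy)) 1
  obtain ⟨b, rfl⟩ := D.ψ_surjective l.succ c
  refine ⟨b, ?_, ?_, fun y hy => ?_⟩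
  · rw [ψ_castSucc]; exact hc
  · refine (hc' x).trans ?_
    rw [hg1 x rfl, one_smul]
  · refine (hc' y).trans ?_
    rw [hg0 y (Or.inr hy), zero_smul]

theorem evalAt_eq_zero_of_lt {m l : Fin R} (hml : m < l) (y : D.X m) {b : B}
    (hb : D.ψ l.castSucc b = 0) : D.evalAt m y b = 0 := by
  have h1 : D.ψ m.succ b = 0 := D.ψ_eq_zero_of_le (Fin.succ_le_castSucc_iff.mpr hml) hb
  have h2 : D.ι m b = D.coord m (D.ψ m.succ b) := rfl
  rw [evalAt_apply, h2, h1, map_zero]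
  rfl

namespace GenericPoint

theorem exists_separating_of_le {p q : D.GenericPoint} (hpq : p ≠ q) (hle : q.level ≤ p.level) :
    ∃ b : B, p.eval b = 1 ∧ q.eval b = 0 := by
  obtain ⟨⟨l, x⟩, hx⟩ := p
  obtain ⟨⟨m, y⟩, hy⟩ := q
  have hle' : m ≤ l := hle
  rcases hle'.eq_or_lt with rfl | hlt
  · have hxy : x ∉ ({y} : Set (D.X m)) := fun h => hpq (by
      have h1 : x = y := h
      subst h1; rfl)
    obtain ⟨b, -, h1, h2⟩ := exists_peak hx isClosed_singleton hxy
    exact ⟨b, h1, h2 y rfl⟩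
  · obtain ⟨b, h0, h1, -⟩ := exists_peak hx isClosed_empty (Set.notMem_empty x)
    exact ⟨b, h1, evalAt_eq_zero_of_lt hlt y h0⟩

/-- A peak is available at the point of the higher level; for the opposite order of the points it is
replaced by 1 minus the peak. -/
theorem exists_separating {p q : D.GenericPoint} (hpq : p ≠ q) :
    ∃ b : B, p.eval b = 1 ∧ q.eval b = 0 := by
  rcases le_total q.level p.level with h | h
  · exact exists_separating_of_le hpq h
  · obtain ⟨b, h1, h2⟩ := exists_separating_of_le hpq.symm h
    exact ⟨1 - b, by rw [map_sub, map_one, h2, sub_zero], by rw [map_sub, map_one, h1, sub_self]⟩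

theorem exists_separating_finset (p : D.GenericPoint) (Q : Finset D.GenericPoint) :
    ∃ b : B, p.eval b = 1 ∧ ∀ q ∈ Q, q ≠ p → q.eval b = 0 := by
  classical
  induction Q using Finset.induction_on with
  | empty => exact ⟨1, map_one _, by simp⟩
  | insert q Q _ ih =>
    obtain ⟨b, h1, h2⟩ := ih
    by_cases hq : q = p
    · refine ⟨b, h1, fun q' hq' hne => ?_⟩
      rcases Finset.mem_insert.mp hq' with rfl | hq'
      · exact absurd hq hne
      · exact h2 q' hq' hne
    · obtain ⟨c, h3, h4⟩ := exists_separating (Ne.symm hq)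
      refine ⟨b * c, by rw [map_mul, h1, h3, one_mul], fun q' hq' hne => ?_⟩
      rcases Finset.mem_insert.mp hq' with rfl | hq'
      · rw [map_mul, h4, mul_zero]
      · rw [map_mul, h2 q' hq' hne, zero_mul]

variable {n : ℕ}

/-- The sum of the evaluations at finitely many points. -/
noncomputable def evalPi (p : Fin n → D.GenericPoint) :
    B →⋆ₐ[ℂ] ∀ k, CMat (D.r (p k).level) ℂ :=
  piStarAlgHom fun k => (p k).eval

theorem evalPi_apply (p : Fin n → D.GenericPoint) (b : B) (k : Fin n) :
    evalPi p b k = (p k).eval b := rfl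

/-- The Chinese remainder argument: elements which are 1 at one point and 0 at the others select the
values prescribed there. -/
theorem evalPi_surjective {p : Fin n → D.GenericPoint} (hp : Function.Injective p) :
    Function.Surjective (evalPi p) := by
  classical
  intro a
  choose b hb hb' using fun k => exists_separating_finset (p k) (Finset.univ.image p)
  choose c hc using fun k => (p k).eval_surjective (a k)
  refine ⟨∑ k, b k * c k, funext fun k => ?_⟩
  rw [evalPi_apply, map_sum, Finset.sum_eq_single k]
  · rw [map_mul, hb, hc, one_mul]
  · intro j _ hj
    rw [map_mul, hb' j (p k) (Finset.mem_image_of_mem p (Finset.mem_univ k))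
      fun h => hj (hp h).symm, zero_mul]
  · simp

end GenericPoint

open GenericPoint

variable (D) in
/-- The evaluation at an arbitrary point, as a sum of evaluations at distinct generic points. -/
theorem exists_eval_factor (l : Fin R) (x : D.X l) :
    ∃ (n : ℕ) (_ : NeZero n) (p : Fin n → D.GenericPoint)
      (i : (∀ k, CMat (D.r (p k).level) ℂ) →⋆ₐ[ℂ] CMat (D.r l) ℂ),
      Function.Injective p ∧ Function.Injective i ∧ (∀ b, i (evalPi p b) = D.evalAt l x b) ∧
      (x ∈ D.Ω l → ∀ k, (p k).level < l) := by
  have : FiniteDimensional ℂ (CMat (D.r l) ℂ) :=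
    inferInstanceAs (FiniteDimensional ℂ (Matrix (Fin (D.r l)) (Fin (D.r l)) ℂ))
  -- Over Ω l the evaluation factors through the gluing map φ and hence through the previous stage,
  -- which forces all points found below to have level less than l.
  obtain ⟨j, hj, χ, hχ⟩ : ∃ (j : Fin (R + 1)) (_ : x ∈ D.Ω l → j = l.castSucc)
      (χ : D.stage j →⋆ₙₐ[ℂ] CMat (D.r l) ℂ), ∀ b, χ (D.ψ j b) = D.evalAt l x b := by
    by_cases hx : x ∈ D.Ω l
    · refine ⟨l.castSucc, fun _ => rfl,
        { toFun := fun a => D.φ l a ⟨x, hx⟩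
          map_smul' := fun c a => by rw [map_smul]; rfl
          map_zero' := by rw [map_zero]; rfl
          map_add' := fun a b => by rw [map_add]; rfl
          map_mul' := fun a b => by rw [map_mul]; rfl
          map_star' := fun a => by rw [map_star]; rfl }, fun b => ?_⟩
      change D.φ l (D.ψ l.castSucc b) ⟨x, hx⟩ = D.coord l (D.ψ l.succ b) x
      have h1 : D.ψ l.castSucc b = D.down l (D.ψ l.succ b) := by rw [ψ_castSucc]; rfl
      rw [h1, D.comm]
      rfl
    · exact ⟨l.succ, fun h => absurd h hx,
        { toFun := fun a => D.coord l a x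
          map_smul' := fun c a => by rw [map_smul]; rfl
          map_zero' := by rw [map_zero]; rfl
          map_add' := fun a b => by rw [map_add]; rfl
          map_mul' := fun a b => by rw [map_mul]; rfl
          map_star' := fun a => by rw [map_star]; rfl }, fun b => rfl⟩
  obtain ⟨P, hP, hP'⟩ := exists_genericPoints j χ
  let p : Fin P.card → D.GenericPoint := fun k => P.equivFin.symm k
  have hpmem : ∀ k, p k ∈ P := fun k => (P.equivFin.symm k).2
  have hpi : Function.Injective p := Subtype.val_injective.comp P.equivFin.symm.injective
  have hker : ∀ b, D.evalAt l x b = 0 ↔ evalPi p b = 0 := fun b => by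
    rw [← hχ, hP', funext_iff]
    refine ⟨fun h k => h _ (hpmem k), fun h q hq => ?_⟩
    have h1 := h (P.equivFin ⟨q, hq⟩)
    rw [evalPi_apply] at h1
    have h2 : p (P.equivFin ⟨q, hq⟩) = q := by simp [p]
    rw [← h2]
    exact h1
  -- Without any points the evaluation would be 0, but it is unital and r l > 0.
  have hcard : NeZero P.card := ⟨fun h0 => by
    have h1 : evalPi p (1 : B) = 0 := funext fun k => absurd k.2 (by omega)
    rw [← hker, map_one] at h1
    have h2 := congrArg (fun z : CMat (D.r l) ℂ => z ⟨0, D.r_pos l⟩ ⟨0, D.r_pos l⟩) h1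
    exact one_ne_zero (α := ℂ) (by simpa using h2)⟩
  obtain ⟨i, hi, hi'⟩ := StarAlgHom.exists_factor (evalPi p) (evalPi_surjective hpi)
    (D.evalAt l x) hker
  refine ⟨P.card, hcard, p, i, hpi, hi, hi', fun hx k => ?_⟩
  have h1 := hP _ (hpmem k)
  rwa [hj hx, Fin.castSucc_lt_castSucc_iff] at h1

instance neZero_r (l : Fin R) : NeZero (D.r l) := ⟨(D.r_pos l).ne'⟩

/-- Every evaluation followed by a homomorphism to `𝒬` comes from a weighted excisor of a point. -/
theorem exists_isPoint (F : Finset B) {η : ℝ} (hη : 0 < η) (l : Fin R) (x : D.X l)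
    (j : CMat (D.r l) ℂ →⋆ₐ[ℂ] UniversalUHF) :
    ∃ V : ExcisorData D, V.IsWeightedExcisor F η ∧ V.IsPoint l x ∧ V.total = j.comp (D.evalAt l x) := by
  obtain ⟨n, hn, p, i, hp, hi, hi', -⟩ := D.exists_eval_factor l x
  choose σ hσ using fun k => ExcisorData.exists_ofPoint F hη (p k).2
  let κ : (∀ k, CMat (D.r (p k).level) ℂ) →⋆ₐ[ℂ] UniversalUHF := j.comp i
  let V := ExcisorData.diagSum
    (fun k => ExcisorData.ofPoint D (p k).1.1 (p k).1.2 (σ k) (UniversalUHF.ofMat _)) κ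
  have hV : V.total = j.comp (D.evalAt l x) := by
    ext b
    exact congrArg j (hi' b)
  exact ⟨V, .diagSum hη (fun k => hσ k _) κ,
    ⟨evalPi_surjective hp, i, j, hi, hi', rfl⟩, hV⟩

/-- The only use of connectedness. Since every evaluation, even at points of Ω l, comes from a point
excisor, the choice of the point within X l and of the embedding of M_{r l} in 𝒬 is irrelevant up to
bridges. -/
theorem homBridge_evalAt {F : Finset B} {η : ℝ} (hη : 0 < η) (hconn : D.IsConnected F η)
    (l : Fin R) (x y : D.X l) (j j' : CMat (D.r l) ℂ →⋆ₐ[ℂ] UniversalUHF) :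
    HomBridge D F η (j.comp (D.evalAt l x)) (j'.comp (D.evalAt l y)) := by
  obtain ⟨V, hV, hVp, hVt⟩ := exists_isPoint F hη l x j
  obtain ⟨W, hW, hWp, hWt⟩ := exists_isPoint F hη l y j'
  rw [← hVt, ← hWt]
  exact (hconn l x y V W hV hW hVp hWp).hom

end RSHDecomposition

/-! ### Unitary equivalence of homomorphisms into matrix algebras -/

section UnitaryEquivalence

open Matrix

/-- The columns of A are the orthonormal eigenvectors for the eigenvalue 1. Consequently the trace
of P is the natural number m. -/
theorem Matrix.exists_isometry_of_projection {n : Type*} [Fintype n] [DecidableEq n]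
    {P : Matrix n n ℂ} (hPP : P * P = P)
    (hP : Pᴴ = P) :
    ∃ (m : ℕ) (A : Matrix n (Fin m) ℂ), A * Aᴴ = P ∧ Aᴴ * A = 1 := by
  have hH : P.IsHermitian := hP
  have hev : ∀ i, hH.eigenvalues i = 0 ∨ hH.eigenvalues i = 1 := fun i => by
    have h := IsIdempotentElem.spectrum_subset ℝ (p := P) hPP (hH.eigenvalues_mem_spectrum_real i)
    simpa using h
  set U : Matrix n n ℂ := (hH.eigenvectorUnitary : Matrix n n ℂ) with hU
  have hUU : Uᴴ * U = 1 := Unitary.coe_star_mul_self hH.eigenvectorUnitary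
  have hspec : P = U * diagonal (fun i => (hH.eigenvalues i : ℂ)) * Uᴴ := hH.spectral_theorem
  let s := {i // hH.eigenvalues i = 1}
  let e : Fin (Fintype.card s) ≃ s := (Fintype.equivFin s).symm
  refine ⟨Fintype.card s, U.submatrix id fun k => (e k : n), ?_, ?_⟩
  · conv_rhs => rw [hspec]
    ext p q
    rw [Matrix.mul_apply, Matrix.mul_apply]
    simp only [Matrix.submatrix_apply, Matrix.conjTranspose_apply, Matrix.mul_diagonal, id]
    rw [e.sum_comp (fun k : s => U p k * star (U q k)),
      ← Finset.sum_subtype (Finset.univ.filter fun i => hH.eigenvalues i = 1) (by simp)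
        (fun i => U p i * star (U q i)), Finset.sum_filter]
    refine Finset.sum_congr rfl fun i _ => ?_
    rcases hev i with h | h <;> simp [h]
  · ext k l
    have h := congrFun (congrFun hUU (e k)) (e l)
    rw [Matrix.one_apply] at h ⊢
    simp only [Subtype.coe_inj, e.injective.eq_iff] at h
    rw [← h]
    rfl

theorem Matrix.exists_partialIsometry {N : ℕ} {P Q : Matrix (Fin N) (Fin N) ℂ} (hPP : P * P = P)
    (hP : Pᴴ = P) (hQQ : Q * Q = Q) (hQ : Qᴴ = Q) (h : P.trace = Q.trace) :
    ∃ w : Matrix (Fin N) (Fin N) ℂ, wᴴ * w = P ∧ w * wᴴ = Q := by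
  obtain ⟨m, A, hA, hA'⟩ := Matrix.exists_isometry_of_projection hPP hP
  obtain ⟨m', A', hB, hB'⟩ := Matrix.exists_isometry_of_projection hQQ hQ
  have hm : m = m' := by
    rw [← hA, ← hB, Matrix.trace_mul_comm, Matrix.trace_mul_comm A', hA', hB', Matrix.trace_one,
      Matrix.trace_one] at h
    simpa using h
  subst hm
  refine ⟨A' * Aᴴ, ?_, ?_⟩
  · rw [conjTranspose_mul, conjTranspose_conjTranspose, Matrix.mul_assoc, ← Matrix.mul_assoc A'ᴴ,
      hB', Matrix.one_mul, hA]
  · rw [conjTranspose_mul, conjTranspose_conjTranspose, Matrix.mul_assoc, ← Matrix.mul_assoc Aᴴ,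
      hA', Matrix.one_mul, hB]

/-- The trace on a matrix algebra. -/
def CStarMatrix.tr {r : ℕ} (a : CMat r ℂ) : ℂ := ∑ i, a i i

theorem CStarMatrix.tr_mul_comm {r : ℕ} (a b : CMat r ℂ) : (a * b).tr = (b * a).tr :=
  Matrix.trace_mul_comm (show Matrix (Fin r) (Fin r) ℂ from a) b

theorem CStarMatrix.tr_sum {r : ℕ} {ι : Type*} (t : Finset ι) (a : ι → CMat r ℂ) :
    (∑ i ∈ t, a i).tr = ∑ i ∈ t, (a i).tr := by
  simp only [CStarMatrix.tr, CStarMatrix.finset_sum_apply]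
  exact Finset.sum_comm

theorem CStarMatrix.tr_one {r : ℕ} : (1 : CMat r ℂ).tr = r := by
  simp [CStarMatrix.tr]

variable {n N : ℕ} {d : Fin n → ℕ}

theorem pi_single_mul_ne {d : Fin n → ℕ} {k l : Fin n} (h : k ≠ l) (a : CMat (d k) ℂ)
    (b : CMat (d l) ℂ) :
    (Pi.single k a * Pi.single l b : ∀ k, CMat (d k) ℂ) = 0 := by
  ext1 j
  by_cases hj : j = k
  · subst hj
    rw [Pi.mul_apply, Pi.single_eq_of_ne h, mul_zero, Pi.zero_apply]
  · rw [Pi.mul_apply, Pi.single_eq_of_ne hj, zero_mul, Pi.zero_apply]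

theorem pi_single_mul_eq {d : Fin n → ℕ} (k : Fin n) (a b : CMat (d k) ℂ) :
    (Pi.single k a * Pi.single k b : ∀ k, CMat (d k) ℂ) = Pi.single k (a * b) := by
  ext1 j
  by_cases hj : j = k
  · subst hj; simp
  · simp [Pi.single_eq_of_ne hj]

theorem pi_single_sum {d : Fin n → ℕ} (k : Fin n) {ι : Type*} (t : Finset ι)
    (a : ι → CMat (d k) ℂ) :
    (Pi.single k (∑ i ∈ t, a i) : ∀ k, CMat (d k) ℂ) = ∑ i ∈ t, Pi.single k (a i) :=
  map_sum (AddMonoidHom.single (fun k => CMat (d k) ℂ) k) _ _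

theorem star_pi_single {d : Fin n → ℕ} (k : Fin n) (a : CMat (d k) ℂ) :
    star (Pi.single k a : ∀ k, CMat (d k) ℂ) = Pi.single k (star a) := by
  ext1 j
  by_cases hj : j = k
  · subst hj; simp
  · simp [Pi.single_eq_of_ne hj]

theorem sum_matUnit_eq {r : ℕ} (a : CMat r ℂ) : a = ∑ i, ∑ j, a i j • matUnit r i j := by
  ext p q
  simp only [CStarMatrix.finset_sum_apply, CStarMatrix.smul_apply, matUnit_apply]
  rw [Finset.sum_eq_single p, Finset.sum_eq_single q]
  · simp
  · intro j _ hj; simp [hj.symm]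
  · simp
  · intro i _ hi; simp [hi.symm]
  · simp

/-- Two homomorphisms into a matrix algebra with the same multiplicities are unitarily
equivalent. -/
theorem exists_unitary_conj (hd : ∀ k, 0 < d k)
    (lam lam' : (∀ k, CMat (d k) ℂ) →⋆ₐ[ℂ] CMat N ℂ)
    (h : ∀ k, (lam (Pi.single k 1)).tr = (lam' (Pi.single k 1)).tr) :
    ∃ u ∈ unitary (CMat N ℂ), ∀ a, lam' a = u * lam a * star u := by
  let o : ∀ k, Fin (d k) := fun k => ⟨0, hd k⟩
  let e : ∀ k, Fin (d k) → Fin (d k) → ∀ k, CMat (d k) ℂ := fun k i j =>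
    Pi.single k (matUnit (d k) i j)
  have hee : ∀ k i j i' j', e k i j * e k i' j' = if j = i' then e k i j' else 0 := by
    intro k i j i' j'
    simp only [e, pi_single_mul_eq, matUnit_mul_matUnit]
    split_ifs
    · rfl
    · exact Pi.single_zero k
  have hene : ∀ k l i j i' j', k ≠ l → e k i j * e l i' j' = 0 := fun k l i j i' j' hkl =>
    pi_single_mul_ne hkl _ _
  have hes : ∀ k i j, star (e k i j) = e k j i := fun k i j => by
    simp only [e, star_pi_single, star_matUnit]
  have hsum : ∀ k, (Pi.single k 1 : ∀ k, CMat (d k) ℂ) = ∑ i, e k i i := fun k => by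
    simp only [e, ← sum_matUnit]
    exact pi_single_sum k _ _
  have htr : ∀ (μ : (∀ k, CMat (d k) ℂ) →⋆ₐ[ℂ] CMat N ℂ) k,
      (μ (Pi.single k 1)).tr = d k * (μ (e k (o k) (o k))).tr := fun μ k => by
    have h1 : ∀ i, (μ (e k i i)).tr = (μ (e k (o k) (o k))).tr := fun i => by
      have h2 : e k i i = e k i (o k) * e k (o k) i := by rw [hee, if_pos rfl]
      rw [h2, map_mul, CStarMatrix.tr_mul_comm, ← map_mul, hee, if_pos rfl]
    rw [hsum, map_sum, CStarMatrix.tr_sum]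
    simp [h1]
  -- The trace of the central projection is d k times that of a minimal projection below it, so the
  -- images of the minimal projections have the same rank.
  have hw : ∀ k, ∃ w : CMat N ℂ, star w * w = lam (e k (o k) (o k)) ∧
      w * star w = lam' (e k (o k) (o k)) := fun k => by
    refine Matrix.exists_partialIsometry (P := lam (e k (o k) (o k)))
      (Q := lam' (e k (o k) (o k))) ?_ ?_ ?_ ?_ ?_
    · exact (map_mul lam _ _).symm.trans (by rw [hee, if_pos rfl])
    · exact (map_star lam _).symm.trans (by rw [hes])
    · exact (map_mul lam' _ _).symm.trans (by rw [hee, if_pos rfl])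
    · exact (map_star lam' _).symm.trans (by rw [hes])
    · have h1 := h k
      rw [htr, htr] at h1
      have h2 : (d k : ℂ) ≠ 0 := by exact_mod_cast (hd k).ne'
      exact mul_left_cancel₀ h2 h1
  choose w hw1 hw2 using hw
  have hw3 : ∀ k, w k * lam (e k (o k) (o k)) = w k := fun k => by
    rw [← hw1, ← sub_eq_zero]
    have h1 : (w k * (star (w k) * w k) - w k) * star (w k * (star (w k) * w k) - w k) = 0 := by
      have h2 : w k * star (w k) * (w k * star (w k)) = w k * star (w k) := by
        rw [hw2, ← map_mul, hee, if_pos rfl]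
      simp only [star_sub, star_mul, star_star, sub_mul, mul_sub]
      have h3 : w k * (star (w k) * w k) * (star (w k) * w k * star (w k)) = w k * star (w k) := by
        calc _ = w k * star (w k) * (w k * star (w k)) * (w k * star (w k)) := by noncomm_ring
          _ = _ := by rw [h2, h2]
      have h4 : w k * (star (w k) * w k) * star (w k) = w k * star (w k) := by
        rw [← h2]; noncomm_ring
      have h5 : w k * (star (w k) * w k * star (w k)) = w k * star (w k) := by
        rw [← h2]; noncomm_ring
      rw [h3, h4, h5]
      abel
    exact CStarRing.mul_star_self_eq_zero_iff _ |>.mp h1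
  -- The partial isometries between the minimal corners are spread over all matrix units; u
  -- intertwines the two homomorphisms.
  let u : CMat N ℂ := ∑ k, ∑ i, lam' (e k i (o k)) * w k * lam (e k (o k) i)
  have hue : ∀ k i j, u * lam (e k i j) = lam' (e k i (o k)) * w k * lam (e k (o k) j) := by
    intro k i j
    simp only [u, Finset.sum_mul, mul_assoc]
    rw [Finset.sum_eq_single k, Finset.sum_eq_single i]
    · rw [← map_mul, hee, if_pos rfl]
    · intro i' _ hi
      rw [← map_mul, hee, if_neg hi, map_zero, mul_zero, mul_zero]
    · simp
    · intro l _ hl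
      refine Finset.sum_eq_zero fun i' _ => ?_
      rw [← map_mul, hene _ _ _ _ _ _ hl, map_zero, mul_zero, mul_zero]
    · simp
  have heu : ∀ k i j, lam' (e k i j) * u = lam' (e k i (o k)) * w k * lam (e k (o k) j) := by
    intro k i j
    simp only [u, Finset.mul_sum, ← mul_assoc]
    rw [Finset.sum_eq_single k, Finset.sum_eq_single j]
    · rw [← map_mul, hee, if_pos rfl]
    · intro i' _ hi
      rw [← map_mul, hee, if_neg hi.symm, map_zero, zero_mul, zero_mul]
    · simp
    · intro l _ hl
      refine Finset.sum_eq_zero fun i' _ => ?_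
      rw [← map_mul, hene _ _ _ _ _ _ hl.symm, map_zero, zero_mul, zero_mul]
    · simp
  have hcomm : ∀ a, lam' a * u = u * lam a := fun a => by
    have ha : a = ∑ k, ∑ i, ∑ j, a k i j • e k i j := by
      conv_lhs => rw [← Finset.univ_sum_single a]
      refine Finset.sum_congr rfl fun k _ => ?_
      conv_lhs => rw [sum_matUnit_eq (a k)]
      rw [pi_single_sum]
      refine Finset.sum_congr rfl fun i _ => ?_
      rw [pi_single_sum]
      refine Finset.sum_congr rfl fun j _ => ?_
      ext1 l
      by_cases hl : l = k
      · subst hl; simp [e]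
      · simp [e, Pi.single_eq_of_ne hl]
    rw [ha]
    simp only [map_sum, map_smul, Finset.sum_mul, Finset.mul_sum, smul_mul_assoc, mul_smul_comm,
      heu, hue]
  have huu : u * star u = 1 := by
    have h1 : ∀ k i, lam' (e k i (o k)) * w k * lam (e k (o k) i) * star u = lam' (e k i i) := by
      intro k i
      have h2 : star u = ∑ l, ∑ j, lam (e l j (o l)) * star (w l) * lam' (e l (o l) j) := by
        simp only [u, star_sum, star_mul, ← map_star, hes, mul_assoc]
      rw [h2]
      simp only [Finset.mul_sum]
      rw [Finset.sum_eq_single k, Finset.sum_eq_single i]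
      · have h3 : lam' (e k i (o k)) * w k * lam (e k (o k) i) *
            (lam (e k i (o k)) * star (w k) * lam' (e k (o k) i)) =
            lam' (e k i (o k)) * (w k * lam (e k (o k) i * e k i (o k)) * star (w k)) *
              lam' (e k (o k) i) := by
          rw [map_mul]; noncomm_ring
        rw [h3, hee, if_pos rfl, hw3, hw2, ← map_mul, ← map_mul, hee, if_pos rfl, hee, if_pos rfl]
      · intro j _ hj
        have h3 : lam' (e k i (o k)) * w k * lam (e k (o k) i) *
            (lam (e k j (o k)) * star (w k) * lam' (e k (o k) j)) =
            lam' (e k i (o k)) * (w k * lam (e k (o k) i * e k j (o k)) * star (w k)) *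
              lam' (e k (o k) j) := by
          rw [map_mul]; noncomm_ring
        rw [h3, hee, if_neg hj.symm, map_zero]
        simp
      · simp
      · intro l _ hl
        refine Finset.sum_eq_zero fun j _ => ?_
        have h3 : lam' (e k i (o k)) * w k * lam (e k (o k) i) *
            (lam (e l j (o l)) * star (w l) * lam' (e l (o l) j)) =
            lam' (e k i (o k)) * (w k * lam (e k (o k) i * e l j (o l)) * star (w l)) *
              lam' (e l (o l) j) := by
          rw [map_mul]; noncomm_ring
        rw [h3, hene _ _ _ _ _ _ hl.symm, map_zero]
        simp
      · simp
    have h4 : (1 : ∀ k, CMat (d k) ℂ) = ∑ k, ∑ i, e k i i := by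
      simp only [← hsum]
      exact (Finset.univ_sum_single (1 : ∀ k, CMat (d k) ℂ)).symm
    conv_lhs => enter [1]; simp only [u]
    rw [← map_one lam', h4]
    simp only [map_sum, Finset.sum_mul, h1]
  -- In a matrix algebra over ℂ a one-sided inverse is two-sided.
  have huu' : star u * u = 1 := by
    have h1 : (show Matrix (Fin N) (Fin N) ℂ from u) * (show Matrix (Fin N) (Fin N) ℂ from star u) = 1 :=
      huu
    have h2 := mul_eq_one_comm.mp h1
    exact h2
  refine ⟨u, ⟨huu', huu⟩, fun a => ?_⟩
  rw [← hcomm, mul_assoc, huu, mul_one]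

/-- Up to a scalar, every unitary matrix is connected to `1`. -/
theorem exists_joined_smul (u : CMat N ℂ) (hu : u ∈ unitary (CMat N ℂ)) :
    ∃ v : unitary (CMat N ℂ), Joined 1 v ∧ ∀ a : CMat N ℂ,
      (v : CMat N ℂ) * a * star (v : CMat N ℂ) = u * a * star u := by
  have hfin : (spectrum ℂ u).Finite := Matrix.finite_spectrum (show Matrix (Fin N) (Fin N) ℂ from u)
  have hinf : (Metric.sphere (0 : ℂ) 1).Infinite := by
    refine IsPreconnected.infinite_of_nontrivial (isPreconnected_sphere (by simp) 0 1) ?_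
    exact ⟨1, by simp, -1, by simp, by norm_num⟩
  -- The spectrum is finite and the circle is not, so u can be rotated until -1 leaves the spectrum;
  -- such a unitary is at distance less than 2 from 1. The scalar is lost in the conjugation.
  obtain ⟨c, hc, hcu⟩ := hinf.exists_notMem_finite hfin
  have hc1 : ‖c‖ = 1 := by simpa using hc
  have hc0 : c ≠ 0 := by rintro rfl; simp at hc1
  have hcc : star c * c = 1 := by
    have := Complex.conj_mul' c
    rw [hc1] at this
    simpa using this
  have hcc' : star (-c⁻¹) * -c⁻¹ = 1 := by
    rw [star_neg, neg_mul_neg, star_inv₀, ← mul_inv, hcc, inv_one]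
  have hv : (-c⁻¹) • u ∈ unitary (CMat N ℂ) := by
    refine ⟨?_, ?_⟩
    · rw [star_smul, smul_mul_smul_comm, hcc', hu.1, one_smul]
    · rw [star_smul, smul_mul_smul_comm, mul_comm, hcc', hu.2, one_smul]
  refine ⟨⟨(-c⁻¹) • u, hv⟩, Unitary.joined _ _ ?_, fun a => ?_⟩
  · refine (Unitary.norm_sub_one_lt_two_iff hv).mpr fun h => hcu ?_
    have h1 := spectrum.unit_smul_eq_smul u (Units.mk0 (-c⁻¹) (by simpa using hc0))
    have h2 : (Units.mk0 (-c⁻¹) (by simpa using hc0) : ℂˣ) • u = (-c⁻¹) • u := rfl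
    rw [h2] at h1
    rw [h1, Set.mem_smul_set] at h
    obtain ⟨z, hz, hz'⟩ := h
    have h3 : z = c := by
      have h4 : (-c⁻¹) * z = -1 := hz'
      field_simp at h4
      simpa using h4
    rwa [← h3]
  · change (-c⁻¹) • u * a * star ((-c⁻¹) • u) = _
    rw [star_smul, smul_mul_assoc, smul_mul_smul_comm, mul_comm, hcc', one_smul]

end UnitaryEquivalence

/-! ### Bridges along paths of unitaries -/

section Paths

variable {B : Type*} [CStarAlgebra B] {R : ℕ} {D : RSHDecomposition B R} {F : Finset B} {η : ℝ}

theorem StarAlgHom.continuous' {A C : Type*} [CStarAlgebra A] [CStarAlgebra C] (f : A →⋆ₐ[ℂ] C) :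
    Continuous fun a => f a :=
  AddMonoidHomClass.continuous_of_bound f 1 fun a => by
    rw [one_mul]
    exact NonUnitalStarAlgHom.norm_apply_le f a

/-- Conjugation by a unitary. -/
noncomputable def conjHom {M : Type*} [CStarAlgebra M] (u : unitary M) : M →⋆ₐ[ℂ] M :=
  (Unitary.conjStarAlgAut ℂ M u : M →⋆ₐ[ℂ] M)

theorem conjHom_apply {M : Type*} [CStarAlgebra M] (u : unitary M) (a : M) :
    conjHom u a = u * a * star (u : M) := rfl

/-- All homomorphisms along the path are excised by the same ρ and σ, with κ varying. Nearby ones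
are η-close on the finite set F, and connectedness of the interval chains them together. -/
theorem homBridge_conj (hη : 0 < η) {V : ExcisorData D} (hV : V.IsWeightedExcisor F η) {M : Type*}
    [CStarAlgebra M] (lam : V.E →⋆ₐ[ℂ] M) (j : M →⋆ₐ[ℂ] UniversalUHF) {u : unitary M}
    (hu : Joined 1 u) :
    HomBridge D F η ((j.comp lam).comp V.ρ) ((j.comp ((conjHom u).comp lam)).comp V.ρ) := by
  obtain ⟨γ⟩ := hu
  let θ : unitInterval → (B →⋆ₐ[ℂ] UniversalUHF) := fun s =>
    (j.comp ((conjHom (γ s)).comp lam)).comp V.ρ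
  have hexc : ∀ s, Excised D F η (θ s) := fun s => (hV.withκ _).excised
  have hcont : ∀ b, Continuous fun s => θ s b := fun b => by
    have h1 : Continuous fun s => ((γ s : unitary M) : M) := continuous_subtype_val.comp γ.continuous
    exact j.continuous'.comp ((h1.mul continuous_const).mul h1.star)
  have hloc : ∀ s, ∀ᶠ s' in 𝓝 s, HomBridge D F η (θ s) (θ s') ∧ HomBridge D F η (θ s') (θ s) := by
    intro s
    have h2 : ∀ᶠ s' in 𝓝 s, ∀ b ∈ F, ‖θ s b - θ s' b‖ < η := by
      rw [Filter.eventually_all_finset]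
      intro b _
      have h3 : Tendsto (fun s' => ‖θ s b - θ s' b‖) (𝓝 s) (𝓝 ‖θ s b - θ s b‖) :=
        (((continuous_const.sub (hcont b)).norm).tendsto s)
      rw [sub_self, norm_zero] at h3
      exact h3.eventually_lt_const hη
    filter_upwards [h2] with s' hs'
    have h4 : HomStep D F η (θ s) (θ s') := ⟨hexc s, hexc s', hs'⟩
    exact ⟨.single h4, .single h4.symm⟩
  have h5 := PreconnectedSpace.induction₂' (fun s s' => HomBridge D F η (θ s) (θ s')) hloc
    ⟨fun _ _ _ h h' => h.trans h'⟩ 0 1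
  have h6 : θ 0 = (j.comp lam).comp V.ρ := by
    ext b
    change j (conjHom (γ 0) (lam (V.ρ b))) = j (lam (V.ρ b))
    rw [γ.source, conjHom_apply]
    simp
  have h7 : θ 1 = (j.comp ((conjHom u).comp lam)).comp V.ρ := by
    simp only [θ, γ.target]
  rwa [h6, h7] at h5

end Paths

/-! ### Homomorphisms to `𝒬` with values in a matrix algebra -/

section BlockHom

variable {E : Type*} [CStarAlgebra E] {N m M : ℕ}

/-- The block diagonal sum of homomorphisms into a matrix algebra. -/
noncomputable def blockHom (e : Fin N × Fin m ≃ Fin M) (lam : Fin m → (E →⋆ₐ[ℂ] CMat N ℂ)) :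
    E →⋆ₐ[ℂ] CMat M ℂ :=
  StarAlgHom.ofLinear
    { toFun := fun a => CStarMatrix.ofMatrix fun p q =>
        if (e.symm p).2 = (e.symm q).2 then lam (e.symm p).2 a (e.symm p).1 (e.symm q).1 else 0
      map_add' := fun a b => by
        ext p q
        change (if _ then lam (e.symm p).2 (a + b) _ _ else 0) =
          (if _ then lam (e.symm p).2 a _ _ else 0) + (if _ then lam (e.symm p).2 b _ _ else 0)
        rw [map_add]
        split_ifs
        · rfl
        · rw [add_zero]
      map_smul' := fun c a => by
        ext p q
        change (if _ then lam (e.symm p).2 (c • a) _ _ else 0) =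
          c • (if _ then lam (e.symm p).2 a _ _ else 0)
        rw [map_smul]
        split_ifs
        · rfl
        · rw [smul_zero] }
    (by
      ext p q
      change (if _ then lam (e.symm p).2 1 _ _ else 0) = (1 : CMat M ℂ) p q
      rw [map_one, CStarMatrix.one_apply, CStarMatrix.one_apply, ← ite_and]
      refine if_congr ?_ rfl rfl
      rw [← e.symm.injective.eq_iff, Prod.ext_iff, and_comm])
    (fun a b => by
      ext p q
      change (if _ then lam (e.symm p).2 (a * b) _ _ else 0) = ∑ s,
        (if (e.symm p).2 = (e.symm s).2 then lam (e.symm p).2 a (e.symm p).1 (e.symm s).1 else 0) *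
        (if (e.symm s).2 = (e.symm q).2 then lam (e.symm s).2 b (e.symm s).1 (e.symm q).1 else 0)
      rw [← e.sum_comp, Fintype.sum_prod_type_right, Finset.sum_eq_single (e.symm p).2]
      · simp only [Equiv.symm_apply_apply, if_true, map_mul, CStarMatrix.mul_apply]
        split_ifs
        · rfl
        · simp
      · intro k _ hk
        refine Finset.sum_eq_zero fun i _ => ?_
        simp only [Equiv.symm_apply_apply, if_neg hk.symm, zero_mul]
      · simp)
    (fun a => by
      ext p q
      change (if _ then lam (e.symm p).2 (star a) (e.symm p).1 (e.symm q).1 else 0) =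
        star (if _ then lam (e.symm q).2 a (e.symm q).1 (e.symm p).1 else 0)
      by_cases h : (e.symm p).2 = (e.symm q).2
      · rw [if_pos h, if_pos h.symm, map_star, CStarMatrix.star_apply, h]
      · rw [if_neg h, if_neg (Ne.symm h), star_zero])

theorem blockHom_apply (e : Fin N × Fin m ≃ Fin M) (lam : Fin m → (E →⋆ₐ[ℂ] CMat N ℂ)) (a : E)
    (i j : Fin N) (k l : Fin m) :
    blockHom e lam a (e (i, k)) (e (j, l)) = if k = l then lam k a i j else 0 := by
  change (if (e.symm (e (i, k))).2 = (e.symm (e (j, l))).2 then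
    lam (e.symm (e (i, k))).2 a (e.symm (e (i, k))).1 (e.symm (e (j, l))).1 else 0) = _
  simp only [Equiv.symm_apply_apply]

theorem tr_blockHom (e : Fin N × Fin m ≃ Fin M) (lam : Fin m → (E →⋆ₐ[ℂ] CMat N ℂ)) (a : E) :
    (blockHom e lam a).tr = ∑ k, (lam k a).tr := by
  simp only [CStarMatrix.tr]
  rw [← e.sum_comp, Fintype.sum_prod_type_right]
  simp only [blockHom_apply, if_true]

theorem ofMat_blockHom [NeZero M] (e : Fin N × Fin m ≃ Fin M)
    (lam : Fin m → (E →⋆ₐ[ℂ] CMat N ℂ)) (a : E) :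
    UniversalUHF.ofMat M (blockHom e lam a) =
      ∑ k, ∑ i, ∑ j, lam k a i j • UniversalUHF.unit M (e (i, k)) (e (j, k)) := by
  rw [UniversalUHF.ofMat_apply, ← e.sum_comp, Fintype.sum_prod_type_right]
  refine Finset.sum_congr rfl fun k _ => Finset.sum_congr rfl fun i _ => ?_
  rw [← e.sum_comp, Fintype.sum_prod_type_right, Finset.sum_eq_single k]
  · simp only [blockHom_apply, if_true]
  · intro l _ hl
    simp only [blockHom_apply, if_neg hl.symm, zero_smul, Finset.sum_const_zero]
  · simp

/-- The index e puts the multiplicity coordinate first, matching the order of digits in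
`UniversalUHF.unit_eq_sum`. -/
theorem ofMat_amplify [NeZero N] [NeZero m] (lam : E →⋆ₐ[ℂ] CMat N ℂ)
    (e : Fin N × Fin m ≃ Fin (m * N)) (he : ∀ i k, e (i, k) = finProdFinEquiv (k, i)) :
    (UniversalUHF.ofMat N).comp lam =
      (UniversalUHF.ofMat (m * N)).comp (blockHom e fun _ : Fin m => lam) := by
  refine StarAlgHom.ext fun a => ?_
  rw [StarAlgHom.comp_apply, StarAlgHom.comp_apply, ofMat_blockHom, UniversalUHF.ofMat_apply,
    Finset.sum_comm (s := (Finset.univ : Finset (Fin m)))]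
  refine Finset.sum_congr rfl fun i _ => ?_
  rw [Finset.sum_comm (s := (Finset.univ : Finset (Fin m)))]
  refine Finset.sum_congr rfl fun j _ => ?_
  rw [UniversalUHF.unit_eq_sum N m, Finset.smul_sum]
  simp only [he]

/-- Here the position in the diagonal is the last digit, as in `UniversalUHF.corner_unit`. This is
the opposite order to that in `ofMat_amplify`. -/
theorem diagHom_ofMat [NeZero N] [NeZero m] (lam : Fin m → (E →⋆ₐ[ℂ] CMat N ℂ)) :
    diagHom m (fun k => (UniversalUHF.ofMat N).comp (lam k)) =
      (UniversalUHF.ofMat (N * m)).comp (blockHom finProdFinEquiv lam) := by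
  refine StarAlgHom.ext fun a => ?_
  change UniversalUHF.diag m (fun k => UniversalUHF.ofMat N (lam k a)) = _
  rw [StarAlgHom.comp_apply, ofMat_blockHom, UniversalUHF.diag_apply]
  refine Finset.sum_congr rfl fun k _ => ?_
  rw [UniversalUHF.ofMat_apply]
  simp only [map_sum, map_smul, UniversalUHF.corner_unit]

end BlockHom

/-! ### Matrix valued homomorphisms and their trace vectors -/

section Matricial

variable {n : ℕ} {d : Fin n → ℕ}

/-- The homomorphism `j` takes values in the standard copy of `M_N` in `𝒬`, and `t` are the traces
of the images of the minimal central projections. -/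
def IsMatricialAt (N : ℕ) [NeZero N] (j : (∀ k, CMat (d k) ℂ) →⋆ₐ[ℂ] UniversalUHF) (t : Fin n → ℂ) :
    Prop :=
  ∃ lam : (∀ k, CMat (d k) ℂ) →⋆ₐ[ℂ] CMat N ℂ, j = (UniversalUHF.ofMat N).comp lam ∧
    ∀ k, (lam (Pi.single k 1)).tr = t k * N

/-- The homomorphism `j` takes values in some standard matrix algebra, and `t` are the traces
of the images of the minimal central projections. -/
def IsMatricial (j : (∀ k, CMat (d k) ℂ) →⋆ₐ[ℂ] UniversalUHF) (t : Fin n → ℂ) : Prop :=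
  ∃ (N : ℕ) (_ : NeZero N), IsMatricialAt N j t

/-- Amplification multiplies ranks and the matrix size by the same number, so normalised traces do
not change. It allows two homomorphisms to be compared inside one matrix algebra. -/
theorem IsMatricialAt.of_dvd {N M : ℕ} [NeZero N] [hM : NeZero M] (hNM : N ∣ M)
    {j : (∀ k, CMat (d k) ℂ) →⋆ₐ[ℂ] UniversalUHF} {t : Fin n → ℂ} (h : IsMatricialAt N j t) :
    IsMatricialAt M j t := by
  obtain ⟨lam, rfl, ht⟩ := h
  obtain ⟨m, rfl⟩ := hNM
  have hm : NeZero m := ⟨by rintro rfl; exact hM.out (mul_zero _)⟩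
  have h1 : IsMatricialAt (m * N) ((UniversalUHF.ofMat N).comp lam) t := by
    refine ⟨_, ofMat_amplify lam ((Equiv.prodComm _ _).trans finProdFinEquiv) fun _ _ => rfl,
      fun k => ?_⟩
    rw [tr_blockHom]
    simp [ht]
    ring
  have h2 : ∀ (K : ℕ) (hK : NeZero K), K = m * N →
      @IsMatricialAt n d K hK ((UniversalUHF.ofMat N).comp lam) t := by
    rintro K hK rfl
    exact h1
  exact h2 _ hM (mul_comm _ _)

/-- All summands are moved to a common matrix size, the product of the individual ones; the
normalised traces of the block sum are then averages. -/
theorem IsMatricial.diagHom {m : ℕ} [NeZero m]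
    {j : Fin m → ((∀ k, CMat (d k) ℂ) →⋆ₐ[ℂ] UniversalUHF)} {t : Fin m → Fin n → ℂ}
    (h : ∀ s, IsMatricial (j s) (t s)) :
    IsMatricial (diagHom m j) fun k => (∑ s, t s k) / m := by
  choose N hN hNj using h
  have hprod : NeZero (∏ s, N s) := ⟨Finset.prod_ne_zero_iff.mpr fun s _ => (hN s).out⟩
  have h1 : ∀ s, IsMatricialAt (∏ s, N s) (j s) (t s) := fun s =>
    (hNj s).of_dvd (Finset.dvd_prod_of_mem N (Finset.mem_univ s))
  choose lam hlam ht using h1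
  refine ⟨(∏ s, N s) * m, inferInstance, blockHom finProdFinEquiv lam, ?_, fun k => ?_⟩
  · rw [← diagHom_ofMat]
    simp only [← hlam]
  · rw [tr_blockHom]
    simp only [ht]
    have hm : (m : ℂ) ≠ 0 := Nat.cast_ne_zero.mpr (NeZero.ne m)
    rw [← Finset.sum_mul, Nat.cast_mul]
    field_simp

/-- The composition of the standard embedding of `M_{d k}` with the coordinate projection. -/
noncomputable def letterHom (d : Fin n → ℕ) [∀ k, NeZero (d k)] (k : Fin n) :
    (∀ k, CMat (d k) ℂ) →⋆ₐ[ℂ] UniversalUHF :=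
  (UniversalUHF.ofMat (d k)).comp (Pi.evalStarAlgHom ℂ (fun k => CMat (d k) ℂ) k)

theorem isMatricial_letterHom [∀ k, NeZero (d k)] (k : Fin n) :
    IsMatricial (letterHom d k) fun l => if l = k then 1 else 0 := by
  refine ⟨d k, inferInstance, Pi.evalStarAlgHom ℂ (fun k => CMat (d k) ℂ) k, rfl, fun l => ?_⟩
  change ((Pi.single l 1 : ∀ k, CMat (d k) ℂ) k).tr = _
  by_cases h : l = k
  · subst h
    simp [CStarMatrix.tr_one]
  · rw [Pi.single_eq_of_ne (Ne.symm h)]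
    simp [CStarMatrix.tr, h]

theorem isMatricial_word [∀ k, NeZero (d k)] {m : ℕ} [NeZero m] (f : Fin m → Fin n) :
    IsMatricial (diagHom m fun s => letterHom d (f s)) fun l =>
      ((Finset.univ.filter fun s => f s = l).card : ℂ) / m := by
  have h := IsMatricial.diagHom fun s => isMatricial_letterHom (d := d) (f s)
  convert h using 3 with l
  rw [Finset.sum_boole]
  simp only [eq_comm]

end Matricial

/-! ### Equal trace vectors give bridges -/

namespace RSHDecomposition

variable {B : Type*} [CStarAlgebra B] {R : ℕ} {D : RSHDecomposition B R} {F : Finset B} {η : ℝ}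

open GenericPoint

/-- Inside a common matrix algebra the two homomorphisms are conjugate by a unitary, which after
multiplication by a scalar is joined to 1. Hence only the trace vector matters up to bridges. -/
theorem homBridge_of_isMatricial (hη : 0 < η) {n : ℕ} [NeZero n] (p : Fin n → D.GenericPoint)
    {j j' : (∀ k, CMat (D.r (p k).level) ℂ) →⋆ₐ[ℂ] UniversalUHF} {t : Fin n → ℂ}
    (hj : IsMatricial j t) (hj' : IsMatricial j' t) :
    HomBridge D F η (j.comp (evalPi p)) (j'.comp (evalPi p)) := by
  choose σ hσ using fun k => ExcisorData.exists_ofPoint F hη (p k).2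
  obtain ⟨N, hN, hj⟩ := hj
  obtain ⟨N', hN', hj'⟩ := hj'
  have hNN : NeZero (N * N') := inferInstance
  obtain ⟨lam, rfl, ht⟩ := hj.of_dvd (Dvd.intro N' rfl : N ∣ N * N')
  obtain ⟨lam', rfl, ht'⟩ := hj'.of_dvd (Dvd.intro_left N rfl : N' ∣ N * N')
  obtain ⟨u, hu, hu'⟩ := exists_unitary_conj (fun k => D.r_pos (p k).level) lam lam'
    fun k => by rw [ht, ht']
  obtain ⟨v, hv, hv'⟩ := exists_joined_smul u hu
  let V := ExcisorData.diagSum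
    (fun k => ExcisorData.ofPoint D (p k).1.1 (p k).1.2 (σ k) (UniversalUHF.ofMat _))
    ((UniversalUHF.ofMat (N * N')).comp lam)
  have hV : V.IsWeightedExcisor F η := .diagSum hη (fun k => hσ k _) _
  have h1 := homBridge_conj hη hV lam (UniversalUHF.ofMat (N * N')) hv
  have h2 : (conjHom v).comp lam = lam' := by
    refine StarAlgHom.ext fun a => ?_
    rw [hu', ← hv']
    rfl
  rw [← h2]
  exact h1

end RSHDecomposition

/-! ### Words of point evaluations -/

section Words

/-- The number of occurrences of the letter `l` in the word `f`. -/
def letterCount {m n : ℕ} (f : Fin m → Fin n) (l : Fin n) : ℕ :=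
  (Finset.univ.filter fun s => f s = l).card

theorem exists_word {n m : ℕ} (c : Fin n → ℕ) (h : ∑ l, c l = m) :
    ∃ f : Fin m → Fin n, ∀ l, letterCount f l = c l := by
  subst h
  let e : (Σ i, Fin (c i)) ≃ Fin (∑ i, c i) := finSigmaFinEquiv
  refine ⟨fun s => (e.symm s).1, fun l => ?_⟩
  rw [letterCount, Finset.card_filter, ← e.sum_comp]
  simp only [Equiv.symm_apply_apply]
  rw [Fintype.sum_sigma, Finset.sum_eq_single l]
  · simp
  · intro k _ hk; simp [hk]
  · simp

theorem sum_letterCount {m n : ℕ} (f : Fin m → Fin n) : ∑ l, letterCount f l = m := by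
  have h := Finset.card_eq_sum_card_fiberwise (s := (Finset.univ : Finset (Fin m)))
    (t := Finset.univ) (f := f) fun _ _ => Finset.mem_coe.mpr (Finset.mem_univ _)
  rw [Finset.card_univ, Fintype.card_fin] at h
  exact h.symm

theorem letterCount_append {a b n : ℕ} (f : Fin a → Fin n) (g : Fin b → Fin n) (l : Fin n) :
    letterCount (Fin.append f g) l = letterCount f l + letterCount g l := by
  simp only [letterCount, Finset.card_filter, Fin.sum_univ_add, Fin.append_left, Fin.append_right]

theorem letterCount_comp {m n n' : ℕ} (f : Fin m → Fin n) (g : Fin n → Fin n') (l : Fin n') :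
    letterCount (fun s => g (f s)) l = ∑ k, if g k = l then letterCount f k else 0 := by
  rw [← Finset.sum_filter]
  have h := Finset.card_eq_sum_card_fiberwise (s := Finset.univ.filter fun s => g (f s) = l)
    (t := Finset.univ.filter fun k => g k = l) (f := f) (by
      intro s hs
      simpa using hs)
  rw [letterCount, h]
  refine Finset.sum_congr rfl fun k hk => ?_
  rw [letterCount]
  congr 1
  ext s
  simp only [Finset.mem_filter, Finset.mem_univ, true_and] at hk ⊢
  constructor
  · exact fun h => h.2
  · exact fun h => ⟨by rw [h, hk], h⟩

end Words

/-- The trace of a projection in a matrix algebra is a natural number. -/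
theorem CStarMatrix.exists_tr_eq_natCast {r : ℕ} {P : CMat r ℂ} (hPP : P * P = P) (hP : star P = P) :
    ∃ m : ℕ, P.tr = m := by
  obtain ⟨m, A, h1, h2⟩ := Matrix.exists_isometry_of_projection
    (P := (show Matrix (Fin r) (Fin r) ℂ from P)) hPP hP
  refine ⟨m, ?_⟩
  change Matrix.trace (show Matrix (Fin r) (Fin r) ℂ from P) = m
  rw [← h1, Matrix.trace_mul_comm, h2, Matrix.trace_one, Fintype.card_fin]

namespace RSHDecomposition

variable {B : Type*} [CStarAlgebra B] {R : ℕ} {D : RSHDecomposition B R} {F : Finset B} {η : ℝ}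

open GenericPoint

section WordHom

variable {n : ℕ} (p : Fin n → D.GenericPoint)

/-- The diagonal sum of the evaluations at the points of a word. -/
noncomputable def wordHom {m : ℕ} [NeZero m] (f : Fin m → Fin n) : B →⋆ₐ[ℂ] UniversalUHF :=
  (diagHom m fun s => letterHom (fun k => D.r (p k).level) (f s)).comp (evalPi p)

theorem wordHom_eq {m : ℕ} [NeZero m] (f : Fin m → Fin n) : wordHom p f =
    diagHom m fun s => (letterHom (fun k => D.r (p k).level) (f s)).comp (evalPi p) := rfl

variable [NeZero n]

theorem homBridge_wordHom (hη : 0 < η) {m : ℕ} [NeZero m] (f g : Fin m → Fin n)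
    (h : ∀ l, letterCount f l = letterCount g l) :
    HomBridge D F η (wordHom p f) (wordHom p g) := by
  refine homBridge_of_isMatricial hη p (isMatricial_word f) ?_
  have h1 := isMatricial_word (d := fun k => D.r (p k).level) g
  have h2 : ∀ l, (Finset.univ.filter fun s => f s = l).card =
    (Finset.univ.filter fun s => g s = l).card := h
  simp only [h2]
  exact h1

variable (F η)

/-- Letter counts of words which are connected by a bridge. -/
def WordBridge (k k' : Fin n → ℕ) : Prop :=
  ∃ (m : ℕ) (_ : NeZero m) (f f' : Fin m → Fin n), (∀ l, letterCount f l = k l) ∧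
    (∀ l, letterCount f' l = k' l) ∧ HomBridge D F η (wordHom p f) (wordHom p f')

variable {F η} {p}

theorem WordBridge.symm {k k' : Fin n → ℕ} (h : WordBridge F η p k k') : WordBridge F η p k' k := by
  obtain ⟨m, hm, f, f', hf, hf', h⟩ := h
  exact ⟨m, hm, f', f, hf', hf, h.symm⟩

theorem WordBridge.refl (hη : 0 < η) (k : Fin n → ℕ) (hk : k ≠ 0) : WordBridge F η p k k := by
  have h0 : ∑ l, k l ≠ 0 := fun h => hk (funext fun l => by
    simpa using Finset.sum_eq_zero_iff.mp h l (Finset.mem_univ l))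
  obtain ⟨f, hf⟩ := exists_word k rfl
  exact ⟨_, ⟨h0⟩, f, f, hf, hf, @homBridge_wordHom B _ R D F η n p _ hη _ ⟨h0⟩ f f fun _ => rfl⟩

/-- The bridge may be used for any words with the given counts: the lengths agree automatically, and
reordering letters is itself a bridge. -/
theorem WordBridge.homBridge (hη : 0 < η) {k k' : Fin n → ℕ} (h : WordBridge F η p k k') {m : ℕ}
    [NeZero m] {f f' : Fin m → Fin n} (hf : ∀ l, letterCount f l = k l)
    (hf' : ∀ l, letterCount f' l = k' l) : HomBridge D F η (wordHom p f) (wordHom p f') := by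
  obtain ⟨m', hm', g, g', hg, hg', h⟩ := h
  have hmm : m = m' := by
    rw [← sum_letterCount f, ← sum_letterCount g]
    exact Finset.sum_congr rfl fun l _ => by rw [hf, hg]
  subst hmm
  refine (homBridge_wordHom p hη f g fun l => by rw [hf, hg]).trans
    (h.trans (homBridge_wordHom p hη g' f' fun l => by rw [hf', hg']))

/-- Repeating a word of length a exactly a times gives each of its letters the same weight 1 / (a +
b) as in the concatenation, and likewise for b. -/
theorem isMatricial_append {a b : ℕ} [NeZero a] [NeZero b] [NeZero (a + b)] {d : Fin n → ℕ}
    [∀ k, NeZero (d k)] (f : Fin a → Fin n) (g : Fin b → Fin n) :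
    IsMatricial (diagHom (a + b) (Fin.append
      (fun _ : Fin a => diagHom a fun s => letterHom d (f s))
      (fun _ : Fin b => diagHom b fun s => letterHom d (g s))))
      fun l => ((letterCount f l + letterCount g l : ℕ) : ℂ) / (a + b : ℕ) := by
  have h := IsMatricial.diagHom (m := a + b)
    (j := Fin.append (fun _ : Fin a => diagHom a fun s => letterHom d (f s))
      (fun _ : Fin b => diagHom b fun s => letterHom d (g s)))
    (t := Fin.append (fun _ l => (letterCount f l : ℂ) / a) (fun _ l => (letterCount g l : ℂ) / b))
    (fun s => by
      refine Fin.addCases (fun s => ?_) (fun s => ?_) s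
      · simp only [Fin.append_left]
        exact isMatricial_word f
      · simp only [Fin.append_right]
        exact isMatricial_word g)
  convert h using 3 with l
  have ha : (a : ℂ) ≠ 0 := Nat.cast_ne_zero.mpr (NeZero.ne a)
  have hb : (b : ℂ) ≠ 0 := Nat.cast_ne_zero.mpr (NeZero.ne b)
  rw [Fin.sum_univ_add]
  simp only [Fin.append_left, Fin.append_right, Finset.sum_const, Finset.card_univ,
    Fintype.card_fin, nsmul_eq_mul]
  push_cast
  field_simp

/-- The diagonal sum of two homomorphisms, with weights proportional to `a` and `b`. -/
theorem homBridge_append (hη : 0 < η) {a b : ℕ} [NeZero a] [NeZero b] [NeZero (a + b)]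
    (f : Fin a → Fin n) (g : Fin b → Fin n) :
    HomBridge D F η (diagHom (a + b) (Fin.append (fun _ : Fin a => wordHom p f)
      (fun _ : Fin b => wordHom p g))) (wordHom p (Fin.append f g)) := by
  have h1 : diagHom (a + b) (Fin.append (fun _ : Fin a => wordHom p f)
      (fun _ : Fin b => wordHom p g)) = (diagHom (a + b) (Fin.append
      (fun _ : Fin a => diagHom a fun s => letterHom (fun k => D.r (p k).level) (f s))
      (fun _ : Fin b => diagHom b fun s => letterHom (fun k => D.r (p k).level) (g s)))).comp
        (evalPi p) := by
    have h2 : ∀ s, Fin.append (fun _ : Fin a => wordHom p f) (fun _ : Fin b => wordHom p g) s =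
      (Fin.append
      (fun _ : Fin a => diagHom a fun s => letterHom (fun k => D.r (p k).level) (f s))
      (fun _ : Fin b => diagHom b fun s => letterHom (fun k => D.r (p k).level) (g s)) s).comp
        (evalPi p) := fun s => by
      refine Fin.addCases (fun s => ?_) (fun s => ?_) s
      · simp only [Fin.append_left]; rfl
      · simp only [Fin.append_right]; rfl
    rw [funext h2]
    rfl
  rw [h1]
  refine homBridge_of_isMatricial hη p (isMatricial_append f g) ?_
  have h3 := isMatricial_word (d := fun k => D.r (p k).level) (Fin.append f g)
  have h4 : ∀ l, (Finset.univ.filter fun s => Fin.append f g s = l).card =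
    letterCount f l + letterCount g l := letterCount_append f g
  simp only [h4] at h3
  exact h3

/-- Up to bridges, concatenation is a diagonal sum of copies of the two words, and bridges pass to
diagonal sums. -/
theorem WordBridge.add (hη : 0 < η) {k k' l l' : Fin n → ℕ} (h : WordBridge F η p k k')
    (h' : WordBridge F η p l l') : WordBridge F η p (k + l) (k' + l') := by
  obtain ⟨a, ha, f, f', hf, hf', h⟩ := h
  obtain ⟨b, hb, g, g', hg, hg', h'⟩ := h'
  have hab : NeZero (a + b) := ⟨by have := ha.out; omega⟩
  refine ⟨a + b, hab, Fin.append f g, Fin.append f' g', fun i => ?_, fun i => ?_, ?_⟩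
  · rw [letterCount_append, hf, hg]; rfl
  · rw [letterCount_append, hf', hg']; rfl
  · refine (homBridge_append hη f g).symm.trans (HomBridge.trans ?_ (homBridge_append hη f' g'))
    refine HomBridge.diagHom hη fun s => ?_
    refine Fin.addCases (fun s => ?_) (fun s => ?_) s
    · simp only [Fin.append_left]; exact h
    · simp only [Fin.append_right]; exact h'

end WordHom

/-- Points in the spaces `X l ∖ Ω l`, one for each `l`. -/
def basePoint {x : ∀ l, D.X l} (hx : ∀ l, x l ∉ D.Ω l) (l : Fin R) : D.GenericPoint :=
  ⟨⟨l, x l⟩, hx l⟩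

/-- The relation between the weights given by an arbitrary point. -/
theorem wordBridge_of_eval [NeZero R] (hη : 0 < η) (hconn : D.IsConnected F η) {x : ∀ l, D.X l}
    (hx : ∀ l, x l ∉ D.Ω l) {l : Fin R} (y : D.X l) {n : ℕ} [NeZero n]
    {q : Fin n → D.GenericPoint}
    {i : (∀ k, CMat (D.r (q k).level) ℂ) →⋆ₐ[ℂ] CMat (D.r l) ℂ}
    (hi : ∀ b, i (evalPi q b) = D.evalAt l y b) {c : Fin n → ℕ}
    (hc : ∀ k, (i (Pi.single k 1)).tr = c k) :
    WordBridge F η (basePoint hx) (fun m => if m = l then D.r l else 0)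
      (fun m => ∑ k, if (q k).level = m then c k else 0) := by
  have hcsum : ∑ k, c k = D.r l := by
    have h1 : (i 1).tr = ∑ k, (i (Pi.single k 1)).tr := by
      rw [← CStarMatrix.tr_sum, ← map_sum]
      exact congrArg (fun z => (i z).tr)
        (Finset.univ_sum_single (1 : ∀ k, CMat (D.r (q k).level) ℂ)).symm
    rw [map_one, CStarMatrix.tr_one] at h1
    simp only [hc] at h1
    exact_mod_cast h1.symm
  obtain ⟨g, hg⟩ := exists_word c hcsum
  -- The chain consists of r l letters l; one evaluation at x l; the evaluation at y; the word of
  -- points q with multiplicities c; and finally that word with every point moved to the base point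
  -- of its level.
  refine ⟨D.r l, inferInstance, fun _ => l, fun s => (q (g s)).level, fun m => ?_, fun m => ?_, ?_⟩
  · rw [letterCount]
    by_cases h : m = l
    · subst h; simp
    · simp [h, Ne.symm h]
  · rw [letterCount_comp g fun k => (q k).level]
    simp only [hg]
  · have h1 : HomBridge D F η (wordHom (basePoint hx) fun _ : Fin (D.r l) => l)
        ((letterHom (fun k => D.r (basePoint hx k).level) l).comp (evalPi (basePoint hx))) := by
      refine homBridge_of_isMatricial hη _ (isMatricial_word _) ?_
      have h2 := isMatricial_letterHom (d := fun k => D.r (basePoint hx k).level) l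
      have h3 : ∀ m : Fin R, (if m = l then (1 : ℂ) else 0) =
          ((Finset.univ.filter fun _ : Fin (D.r l) => l = m).card : ℂ) / D.r l := fun m => by
        by_cases h : m = l
        · subst h
          have : (D.r m : ℂ) ≠ 0 := Nat.cast_ne_zero.mpr (D.r_pos m).ne'
          simp [this]
        · simp [h, Ne.symm h]
      simp only [h3] at h2
      exact h2
    have h4 : HomBridge D F η
        ((letterHom (fun k => D.r (basePoint hx k).level) l).comp (evalPi (basePoint hx)))
        (((UniversalUHF.ofMat (D.r l)).comp i).comp (evalPi q)) := by
      have h5 : ((UniversalUHF.ofMat (D.r l)).comp i).comp (evalPi q) =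
          (UniversalUHF.ofMat (D.r l)).comp (D.evalAt l y) :=
        StarAlgHom.ext fun b => congrArg (UniversalUHF.ofMat (D.r l)) (hi b)
      rw [h5]
      exact homBridge_evalAt hη hconn l (x l) y (UniversalUHF.ofMat (D.r l))
        (UniversalUHF.ofMat (D.r l))
    have h6 : HomBridge D F η (((UniversalUHF.ofMat (D.r l)).comp i).comp (evalPi q))
        (wordHom q g) := by
      refine homBridge_of_isMatricial (t := fun k => (c k : ℂ) / D.r l) hη _
        ⟨D.r l, inferInstance, i, rfl, fun k => ?_⟩ ?_
      · rw [hc, div_mul_cancel₀]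
        exact Nat.cast_ne_zero.mpr (D.r_pos l).ne'
      · have h7 := isMatricial_word (d := fun k => D.r (q k).level) g
        have h8 : ∀ k, (Finset.univ.filter fun s => g s = k).card = c k := hg
        simp only [h8] at h7
        exact h7
    have h9 : HomBridge D F η (wordHom q g) (wordHom (basePoint hx) fun s => (q (g s)).level) := by
      rw [wordHom_eq, wordHom_eq]
      refine HomBridge.diagHom hη fun s => ?_
      exact homBridge_evalAt hη hconn (q (g s)).level (q (g s)).1.2 (x (q (g s)).level)
        (UniversalUHF.ofMat (D.r (q (g s)).level)) (UniversalUHF.ofMat (D.r (q (g s)).level))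
    exact h1.trans (h4.trans (h6.trans h9))

end RSHDecomposition

/-! ### Projections with prescribed traces -/

section MatrixTrace

variable {r : ℕ}

/-- Tracial functionals on matrix algebras are multiples of the trace. -/
theorem CStarMatrix.tracial_eq (T : CMat r ℂ →ₗ[ℂ] ℂ) (hT : ∀ a b, T (a * b) = T (b * a))
    (a : CMat r ℂ) : T a * r = T 1 * a.tr := by
  have h1 : ∀ i j, T (matUnit r i i) = T (matUnit r j j) := fun i j => by
    have h2 := hT (matUnit r i j) (matUnit r j i)
    rwa [matUnit_mul_matUnit, matUnit_mul_matUnit, if_pos rfl, if_pos rfl] at h2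
  have h3 : ∀ i j, i ≠ j → T (matUnit r i j) = 0 := fun i j hij => by
    have h2 := hT (matUnit r i j) (matUnit r j j)
    rwa [matUnit_mul_matUnit, matUnit_mul_matUnit, if_pos rfl, if_neg hij.symm, map_zero] at h2
  rcases Nat.eq_zero_or_pos r with rfl | hr
  · simp [CStarMatrix.tr]
  · have h4 : ∀ i, T (matUnit r i i) = T (matUnit r ⟨0, hr⟩ ⟨0, hr⟩) := fun i => h1 i _
    have h5 : T 1 = r * T (matUnit r ⟨0, hr⟩ ⟨0, hr⟩) := by
      rw [← sum_matUnit, map_sum]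
      simp only [h4, Finset.sum_const, Finset.card_univ, Fintype.card_fin, nsmul_eq_mul]
    have h6 : T a = a.tr * T (matUnit r ⟨0, hr⟩ ⟨0, hr⟩) := by
      conv_lhs => rw [sum_matUnit_eq a]
      rw [map_sum, CStarMatrix.tr, Finset.sum_mul]
      refine Finset.sum_congr rfl fun i _ => ?_
      rw [map_sum, Finset.sum_eq_single i]
      · rw [map_smul, h4, smul_eq_mul]
      · intro j _ hj
        rw [map_smul, h3 i j hj.symm, smul_zero]
      · simp
    rw [h5, h6]
    ring

theorem CStarMatrix.tr_add (a b : CMat r ℂ) : (a + b).tr = a.tr + b.tr := by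
  simp [CStarMatrix.tr, Finset.sum_add_distrib]

theorem CStarMatrix.tr_smul (c : ℂ) (a : CMat r ℂ) : (c • a).tr = c * a.tr := by
  simp [CStarMatrix.tr, Finset.mul_sum]

/-- On each summand the pulled back trace is tracial, hence a multiple of the trace, and its value
at the unit fixes the multiple. -/
theorem StarAlgHom.tr_apply {n N : ℕ} {d : Fin n → ℕ} (hd : ∀ k, 0 < d k)
    (i : (∀ k, CMat (d k) ℂ) →⋆ₐ[ℂ] CMat N ℂ) (a : ∀ k, CMat (d k) ℂ) :
    (i a).tr = ∑ k, (i (Pi.single k 1)).tr * ((a k).tr / d k) := by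
  have h1 : (i a).tr = ∑ k, (i (Pi.single k (a k))).tr := by
    rw [← CStarMatrix.tr_sum, ← map_sum]
    exact congrArg (fun z => (i z).tr) (Finset.univ_sum_single a).symm
  rw [h1]
  refine Finset.sum_congr rfl fun k _ => ?_
  let T : CMat (d k) ℂ →ₗ[ℂ] ℂ :=
    { toFun := fun a => (i (Pi.single k a)).tr
      map_add' := fun a b => by
        rw [← CStarMatrix.tr_add, ← map_add]
        exact congrArg (fun z => (i z).tr) (Pi.single_add (f := fun k => CMat (d k) ℂ) k a b)
      map_smul' := fun c a => by
        rw [RingHom.id_apply, smul_eq_mul, ← CStarMatrix.tr_smul, ← map_smul]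
        exact congrArg (fun z => (i z).tr)
          (Pi.single_smul (f := fun k => CMat (d k) ℂ) k c a) }
  have h2 := CStarMatrix.tracial_eq T (fun a b => by
    change (i (Pi.single k (a * b))).tr = (i (Pi.single k (b * a))).tr
    rw [← pi_single_mul_eq, ← pi_single_mul_eq, map_mul, map_mul, CStarMatrix.tr_mul_comm]) (a k)
  have h3 : (d k : ℂ) ≠ 0 := Nat.cast_ne_zero.mpr (hd k).ne'
  rw [← mul_div_assoc, eq_div_iff h3]
  exact h2

theorem StarAlgHom.exists_tr_single {n N : ℕ} {d : Fin n → ℕ}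
    (i : (∀ k, CMat (d k) ℂ) →⋆ₐ[ℂ] CMat N ℂ) :
    ∃ c : Fin n → ℕ, ∀ k, (i (Pi.single k 1)).tr = c k := by
  have hc : ∀ k, ∃ c : ℕ, (i (Pi.single k 1)).tr = c := fun k => by
    refine CStarMatrix.exists_tr_eq_natCast ?_ ?_
    · rw [← map_mul, pi_single_mul_eq, one_mul]
    · rw [← map_star, star_pi_single, star_one]
  choose c hc using hc
  exact ⟨c, hc⟩

end MatrixTrace

/-! ### Continuous fields of projections -/

section ProjectionFields

variable {X : Type*} [TopologicalSpace X] {r N : ℕ}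

/-- The trace of a projection in `M_N(M_r)` is a natural number. -/
theorem exists_sum_tr_eq_natCast {Q : Fin N → Fin N → CMat r ℂ}
    (hQQ : ∀ i j, ∑ k, Q i k * Q k j = Q i j) (hQ : ∀ i j, star (Q j i) = Q i j) :
    ∃ m : ℕ, ∑ i, (Q i i).tr = m := by
  let M : Matrix (Fin N × Fin r) (Fin N × Fin r) ℂ := fun a b => Q a.1 b.1 a.2 b.2
  obtain ⟨m, A, h1, h2⟩ := Matrix.exists_isometry_of_projection (P := M) (by
    ext ⟨i, a⟩ ⟨j, b⟩
    rw [Matrix.mul_apply, Fintype.sum_prod_type]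
    change ∑ k, ∑ c, Q i k a c * Q k j c b = Q i j a b
    rw [← hQQ i j, CStarMatrix.finset_sum_apply]
    rfl) (by
    ext ⟨i, a⟩ ⟨j, b⟩
    change star (Q j i b a) = Q i j a b
    rw [← hQ i j]
    rfl)
  refine ⟨m, ?_⟩
  have h3 : ∑ i, (Q i i).tr = M.trace := by
    rw [Matrix.trace, Fintype.sum_prod_type]
    rfl
  rw [h3, ← h1, Matrix.trace_mul_comm, h2, Matrix.trace_one, Fintype.card_fin]

/-- A continuous field of projections whose trace is constant on a subset can be changed outside of
this subset so that the trace is constant. -/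
theorem exists_projection_field {Ω : Set X} {d : ℕ} (hd : d ≤ N)
    (Q : Fin N → Fin N → C(X, CMat r ℂ))
    (hQQ : ∀ i j x, ∑ k, Q i k x * Q k j x = Q i j x) (hQ : ∀ i j x, star (Q j i x) = Q i j x)
    (hΩ : ∀ x ∈ Ω, ∑ i, (Q i i x).tr = d * r) :
    ∃ Q' : Fin N → Fin N → C(X, CMat r ℂ),
      (∀ i j x, ∑ k, Q' i k x * Q' k j x = Q' i j x) ∧ (∀ i j x, star (Q' j i x) = Q' i j x) ∧
      (∀ x, ∑ i, (Q' i i x).tr = d * r) ∧ ∀ i j, ∀ x ∈ Ω, Q' i j x = Q i j x := by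
  classical
  have hcont : Continuous fun x => ∑ i, (Q i i x).tr := by
    refine continuous_finsetSum _ fun i _ => continuous_finsetSum _ fun a _ => ?_
    exact (continuous_apply a).comp ((continuous_apply a).comp (Q i i).continuous)
  let C : Set X := {x | ∑ i, (Q i i x).tr = d * r}
  -- The trace is continuous and takes values in the natural numbers, so its level sets are clopen.
  have hC : IsClopen C := by
    refine ⟨isClosed_eq hcont continuous_const, ?_⟩
    have h1 : C = (fun x => ∑ i, (Q i i x).tr) ⁻¹' Metric.ball ((d * r : ℕ) : ℂ) 1 := by
      ext x
      obtain ⟨m, hm⟩ := exists_sum_tr_eq_natCast (hQQ := fun i j => hQQ i j x)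
        (hQ := fun i j => hQ i j x)
      change ∑ i, (Q i i x).tr = d * r ↔ dist (∑ i, (Q i i x).tr) ((d * r : ℕ) : ℂ) < 1
      rw [hm, dist_eq_norm]
      constructor
      · intro h; rw [h]; simp
      · intro h
        have h2 : ‖(((m : ℤ) - ((d * r : ℕ) : ℤ) : ℤ) : ℂ)‖ < 1 := by
          rw [Int.cast_sub]
          exact h
        rw [Complex.norm_intCast] at h2
        have h3 : |(m : ℤ) - ((d * r : ℕ) : ℤ)| < 1 := by exact_mod_cast h2
        have h4 := Int.abs_lt_one_iff.mp h3
        have h5 : m = d * r := by omega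
        rw [h5]; push_cast; rfl
    rw [h1]
    exact Metric.isOpen_ball.preimage hcont
  -- A constant projection of trace d r, which exists in M_N(M_r) because d ≤ N. It replaces Q away
  -- from the clopen set.
  let K : Fin N → Fin N → CMat r ℂ := fun i j => if i = j ∧ (i : ℕ) < d then 1 else 0
  let Q' : Fin N → Fin N → C(X, CMat r ℂ) := fun i j =>
    ⟨fun x => if x ∈ C then Q i j x else K i j, continuous_if
      (fun x hx => by
        have h : frontier {x | x ∈ C} = ∅ := hC.frontier_eq
        rw [h] at hx
        exact absurd hx (Set.notMem_empty x)) (Q i j).continuous.continuousOn continuousOn_const⟩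
  have h1 : ∀ i j, ∀ x ∈ C, Q' i j x = Q i j x := fun i j x hx => if_pos hx
  have h2 : ∀ i j, ∀ x ∉ C, Q' i j x = K i j := fun i j x hx => if_neg hx
  refine ⟨Q', fun i j x => ?_, fun i j x => ?_, fun x => ?_, fun i j x hx => h1 i j x (hΩ x hx)⟩
  · by_cases hx : x ∈ C
    · simp only [h1 _ _ x hx, hQQ]
    · simp only [h2 _ _ x hx, K]
      rw [Finset.sum_eq_single i]
      · by_cases hi : (i : ℕ) < d
        · simp [hi]
        · simp [hi]
      · intro k _ hk; simp [Ne.symm hk]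
      · simp
  · by_cases hx : x ∈ C
    · simp only [h1 _ _ x hx, hQ]
    · simp only [h2 _ _ x hx, K]
      by_cases hij : i = j
      · subst hij; split_ifs <;> simp
      · simp [hij, Ne.symm hij]
  · by_cases hx : x ∈ C
    · simp only [h1 _ _ x hx]; exact hx
    · simp only [h2 _ _ x hx, K]
      have h3 : ∀ i : Fin N, (if True ∧ (i : ℕ) < d then (1 : CMat r ℂ) else 0).tr =
          if (i : ℕ) < d then (r : ℂ) else 0 := fun i => by
        by_cases hi : (i : ℕ) < d
        · simp [hi, CStarMatrix.tr_one]
        · simp [hi, CStarMatrix.tr]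
      simp only [h3]
      rw [← Finset.sum_filter, Finset.sum_const, nsmul_eq_mul, Fin.card_filter_val_lt,
        min_eq_right hd]

end ProjectionFields

/-! ### Projections over the stages with traces dual to the relations -/

namespace RSHDecomposition

variable {B : Type*} [CStarAlgebra B] {R : ℕ} {D : RSHDecomposition B R} {F : Finset B} {η : ℝ}

open GenericPoint

/-- If the traces of `b` at the points of lower levels are prescribed by `d`, then this is so on the
sets along which one glues. -/
theorem tr_evalAt_eq [NeZero R] (hη : 0 < η) (hconn : D.IsConnected F η) {x : ∀ l, D.X l}
    (hx : ∀ l, x l ∉ D.Ω l) {d : Fin R → ℕ}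
    (hd : ∀ k k', WordBridge F η (basePoint hx) k k' → ∑ l, k l * d l = ∑ l, k' l * d l)
    {l : Fin R} {b : B} (hb : ∀ m, m < l → ∀ y : D.X m, (D.evalAt m y b).tr = d m * D.r m)
    {y : D.X l} (hy : y ∈ D.Ω l) : (D.evalAt l y b).tr = d l * D.r l := by
  obtain ⟨n, hn, q, i, -, -, hi, hq⟩ := D.exists_eval_factor l y
  obtain ⟨c, hc⟩ := i.exists_tr_single
  -- The relation attached to y says d l · r l = ∑ c k · d (level of q k), and the right side
  -- computes the trace at y from the traces at the lower points q k.
  have h1 := hd _ _ (wordBridge_of_eval hη hconn hx y hi hc)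
  rw [← hi, StarAlgHom.tr_apply fun k => D.r_pos _]
  have h2 : ∀ k, (evalPi q b k).tr / D.r (q k).level = d (q k).level := fun k => by
    rw [div_eq_iff (Nat.cast_ne_zero.mpr (D.r_pos _).ne')]
    exact hb _ (hq hy k) (q k).1.2
  simp only [h2, hc]
  have h3 : ∑ k, c k * d (q k).level = d l * D.r l := by
    simp only [ite_mul, zero_mul, Finset.sum_ite_eq', Finset.mem_univ, if_true] at h1
    rw [mul_comm, h1]
    simp only [Finset.sum_mul, ite_mul, zero_mul]
    rw [Finset.sum_comm]
    simp
  exact_mod_cast h3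

/-- Induction over the stages. A lift of the projection found so far automatically has the right
trace over Ω l, by `tr_evalAt_eq`. It is changed only where its trace is wrong, which is away from Ω
l, so gluing with the old projection remains possible. -/
theorem exists_projection_stage [NeZero R] (hη : 0 < η) (hconn : D.IsConnected F η)
    (hlift : D.ProjectionsLift) {x : ∀ l, D.X l}
    (hx : ∀ l, x l ∉ D.Ω l) {d : Fin R → ℕ} {N : ℕ} (hdN : ∀ l, d l ≤ N)
    (hd : ∀ k k', WordBridge F η (basePoint hx) k k' → ∑ l, k l * d l = ∑ l, k' l * d l)
    (j : Fin (R + 1)) :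
    ∃ P : CStarMatrix (Fin N) (Fin N) (D.stage j), IsStarProjection P ∧
      ∀ b : B, D.ψ j b = ∑ i, P i i → ∀ l, l.castSucc < j → ∀ y : D.X l,
        (D.evalAt l y b).tr = d l * D.r l := by
  induction j using Fin.induction with
  | zero => exact ⟨0, .zero _, fun b _ l hl => absurd hl (Fin.not_lt_zero _)⟩
  | succ l ih =>
    obtain ⟨P, hP, hPd⟩ := ih
    obtain ⟨Q, hQ, rfl⟩ := hlift l N P hP
    have hpb := D.isPullback l
    have hψ : ∀ b, D.ψ l.castSucc b = D.down l (D.ψ l.succ b) := fun b => by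
      rw [ψ_castSucc]; rfl
    have hQQ : ∀ i j, ∑ k, Q i k * Q k j = Q i j := fun i j => by
      have h := congrArg (fun M : CStarMatrix (Fin N) (Fin N) (D.stage l.succ) => M i j)
        hQ.isIdempotentElem.eq
      simpa only [CStarMatrix.mul_apply] using h
    have hQs : ∀ i j, star (Q j i) = Q i j := fun i j => by
      have h := congrArg (fun M : CStarMatrix (Fin N) (Fin N) (D.stage l.succ) => M i j)
        hQ.isSelfAdjoint.star_eq
      simpa only [CStarMatrix.star_apply] using h
    obtain ⟨Q', h1, h2, h3, h4⟩ := exists_projection_field (Ω := D.Ω l) (hdN l)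
      (fun i j => D.coord l (Q i j)) (fun i j x => by
        rw [← hQQ i j, IsPullback.coord_sum]
        simp only [IsPullback.coord_mul]) (fun i j x => by
        rw [← hQs i j, IsPullback.coord_star]) (fun y hy => by
        obtain ⟨b, hb⟩ := D.ψ_surjective l.succ (∑ i, Q i i)
        rw [← CStarMatrix.tr_sum, ← IsPullback.coord_sum, ← hb]
        refine tr_evalAt_eq hη hconn hx hd (fun m hm z => ?_) hy
        refine hPd b ?_ m (by simpa using hm) z
        rw [hψ, hb, map_sum]
        rfl)
    have h5 : ∀ i j, ∃ b, D.down l b = D.down l (Q i j) ∧ D.coord l b = Q' i j := fun i j => by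
      refine (D.pullback l (D.down l (Q i j)) (Q' i j) ?_).exists
      rw [D.comm]
      ext1 y
      exact (h4 i j y y.2).symm
    choose q hq hq' using h5
    refine ⟨CStarMatrix.ofMatrix q, ⟨?_, ?_⟩, fun b hb m hm y => ?_⟩
    · ext i j
      rw [CStarMatrix.mul_apply]
      change ∑ k, q i k * q k j = q i j
      refine hpb.inj _ _ ?_ fun y => ?_
      · rw [hq, ← hQQ i j, map_sum, map_sum]
        simp only [map_mul, hq]
      · rw [IsPullback.coord_sum]
        simp only [IsPullback.coord_mul, hq', h1]
    · ext i j
      change star (q j i) = q i j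
      refine hpb.inj _ _ ?_ fun y => ?_
      · rw [map_star, hq, hq, ← map_star, hQs]
      · rw [IsPullback.coord_star, hq', hq', h2]
    · have hb' : D.ψ l.succ b = ∑ i, q i i := hb
      have hm' : m ≤ l := by simpa [Fin.castSucc_lt_succ_iff] using hm
      rcases hm'.eq_or_lt with rfl | hlt
      · have h6 : D.evalAt m y b = D.coord m (D.ψ m.succ b) y := rfl
        rw [h6, hb', IsPullback.coord_sum, CStarMatrix.tr_sum]
        simp only [hq', h3]
      · refine hPd b ?_ m (by simpa using hlt) y
        rw [hψ, hb', map_sum]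
        exact Finset.sum_congr rfl fun i _ => hq i i

/-- Projections with prescribed traces. -/
theorem exists_projection [NeZero R] (hη : 0 < η) (hconn : D.IsConnected F η)
    (hlift : D.ProjectionsLift) {x : ∀ l, D.X l}
    (hx : ∀ l, x l ∉ D.Ω l) {d : Fin R → ℕ} {N : ℕ} (hdN : ∀ l, d l ≤ N)
    (hd : ∀ k k', WordBridge F η (basePoint hx) k k' → ∑ l, k l * d l = ∑ l, k' l * d l) :
    ∃ P : MatProj B, ∀ l (y : D.X l), (D.evalAt l y P.mat.trace).tr = d l * D.r l := by
  obtain ⟨P, hP, h⟩ := exists_projection_stage hη hconn hlift hx hdN hd (Fin.last R)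
  have hPP : ∀ i j, ∑ k, P i k * P k j = P i j := fun i j => by
    have h := congrArg (fun M : CStarMatrix (Fin N) (Fin N) (D.stage (Fin.last R)) => M i j)
      hP.isIdempotentElem.eq
    simpa only [CStarMatrix.mul_apply] using h
  have hPs : ∀ i j, star (P j i) = P i j := fun i j => by
    have h := congrArg (fun M : CStarMatrix (Fin N) (Fin N) (D.stage (Fin.last R)) => M i j)
      hP.isSelfAdjoint.star_eq
    simpa only [CStarMatrix.star_apply] using h
  refine ⟨⟨N, Matrix.of fun i j => D.equiv.symm (P i j), ?_, ?_⟩, fun l y => ?_⟩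
  · ext i j
    rw [Matrix.mul_apply]
    simp only [Matrix.of_apply, ← map_mul, ← map_sum, hPP]
  · ext i j
    change star (D.equiv.symm (P j i)) = D.equiv.symm (P i j)
    rw [← map_star, hPs]
  · refine h _ ?_ l (Fin.castSucc_lt_last l) y
    rw [ψ_last]
    change D.equiv (∑ i, D.equiv.symm (P i i)) = _
    rw [map_sum]
    simp

end RSHDecomposition

/-! ### The weights of a tracial state -/

/-- Positive tracial functionals. -/
structure IsPosTrace {S : Type*} [CStarAlgebra S] (t : S →ₗ[ℂ] ℂ) : Prop where
  nonneg : ∀ a, 0 ≤ t (star a * a)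
  comm : ∀ a b, t (a * b) = t (b * a)

namespace IsPosTrace

variable {S : Type*} [CStarAlgebra S] {t : S →ₗ[ℂ] ℂ} (ht : IsPosTrace t)

include ht

/-- As v is central and self-adjoint, v² c* c = (c v)* (c v). -/
theorem mul_self_mul_nonneg {v : S} (hv : star v = v) (hv' : ∀ a, v * a = a * v) (c : S) :
    0 ≤ t (v * v * (star c * c)) := by
  have h : v * v * (star c * c) = star (c * v) * (c * v) := by
    rw [star_mul, hv, ← hv' c]
    have h1 : v * star c * (v * c) = v * (star c * v) * c := by simp only [mul_assoc]
    rw [h1, ← hv' (star c)]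
    simp only [mul_assoc]
  rw [h]
  exact ht.nonneg _

protected theorem continuous : Continuous t := by
  let _ := CStarAlgebra.spectralOrder S
  have := CStarAlgebra.spectralOrderedRing S
  let p : S →ₚ[ℂ] ℂ := PositiveLinearMap.mk₀ t fun a ha => by
    obtain ⟨b, rfl⟩ := exists_eq_star_mul_self ha
    exact ht.nonneg b
  exact map_continuous p

end IsPosTrace

theorem exists_tendsto_of_monotone {z : ℕ → ℂ} {C : ℂ} (h0 : ∀ n, z n ≤ z (n + 1))
    (hC : ∀ n, z n ≤ C) : ∃ w, Tendsto z atTop (𝓝 w) := by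
  have h1 : Monotone z := monotone_nat_of_le_succ h0
  have h2 : Monotone fun n => (z n).re := fun m n hmn => (Complex.le_def.mp (h1 hmn)).1
  have h3 : BddAbove (Set.range fun n => (z n).re) :=
    ⟨C.re, by rintro _ ⟨n, rfl⟩; exact (Complex.le_def.mp (hC n)).1⟩
  have h4 := tendsto_atTop_ciSup h2 h3
  refine ⟨((⨆ n, (z n).re : ℝ) : ℂ) + C.im * Complex.I, ?_⟩
  refine (((Complex.continuous_ofReal.tendsto _).comp h4).add_const (C.im * Complex.I)).congr
    fun n => ?_
  rw [← (Complex.le_def.mp (hC n)).2]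
  exact Complex.re_add_im _

/-! ### Splitting a positive trace on a pullback -/

namespace IsPullback

variable {X : Type*} [TopologicalSpace X] [CompactSpace X] {r : ℕ} {S T : Type*} [CStarAlgebra S]
  [CStarAlgebra T] {Ω : Set X} {down : S →⋆ₐ[ℂ] T} {coord : S →⋆ₐ[ℂ] C(X, CMat r ℂ)}

theorem coord_one (x : X) : coord 1 x = 1 := by
  exact congrArg (fun f : C(X, CMat r ℂ) => f x) coord.map_one'

variable (h : IsPullback Ω down coord)

include h

theorem exists_central (g : C(X, ℝ)) (hg : ∀ x ∈ Ω, g x = 0) :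
    ∃ v, down v = 0 ∧ ∀ x, coord v x = (g x : ℂ) • 1 := by
  obtain ⟨v, hv, hv'⟩ := h.lift_tensorFun
    (⟨fun x => (g x : ℂ), Complex.continuous_ofReal.comp g.continuous⟩ : C(X, ℂ))
    (fun x hx => by simp [hg x hx]) 1
  exact ⟨v, hv, hv'⟩

theorem central_comm {v : S} (hv : down v = 0) {g : X → ℂ} (hg : ∀ x, coord v x = g x • 1)
    (a : S) : v * a = a * v := by
  refine h.inj _ _ ?_ fun x => ?_
  · rw [map_mul, map_mul, hv, zero_mul, mul_zero]
  · rw [coord_mul, coord_mul, hg, smul_mul_assoc, mul_smul_comm, one_mul, mul_one]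

theorem central_star {v : S} (hv : down v = 0) {g : X → ℝ} (hg : ∀ x, coord v x = (g x : ℂ) • 1) :
    star v = v := by
  refine h.inj _ _ ?_ fun x => ?_
  · rw [map_star, hv, star_zero]
  · rw [coord_star, hg, star_smul, star_one]
    congr 1
    exact Complex.conj_ofReal _

variable {t : S →ₗ[ℂ] ℂ} (ht : IsPosTrace t)

include ht

theorem nonneg_of_central {s : S} (hs : down s = 0) (g : C(X, ℝ)) (hg : ∀ x ∈ Ω, g x = 0)
    (hg0 : ∀ x, 0 ≤ g x) (hgs : ∀ x, coord s x = (g x : ℂ) • 1) (c : S) :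
    0 ≤ t (s * (star c * c)) := by
  obtain ⟨v, hv, hv'⟩ := h.exists_central ⟨fun x => Real.sqrt (g x), g.continuous.sqrt⟩
    fun x hx => by simp [hg x hx]
  have h1 : s = v * v := by
    refine h.inj _ _ ?_ fun x => ?_
    · rw [map_mul, hv, hs, zero_mul]
    · rw [coord_mul, hv', hgs, smul_mul_smul_comm, one_mul, ← Complex.ofReal_mul]
      congr 2
      exact (Real.mul_self_sqrt (hg0 x)).symm
  rw [h1]
  exact ht.mul_self_mul_nonneg (h.central_star hv hv') (h.central_comm hv hv') c

theorem nonneg_of_one_sub_central {s : S} (hs : down s = 0) (g : C(X, ℝ)) (hg : ∀ x ∈ Ω, g x = 0)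
    (hg1 : ∀ x, g x ≤ 1) (hgs : ∀ x, coord s x = (g x : ℂ) • 1) (c : S) :
    0 ≤ t ((1 - s) * (star c * c)) := by
  -- The square root of 1 - s is written as 1 - v with v = 1 - √(1 - g), since it is v which
  -- vanishes on Ω and therefore lifts to the ideal.
  obtain ⟨v, hv, hv'⟩ := h.exists_central
    ⟨fun x => 1 - Real.sqrt (1 - g x), by fun_prop⟩
    fun x hx => by simp [hg x hx]
  have h1 : 1 - s = (1 - v) * (1 - v) := by
    refine h.inj _ _ ?_ fun x => ?_
    · rw [map_mul, map_sub, map_sub, hv, hs, sub_zero, map_one, one_mul]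
    · rw [coord_mul, coord_sub, coord_sub, hv', hgs, coord_one]
      have h2 : (1 : CMat r ℂ) - ((1 - Real.sqrt (1 - g x) : ℝ) : ℂ) • 1 =
          ((Real.sqrt (1 - g x) : ℝ) : ℂ) • 1 := by
        rw [Complex.ofReal_sub, sub_smul, Complex.ofReal_one, one_smul, sub_sub_cancel]
      refine Eq.trans ?_ (congrArg₂ (· * ·) h2.symm h2.symm)
      rw [smul_mul_smul_comm, one_mul, ← Complex.ofReal_mul,
        Real.mul_self_sqrt (sub_nonneg.mpr (hg1 x)), Complex.ofReal_sub, sub_smul,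
        Complex.ofReal_one, one_smul]
  rw [h1]
  refine ht.mul_self_mul_nonneg ?_ (fun a => ?_) c
  · rw [star_sub, star_one, h.central_star hv hv']
  · rw [sub_mul, mul_sub, h.central_comm hv hv' a, one_mul, mul_one]

/-- Positive traces only see the traces of matrix valued functions vanishing on `Ω`. -/
theorem trace_eq_of_tr_eq {s : S} (hs : down s = 0) (g : C(X, ℝ)) (hg : ∀ x ∈ Ω, g x = 0)
    (hg0 : ∀ x, 0 ≤ g x) (hgs : ∀ x, coord s x = (g x : ℂ) • 1) {b b' : S}
    (hb : ∀ x, (coord b x).tr = (coord b' x).tr) : t (s * b) = t (s * b') := by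
  rcases Nat.eq_zero_or_pos r with rfl | hr
  · have h1 : ∀ c, s * c = 0 := fun c => h.eq_zero (by rw [map_mul, hs, zero_mul]) fun x => by
      ext i; exact i.elim0
    rw [h1, h1]
  let o : Fin r := ⟨0, hr⟩
  let g' : C(X, ℂ) := ⟨fun x => (Real.sqrt (g x) : ℂ),
    Complex.continuous_ofReal.comp g.continuous.sqrt⟩
  have hg' : ∀ x ∈ Ω, g' x = 0 := fun x hx => by
    change (Real.sqrt (g x) : ℂ) = 0
    rw [hg x hx]; simp
  have hgg : ∀ x, g' x * g' x = g x := fun x => by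
    change (Real.sqrt (g x) : ℂ) * (Real.sqrt (g x) : ℂ) = g x
    rw [← Complex.ofReal_mul, Real.mul_self_sqrt (hg0 x)]
  -- With e i = √g ⊗ e_{i o} and f i = √g ⊗ e_{o i} one has s = ∑ e i f i. The trace property turns
  -- t (s c) into t (∑ f i c e i), whose argument is g · tr(c) ⊗ e_{o o} and sees c only through its
  -- pointwise trace.
  choose e he he' using fun i => h.lift_tensorFun g' hg' (matUnit r i o)
  choose f hf hf' using fun i => h.lift_tensorFun g' hg' (matUnit r o i)
  have h1 : s = ∑ i, e i * f i := by
    refine h.inj _ _ ?_ fun x => ?_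
    · rw [map_sum, hs]
      exact (Finset.sum_eq_zero fun i _ => by rw [map_mul, he, zero_mul]).symm
    · rw [coord_sum]
      simp only [coord_mul, he', hf', smul_mul_smul_comm, hgg, matUnit_mul_matUnit, if_true]
      rw [← Finset.smul_sum, sum_matUnit, hgs]
  have h2 : ∀ c, t (s * c) = t (∑ i, f i * c * e i) := fun c => by
    rw [h1, Finset.sum_mul, map_sum, map_sum]
    exact Finset.sum_congr rfl fun i _ => by rw [mul_assoc, ht.comm]
  have h3 : ∀ c x, coord (∑ i, f i * c * e i) x = (g x : ℂ) • (coord c x).tr • matUnit r o o := by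
    intro c x
    rw [coord_sum]
    have h4 : ∀ i, coord (f i * c * e i) x = (g x : ℂ) • (coord c x i i) • matUnit r o o := by
      intro i
      rw [coord_mul, coord_mul, he', hf', smul_mul_assoc, smul_mul_smul_comm, hgg]
      congr 1
      ext p q
      rw [mul_assoc, matUnit_mul, CStarMatrix.mul_apply, CStarMatrix.smul_apply, matUnit_apply,
        Finset.sum_eq_single i]
      · simp only [matUnit_apply]
        by_cases hp : p = o <;> by_cases hq : q = o <;> simp [hp, hq]
      · intro k _ hk; simp [matUnit_apply, hk]
      · simp
    simp only [h4]
    rw [← Finset.smul_sum, ← Finset.sum_smul]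
    rfl
  rw [h2, h2]
  congr 1
  refine h.inj _ _ ?_ fun x => ?_
  · rw [map_sum, map_sum]
    exact Finset.sum_congr rfl fun i _ => by rw [map_mul, map_mul, map_mul, map_mul, he, mul_zero,
      mul_zero]
  · rw [h3, h3, hb]


omit ht in
-- Dini's theorem: ‖b(x)‖ (1 - k(x)^{1/(n+1)}) decreases to 0 pointwise on a compact space, also on
-- Ω because b vanishes there.
theorem tendsto_mul_of_down_eq_zero {u : ℕ → S} (hu : ∀ n, down (u n) = 0) {k : C(X, ℝ)}
    (hk : ∀ x, 0 ≤ k x ∧ k x ≤ 1 ∧ (k x = 0 ↔ x ∈ Ω))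
    (hu' : ∀ n x, coord (u n) x = (((k x) ^ ((1 : ℝ) / (n + 1)) : ℝ) : ℂ) • 1) {b : S}
    (hb : down b = 0) : Tendsto (fun n => u n * b) atTop (𝓝 b) := by
  have hpos : ∀ n : ℕ, (0 : ℝ) < 1 / (n + 1) := fun n => by positivity
  let f : ℕ → C(X, ℝ) := fun n =>
    ⟨fun x => ‖coord b x‖ * (1 - (k x) ^ ((1 : ℝ) / (n + 1))),
      (coord b).continuous.norm.mul (continuous_const.sub
        (k.continuous.rpow_const fun x => Or.inr (hpos n).le))⟩
  have hf0 : ∀ n x, 0 ≤ f n x := fun n x => mul_nonneg (norm_nonneg _)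
    (sub_nonneg.mpr (Real.rpow_le_one (hk x).1 (hk x).2.1 (hpos n).le))
  have h1 : Antitone f := antitone_nat_of_succ_le fun n x => by
    refine mul_le_mul_of_nonneg_left ?_ (norm_nonneg _)
    refine sub_le_sub_left ?_ _
    rcases (hk x).1.eq_or_lt with h0 | h0
    · rw [← h0, Real.zero_rpow (hpos _).ne', Real.zero_rpow (hpos _).ne']
    · refine Real.rpow_le_rpow_of_exponent_ge h0 (hk x).2.1 ?_
      exact one_div_le_one_div_of_le (by positivity) (by push_cast; linarith)
  have h2 : Tendsto f atTop (𝓝 0) := by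
    refine ContinuousMap.tendsto_of_antitone_of_pointwise h1 fun x => ?_
    by_cases hx : x ∈ Ω
    · have h3 : ∀ n, f n x = 0 := fun n => by
        change ‖coord b x‖ * _ = 0
        rw [h.zero b hb x hx, norm_zero, zero_mul]
      simp only [h3]
      exact tendsto_const_nhds
    · have h3 : Tendsto (fun n : ℕ => (k x) ^ ((1 : ℝ) / (n + 1))) atTop (𝓝 1) := by
        have h4 := (Real.continuousAt_const_rpow (a := k x) (b := 0)
          fun h0 => hx ((hk x).2.2.mp h0)).tendsto.comp
          (tendsto_one_div_add_atTop_nhds_zero_nat (𝕜 := ℝ))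
        rwa [Real.rpow_zero] at h4
      have h5 := (tendsto_const_nhds (x := ‖coord b x‖)).mul ((tendsto_const_nhds (x := (1:ℝ))).sub h3)
      rw [sub_self, mul_zero] at h5
      exact h5
  rw [tendsto_iff_norm_sub_tendsto_zero]
  have h3 := tendsto_zero_iff_norm_tendsto_zero.mp h2
  refine squeeze_zero (fun _ => norm_nonneg _) (fun n => ?_) h3
  refine (h.norm_le (NonUnitalStarAlgHom.id ℂ S) (b := u n * b - b) (by
    rw [map_sub, map_mul, hu, hb, zero_mul, sub_zero])).trans ?_
  refine (ContinuousMap.norm_le _ (norm_nonneg _)).mpr fun x => ?_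
  refine le_trans ?_ ((f n).norm_coe_le_norm x)
  rw [Real.norm_of_nonneg (hf0 n x), coord_sub, coord_mul, hu', smul_mul_assoc, one_mul]
  have h4 : ((((k x) ^ ((1 : ℝ) / (n + 1)) : ℝ) : ℂ) • coord b x - coord b x) =
      ((((k x) ^ ((1 : ℝ) / (n + 1)) - 1 : ℝ)) : ℂ) • coord b x := by
    rw [Complex.ofReal_sub, sub_smul, Complex.ofReal_one, one_smul]
  rw [h4, norm_smul, Complex.norm_real, norm_sub_rev,
    Real.norm_of_nonneg (sub_nonneg.mpr (Real.rpow_le_one (hk x).1 (hk x).2.1 (hpos n).le)), mul_comm]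
  rfl

section Bar

variable {u : ℕ → S} (hu : ∀ n, down (u n) = 0) {k : C(X, ℝ)}
    (hk : ∀ x, 0 ≤ k x ∧ k x ≤ 1 ∧ (k x = 0 ↔ x ∈ Ω))
    (hu' : ∀ n x, coord (u n) x = (((k x) ^ ((1 : ℝ) / (n + 1)) : ℝ) : ℂ) • 1)

include hu hk hu'

omit h ht hu hu' in
theorem exists_rootFun (n : ℕ) : ∃ g : C(X, ℝ), (∀ x, g x = (k x) ^ ((1 : ℝ) / (n + 1))) ∧
    (∀ x ∈ Ω, g x = 0) ∧ (∀ x, 0 ≤ g x) ∧ ∀ x, g x ≤ 1 := by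
  have hpos : (0 : ℝ) < 1 / (n + 1) := by positivity
  refine ⟨⟨fun x => (k x) ^ ((1 : ℝ) / (n + 1)),
    k.continuous.rpow_const fun x => Or.inr hpos.le⟩, fun x => rfl, fun x hx => ?_, fun x => ?_,
    fun x => ?_⟩
  · change (k x) ^ ((1 : ℝ) / (n + 1)) = 0
    rw [(hk x).2.2.mpr hx, Real.zero_rpow hpos.ne']
  · exact Real.rpow_nonneg (hk x).1 _
  · exact Real.rpow_le_one (hk x).1 (hk x).2.1 hpos.le

/-- For positive b the sequence is increasing and bounded by t b; positive elements span S. -/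
theorem exists_tendsto_trace (b : S) : ∃ z, Tendsto (fun n => t (u n * b)) atTop (𝓝 z) := by
  let _ := CStarAlgebra.spectralOrder S
  have := CStarAlgebra.spectralOrderedRing S
  have hb : b ∈ Submodule.span ℂ {a : S | 0 ≤ a} := by rw [CStarAlgebra.span_nonneg]; trivial
  induction hb using Submodule.span_induction with
  | mem a ha =>
    obtain ⟨c, rfl⟩ := exists_eq_star_mul_self (show 0 ≤ a from ha)
    refine exists_tendsto_of_monotone (C := t (star c * c)) (fun n => ?_) fun n => ?_
    · obtain ⟨g, hg, hgΩ, hg0, hg1⟩ := exists_rootFun hk n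
      obtain ⟨g', hg', hgΩ', hg0', hg1'⟩ := exists_rootFun hk (n + 1)
      have h1 := h.nonneg_of_central ht (s := u (n + 1) - u n) (by
          rw [map_sub, hu, hu, sub_zero]) (g' - g) (fun x hx => by
          rw [ContinuousMap.sub_apply, hgΩ x hx, hgΩ' x hx, sub_zero]) (fun x => by
          rw [ContinuousMap.sub_apply, hg, hg', sub_nonneg]
          rcases (hk x).1.eq_or_lt with h0 | h0
          · rw [← h0, Real.zero_rpow (by positivity), Real.zero_rpow (by positivity)]
          · refine Real.rpow_le_rpow_of_exponent_ge h0 (hk x).2.1 ?_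
            exact one_div_le_one_div_of_le (by positivity) (by push_cast; linarith)) (fun x => by
          rw [coord_sub, hu', hu', ContinuousMap.sub_apply, hg, hg', Complex.ofReal_sub, sub_smul])
          c
      rwa [sub_mul, map_sub, sub_nonneg] at h1
    · obtain ⟨g, hg, hgΩ, hg0, hg1⟩ := exists_rootFun hk n
      have h1 := h.nonneg_of_one_sub_central ht (hu n) g hgΩ hg1 (fun x => by rw [hu', hg]) c
      rwa [sub_mul, one_mul, map_sub, sub_nonneg] at h1
  | zero => exact ⟨0, by simp⟩
  | add a b _ _ ha hb =>
    obtain ⟨z, hz⟩ := ha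
    obtain ⟨w, hw⟩ := hb
    exact ⟨z + w, by simpa only [mul_add, map_add] using hz.add hw⟩
  | smul c a _ ha =>
    obtain ⟨z, hz⟩ := ha
    exact ⟨c * z, by simpa only [mul_smul_comm, map_smul, smul_eq_mul] using hz.const_mul c⟩

/-- The part of a positive trace on a pullback which lives on the ideal, and the induced positive
trace on the quotient. -/
theorem exists_decomposition :
    ∃ (s : S →ₗ[ℂ] ℂ) (t' : T →ₗ[ℂ] ℂ),
      (∀ b, Tendsto (fun n => t (u n * b)) atTop (𝓝 (s b))) ∧ (∀ b, t' (down b) = t b - s b) ∧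
      0 ≤ s 1 ∧ IsPosTrace t' ∧
      ∀ b b' : S, (∀ x, (coord b x).tr = (coord b' x).tr) → s b = s b' := by
  choose z hz using h.exists_tendsto_trace ht hu hk hu'
  let s : S →ₗ[ℂ] ℂ :=
    { toFun := z
      map_add' := fun a b => tendsto_nhds_unique (hz (a + b))
        (by simpa only [mul_add, map_add] using (hz a).add (hz b))
      map_smul' := fun c a => tendsto_nhds_unique (hz (c • a))
        (by simpa only [mul_smul_comm, map_smul, smul_eq_mul, RingHom.id_apply] using (hz a).const_mul c) }
  have hs : ∀ b, Tendsto (fun n => t (u n * b)) atTop (𝓝 (s b)) := hz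
  -- The elements u n form an approximate unit of the ideal, so s and t agree there and t - s
  -- descends to the quotient.
  have hJ : ∀ b, down b = 0 → s b = t b := fun b hb => tendsto_nhds_unique (hs b)
    ((ht.continuous.tendsto b).comp (h.tendsto_mul_of_down_eq_zero hu hk hu' hb))
  have hsinv := fun a => Function.surjInv_eq h.surj a
  have hwd : ∀ a b, down a = down b → t a - s a = t b - s b := fun a b hab => by
    have h1 := hJ (a - b) (by rw [map_sub, hab, sub_self])
    rw [map_sub, map_sub] at h1
    linear_combination -h1
  let t' : T →ₗ[ℂ] ℂ :=
    { toFun := fun a => t (Function.surjInv h.surj a) - s (Function.surjInv h.surj a)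
      map_add' := fun a b => by
        rw [hwd _ (Function.surjInv h.surj a + Function.surjInv h.surj b)
          (by rw [map_add, hsinv, hsinv, hsinv]), map_add, map_add]
        ring
      map_smul' := fun c a => by
        rw [hwd _ (c • Function.surjInv h.surj a) (by rw [map_smul, hsinv, hsinv]), map_smul,
          map_smul, RingHom.id_apply, smul_sub] }
  have ht' : ∀ b, t' (down b) = t b - s b := fun b => hwd _ _ (hsinv _)
  refine ⟨s, t', hs, ht', ?_, ⟨fun a => ?_, fun a b => ?_⟩, fun b b' hbb => ?_⟩
  · refine ge_of_tendsto' (hs 1) fun n => ?_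
    obtain ⟨g, hg, hgΩ, hg0, hg1⟩ := exists_rootFun hk n
    have h1 := h.nonneg_of_central ht (hu n) g hgΩ hg0 (fun x => by rw [hu', hg]) 1
    rwa [star_one, one_mul] at h1
  · obtain ⟨c, rfl⟩ := h.surj a
    rw [← map_star, ← map_mul, ht', sub_nonneg]
    refine le_of_tendsto' (hs (star c * c)) fun n => ?_
    obtain ⟨g, hg, hgΩ, hg0, hg1⟩ := exists_rootFun hk n
    have h1 := h.nonneg_of_one_sub_central ht (hu n) g hgΩ hg1 (fun x => by rw [hu', hg]) c
    rwa [sub_mul, one_mul, map_sub, sub_nonneg] at h1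
  · obtain ⟨c, rfl⟩ := h.surj a
    obtain ⟨d, rfl⟩ := h.surj b
    rw [← map_mul, ← map_mul, ht', ht', ht.comm c d]
    congr 1
    -- The part s is tracial because each u n is central.
    refine tendsto_nhds_unique (hs (c * d)) ((hs (d * c)).congr fun n => ?_)
    rw [← mul_assoc, ht.comm, ← mul_assoc, ← mul_assoc]
    rw [h.central_comm (hu n) (hu' n) c]
  · refine tendsto_nhds_unique (hs b) ((hs b').congr fun n => ?_)
    obtain ⟨g, hg, hgΩ, hg0, hg1⟩ := exists_rootFun hk n
    exact (h.trace_eq_of_tr_eq ht (hu n) g hgΩ hg0 (fun x => by rw [hu', hg]) hbb).symm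

end Bar

end IsPullback

/-! ### Decomposition of tracial states along the stages -/

namespace RSHDecomposition

variable {B : Type*} [CStarAlgebra B] {R : ℕ} (D : RSHDecomposition B R)

theorem root_spec (l : Fin R) (n : ℕ) :
    D.down l (D.root l n) = 0 ∧ D.coord l (D.root l n) = D.rootFun l n :=
  (D.exists_root l n).choose_spec.1

theorem stageFun_last (τ : TracialState B) :
    D.stageFun τ (Fin.last R) = fun b => τ.toLin (D.equiv.symm b) :=
  Fin.reverseInduction_last ..

theorem stageFun_castSucc (τ : TracialState B) (l : Fin R) :
    D.stageFun τ l.castSucc = fun b =>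
      D.stageFun τ l.succ (Function.surjInv (D.down_surjective l) b)
        - D.barFun l (D.stageFun τ l.succ) (Function.surjInv (D.down_surjective l) b) :=
  Fin.reverseInduction_castSucc ..

/-- The decomposition of a positive trace on a stage. -/
theorem exists_barFun (l : Fin R) {t : D.stage l.succ →ₗ[ℂ] ℂ} (ht : IsPosTrace t) :
    ∃ (s : D.stage l.succ →ₗ[ℂ] ℂ) (t' : D.stage l.castSucc →ₗ[ℂ] ℂ),
      (∀ b, D.barFun l t b = s b) ∧ (∀ b, t' (D.down l b) = t b - s b) ∧
      0 ≤ s 1 ∧ IsPosTrace t' ∧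
      ∀ b b' : D.stage l.succ, (∀ x, (D.coord l b x).tr = (D.coord l b' x).tr) → s b = s b' := by
  obtain ⟨s, t', h1, h2, h3, h4, h5⟩ := (D.isPullback l).exists_decomposition ht (u := D.root l)
    (fun n => (D.root_spec l n).1) (k := D.h l) (D.h_spec l) (fun n x => by
      rw [(D.root_spec l n).2]; rfl)
  exact ⟨s, t', fun b => (h1 b).limUnder_eq, h2, h3, h4, h5⟩

/-- Descending from the last stage, the remainder after splitting off the part on X l ∖ Ω l is again
a positive trace, so the decomposition applies to it. -/
theorem exists_stageFun (τ : TracialState B) (j : Fin (R + 1)) :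
    ∃ t : D.stage j →ₗ[ℂ] ℂ, IsPosTrace t ∧ D.stageFun τ j = t := by
  induction j using Fin.reverseInduction with
  | last =>
    refine ⟨τ.toLin ∘ₗ (D.equiv.symm : D.stage (Fin.last R) →⋆ₐ[ℂ] B).toAlgHom.toLinearMap,
      ⟨fun a => ?_, fun a b => ?_⟩, ?_⟩
    · change 0 ≤ τ.toLin (D.equiv.symm (star a * a))
      rw [map_mul, map_star]
      exact τ.nonneg _
    · change τ.toLin (D.equiv.symm (a * b)) = τ.toLin (D.equiv.symm (b * a))
      rw [map_mul D.equiv.symm, map_mul D.equiv.symm]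
      exact τ.comm _ _
    · rw [stageFun_last]; rfl
  | cast l ih =>
    obtain ⟨t, ht, hτ⟩ := ih
    obtain ⟨s, t', h1, h2, -, h4, -⟩ := D.exists_barFun l ht
    refine ⟨t', h4, ?_⟩
    rw [stageFun_castSucc, hτ]
    funext b
    rw [h1, ← h2, Function.surjInv_eq (D.down_surjective l)]

/-- A tracial state is the sum of traces living on the sets `X l ∖ Ω l`, whose norms are the
weights. -/
theorem exists_sum_eq (τ : TracialState B) :
    ∃ s : ∀ l : Fin R, D.stage l.succ →ₗ[ℂ] ℂ, (∀ b, τ.toLin b = ∑ l, s l (D.ψ l.succ b)) ∧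
      (∀ l, D.weight τ l = s l 1) ∧ (∀ l, 0 ≤ s l 1) ∧
      ∀ (l) (b b' : D.stage l.succ), (∀ x, (D.coord l b x).tr = (D.coord l b' x).tr) →
        s l b = s l b' := by
  choose t ht hτ using D.exists_stageFun τ
  choose s t' h1 h2 h3 h4 h5 using fun l => D.exists_barFun l (ht l.succ)
  have h6 : ∀ l b, s l b = D.stageFun τ l.succ b - D.stageFun τ l.castSucc (D.down l b) := by
    intro l b
    have h7 : D.stageFun τ l.castSucc (D.down l b) = t' l (D.down l b) := by
      rw [stageFun_castSucc, hτ]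
      change t l.succ _ - D.barFun l (t l.succ) _ = _
      rw [h1, ← h2, Function.surjInv_eq (D.down_surjective l)]
    rw [h7, h2, hτ]
    ring
  refine ⟨s, fun b => ?_, fun l => ?_, h3, h5⟩
  · have h7 : ∀ l, s l (D.ψ l.succ b) =
        D.stageFun τ l.succ (D.ψ l.succ b) - D.stageFun τ l.castSucc (D.ψ l.castSucc b) := by
      intro l
      rw [h6, ψ_castSucc]
      rfl
    -- The parts s l are successive differences of the stage functionals and telescope to τ; nothing
    -- is left at the stage 0, the zero algebra.
    have h8 : ∀ (n : ℕ) (f : Fin (n + 1) → ℂ), ∑ l : Fin n, (f l.succ - f l.castSucc) =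
        f (Fin.last n) - f 0 := fun n f => by
      have h9 := Fin.sum_univ_succ f
      rw [Fin.sum_univ_castSucc] at h9
      rw [Finset.sum_sub_distrib]
      linear_combination -h9
    simp only [h7]
    rw [h8 R fun j => D.stageFun τ j (D.ψ j b), stageFun_last, ψ_last, hτ 0]
    have := D.stage_zero
    rw [Subsingleton.elim (D.ψ 0 b) 0, map_zero, sub_zero]
    change _ = τ.toLin (D.equiv.symm (D.equiv b))
    rw [StarAlgEquiv.symm_apply_apply]
  · rw [h6, weight]
    congr 2
    exact (map_one (D.down l)).symm

theorem weight_nonneg (τ : TracialState B) (l : Fin R) : 0 ≤ D.weight τ l := by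
  obtain ⟨s, -, h2, h3, -⟩ := D.exists_sum_eq τ
  rw [h2]
  exact h3 l

/-- The part s l cannot distinguish b from the scalar d l, which has the same pointwise traces over
X l, and s l 1 is the weight. -/
theorem toLin_eq_sum_weight (τ : TracialState B) {b : B} {d : Fin R → ℂ}
    (hb : ∀ l (x : D.X l), (D.evalAt l x b).tr = d l * D.r l) :
    τ.toLin b = ∑ l, d l * D.weight τ l := by
  obtain ⟨s, h1, h2, -, h4⟩ := D.exists_sum_eq τ
  rw [h1]
  refine Finset.sum_congr rfl fun l _ => ?_
  rw [h2, ← smul_eq_mul, ← map_smul]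
  refine h4 l _ _ fun x => ?_
  have h5 : D.coord l (d l • 1) x = d l • 1 := by
    have h6 := congrArg (fun f : C(D.X l, CMat (D.r l) ℂ) => f x)
      (map_smul (D.coord l) (d l) (1 : D.stage l.succ))
    refine h6.trans ?_
    change d l • D.coord l 1 x = _
    rw [IsPullback.coord_one]
  rw [h5, CStarMatrix.tr_smul, CStarMatrix.tr_one]
  exact hb l x

theorem sum_weight (τ : TracialState B) : ∑ l, D.weight τ l = 1 := by
  have h := D.toLin_eq_sum_weight τ (b := 1) (d := fun _ => 1) fun l x => by
    rw [one_mul, map_one, CStarMatrix.tr_one]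
  simpa [τ.map_one] using h.symm

/-- Tracial states which agree on `K₀` have the same pairing with projections. -/
theorem _root_.TracialState.toLin_trace_eq {τ τ' : TracialState B} (h : τ.kZero = τ'.kZero)
    (P : MatProj B) : τ.toLin P.mat.trace = τ'.toLin P.mat.trace := by
  have h1 : τ.onMvN = τ'.onMvN := Algebra.GrothendieckAddGroup.lift.injective h
  exact DFunLike.congr_fun h1 (show MvNMonoid B from Quotient.mk _ P)

end RSHDecomposition

/-! ### Rational approximation of weights -/

section Approximation

variable {ι : Type*} [Fintype ι]

theorem Rat.exists_common_denominator {κ : Type*} [Fintype κ] (q : κ → ℚ) :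
    ∃ D : ℕ, 0 < D ∧ ∀ k, ∃ z : ℤ, D * q k = z := by
  refine ⟨∏ k, (q k).den, Finset.prod_pos fun k _ => (q k).den_pos, fun k => ?_⟩
  obtain ⟨c, hc⟩ := Finset.dvd_prod_of_mem (fun k => (q k).den) (Finset.mem_univ k)
  refine ⟨c * (q k).num, ?_⟩
  rw [hc]
  push_cast
  rw [mul_comm ((q k).den : ℚ), mul_assoc, Rat.den_mul_eq_num]

/-- The rational vectors with a multiple in a group of integer vectors. -/
def AddSubgroup.rationalSpan (H : AddSubgroup (ι → ℤ)) : Submodule ℚ (ι → ℚ) where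
  carrier := {v | ∃ M : ℕ, 0 < M ∧ ∃ u ∈ H, ∀ l, M * v l = u l}
  zero_mem' := ⟨1, one_pos, 0, H.zero_mem, fun l => by simp⟩
  add_mem' := by
    rintro v v' ⟨M, hM, u, hu, h⟩ ⟨M', hM', u', hu', h'⟩
    refine ⟨M * M', Nat.mul_pos hM hM', M' • u + M • u',
      H.add_mem (H.nsmul_mem hu _) (H.nsmul_mem hu' _), fun l => ?_⟩
    rw [show (M' • u + M • u') l = M' * u l + M * u' l by simp]
    push_cast
    rw [Pi.add_apply, ← h, ← h']
    ring
  smul_mem' := by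
    rintro c v ⟨M, hM, u, hu, h⟩
    refine ⟨M * c.den, Nat.mul_pos hM c.den_pos, c.num • u, H.zsmul_mem hu _, fun l => ?_⟩
    simp only [Pi.smul_apply, smul_eq_mul]
    push_cast
    rw [← h, ← Rat.den_mul_eq_num]
    ring

theorem AddSubgroup.mem_rationalSpan {H : AddSubgroup (ι → ℤ)} {u : ι → ℤ} (hu : u ∈ H) :
    (fun l => (u l : ℚ)) ∈ H.rationalSpan :=
  ⟨1, one_pos, u, hu, fun l => by simp⟩

/-- A real vector which pairs to `0` with all natural vectors annihilating `H` is fixed by a rational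
projection onto the rational span of `H`. -/
theorem exists_rational_projection (H : AddSubgroup (ι → ℤ)) (hsum : ∀ v ∈ H, ∑ l, v l = 0)
    {z : ι → ℝ} (hz1 : ∑ l, z l = 0)
    (hz : ∀ d : ι → ℕ, (∀ v ∈ H, ∑ l, v l * (d l : ℤ) = 0) → ∑ l, d l * z l = 0) :
    ∃ P : ι → ι → ℚ, (∀ w : ι → ℚ, (fun l => ∑ m, P l m * w m) ∈ H.rationalSpan) ∧
      ∀ l, ∑ m, P l m * z m = z l := by
  classical
  obtain ⟨g, hg⟩ := LinearMap.exists_leftInverse_of_injective H.rationalSpan.subtype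
    H.rationalSpan.ker_subtype
  let P : ι → ι → ℚ := fun l m => (g (Pi.single m 1) : ι → ℚ) l
  have hP : ∀ (w : ι → ℚ) l, ∑ m, P l m * w m = (g w : ι → ℚ) l := fun w l => by
    have h1 : w = ∑ m, w m • (Pi.single m 1 : ι → ℚ) := pi_eq_sum_univ' w
    conv_rhs => rw [h1, map_sum]
    simp only [map_smul]
    rw [Submodule.coe_sum, Finset.sum_apply]
    exact Finset.sum_congr rfl fun m _ => by
      rw [Submodule.coe_smul, Pi.smul_apply, smul_eq_mul, mul_comm]
  refine ⟨P, fun w => ?_, fun l => ?_⟩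
  · simp only [hP]
    exact (g w).2
  -- The l-th row of 1 - P is a rational functional which annihilates H. Clearing denominators makes
  -- it integral, and adding the constant s makes it natural; the constant changes no pairing with H
  -- or z, whose coordinate sums are 0. Hence this row annihilates z.
  · obtain ⟨D, hD, hDz⟩ := Rat.exists_common_denominator
      fun m => (if m = l then 1 else 0) - P l m
    choose c hc using hDz
    let s : ℕ := ∑ m, (c m).natAbs
    have hs : ∀ m, 0 ≤ c m + s := fun m => by
      have h1 : (c m).natAbs ≤ s :=
        Finset.single_le_sum (f := fun m => (c m).natAbs) (fun _ _ => Nat.zero_le _)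
          (Finset.mem_univ m)
      omega
    have hd : ∀ m, ((c m + s).toNat : ℤ) = c m + s := fun m => Int.toNat_of_nonneg (hs m)
    have h1 := hz (fun m => (c m + s).toNat) fun v hv => by
      simp only [hd, mul_add, Finset.sum_add_distrib, ← Finset.sum_mul, hsum v hv, zero_mul,
        add_zero]
      have h2 : ((∑ m, v m * c m : ℤ) : ℚ) = 0 := by
        push_cast
        simp only [← hc]
        have h3 : ∑ m, P l m * v m = v l := by
          rw [hP]
          exact congrFun (congrArg Subtype.val (LinearMap.congr_fun hg
            ⟨_, AddSubgroup.mem_rationalSpan hv⟩)) l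
        calc ∑ m, (v m : ℚ) * (D * ((if m = l then 1 else 0) - P l m))
            = D * (∑ m, (if m = l then (v m : ℚ) else 0) - ∑ m, P l m * v m) := by
              rw [← Finset.sum_sub_distrib, Finset.mul_sum]
              refine Finset.sum_congr rfl fun m _ => ?_
              split_ifs <;> ring
          _ = 0 := by rw [h3]; simp
      exact_mod_cast h2
    have h4 : ∀ m, (((c m + s).toNat : ℕ) : ℝ) =
        D * ((if m = l then 1 else 0) - (P l m : ℝ)) + s := fun m => by
      have h5 : (((c m + s).toNat : ℕ) : ℝ) = c m + s := by
        rw [← Int.cast_natCast, hd m, Int.cast_add, Int.cast_natCast]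
      have h6 : ((D * ((if m = l then 1 else 0) - P l m) : ℚ) : ℝ) = ((c m : ℚ) : ℝ) := by rw [hc m]
      push_cast at h6
      rw [h5, ← h6]
      split_ifs <;> simp
    simp only [h4] at h1
    have h7 : ∑ m, ((D : ℝ) * ((if m = l then 1 else 0) - (P l m : ℝ)) + s) * z m =
        D * (∑ m, (if m = l then z m else 0) - ∑ m, P l m * z m) + s * ∑ m, z m := by
      rw [← Finset.sum_sub_distrib, Finset.mul_sum, Finset.mul_sum, ← Finset.sum_add_distrib]
      refine Finset.sum_congr rfl fun m _ => ?_
      split_ifs <;> ring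
    rw [h7, hz1, mul_zero, add_zero] at h1
    have h8 := (mul_eq_zero.mp h1).resolve_left (Nat.cast_ne_zero.mpr hD.ne')
    simp only [Finset.sum_ite_eq', Finset.mem_univ, if_true] at h8
    linarith

/-- Approximation of two vectors of weights by rational vectors with difference in the rational span
of `H`. -/
theorem exists_rational_weights [Nonempty ι] (H : AddSubgroup (ι → ℤ))
    (hsum : ∀ v ∈ H, ∑ l, v l = 0) {y y' : ι → ℝ} (hy0 : ∀ l, 0 ≤ y l) (hy0' : ∀ l, 0 ≤ y' l)
    (hy1 : ∑ l, y l = 1) (hy1' : ∑ l, y' l = 1)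
    (hyy : ∀ d : ι → ℕ, (∀ v ∈ H, ∑ l, v l * (d l : ℤ) = 0) →
      ∑ l, d l * y l = ∑ l, d l * y' l) {β : ℝ} (hβ : 0 < β) (hβ1 : β ≤ 1) :
    ∃ a a' : ι → ℚ, (∀ l, 0 < a l) ∧ (∀ l, 0 < a' l) ∧ ∑ l, a l = 1 ∧ ∑ l, a' l = 1 ∧
      (∀ l, |(a l : ℝ) - y l| < β) ∧ (∀ l, |(a' l : ℝ) - y' l| < β) ∧ a - a' ∈ H.rationalSpan := by
  obtain ⟨P, hP, hPz⟩ := exists_rational_projection H hsum (z := y - y')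
    (by simp [Finset.sum_sub_distrib, hy1, hy1']) fun d hd => by
      simp only [Pi.sub_apply, mul_sub, Finset.sum_sub_distrib, hyy d hd, sub_self]
  obtain ⟨n, hn⟩ : ∃ n : ℝ, n = Fintype.card ι := ⟨_, rfl⟩
  have hn0 : 1 ≤ n := by
    rw [hn]; exact_mod_cast Fintype.card_pos
  -- Moving slightly towards the uniform distribution makes all weights positive, at a cost of at
  -- most β / 2. Differences are only rescaled, so P still fixes them.
  let p : (ι → ℝ) → ι → ℝ := fun x l => (1 - β / 2) * x l + β / 2 * n⁻¹
  have hp0 : ∀ x : ι → ℝ, (∀ l, 0 ≤ x l) → ∀ l, 0 < p x l := fun x hx l => by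
    have h1 : 0 ≤ (1 - β / 2) * x l := mul_nonneg (by linarith) (hx l)
    have h2 : 0 < β / 2 * n⁻¹ := by positivity
    exact add_pos_of_nonneg_of_pos h1 h2
  have hp1 : ∀ x : ι → ℝ, ∑ l, x l = 1 → ∑ l, p x l = 1 := fun x hx => by
    have h1 : n * n⁻¹ = 1 := mul_inv_cancel₀ (by linarith)
    simp only [p, Finset.sum_add_distrib, ← Finset.mul_sum, hx, Finset.sum_const,
      Finset.card_univ, nsmul_eq_mul]
    rw [← hn]
    linear_combination (β / 2) * h1
  have hpβ : ∀ x : ι → ℝ, (∀ l, 0 ≤ x l) → ∑ l, x l = 1 → ∀ l, |p x l - x l| < β := by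
    intro x hx hx1 l
    have h1 : x l ≤ 1 := by
      rw [← hx1]; exact Finset.single_le_sum (fun m _ => hx m) (Finset.mem_univ l)
    have h2 : n⁻¹ ≤ 1 := inv_le_one_of_one_le₀ hn0
    have h3 : 0 < n⁻¹ := by positivity
    have h4 : p x l - x l = β / 2 * (n⁻¹ - x l) := by simp only [p]; ring
    rw [h4, abs_mul, abs_of_pos (by linarith : 0 < β / 2)]
    have h5 : |n⁻¹ - x l| ≤ 1 := abs_le.mpr ⟨by linarith [hx l], by linarith [hx l]⟩
    nlinarith
  have hPp : ∀ l, ∑ m, P l m * (p y - p y') m = p y l - p y' l := fun l => by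
    have h1 : ∀ m, (P l m : ℝ) * (p y - p y') m = (1 - β / 2) * (P l m * (y - y') m) := fun m => by
      simp only [Pi.sub_apply, p]; ring
    simp only [h1]
    rw [← Finset.mul_sum, hPz]
    simp only [Pi.sub_apply, p]; ring
  -- For a pair (b, w) these are the normalisations of b and of b + P w. Their difference is a
  -- multiple of P w, hence in the rational span for rational b and w. At x₀ they equal p y' and p
  -- y, so by continuity rational pairs close to x₀ give admissible weights.
  let A : (ι → ℝ) × (ι → ℝ) → ι → ℝ := fun x l => x.1 l / ∑ m, x.1 m
  let A' : (ι → ℝ) × (ι → ℝ) → ι → ℝ := fun x l =>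
    (x.1 l + ∑ m, P l m * x.2 m) / ∑ m, x.1 m
  let x₀ : (ι → ℝ) × (ι → ℝ) := (p y', p y - p y')
  have hx₀ : ∑ m, x₀.1 m = 1 := hp1 y' hy1'
  have hA : ∀ l, ContinuousAt (fun x => A x l) x₀ := fun l =>
    ContinuousAt.div (by fun_prop) (by fun_prop) (by rw [hx₀]; exact one_ne_zero)
  have hA' : ∀ l, ContinuousAt (fun x => A' x l) x₀ := fun l =>
    ContinuousAt.div (by fun_prop) (by fun_prop) (by rw [hx₀]; exact one_ne_zero)
  have hAx : ∀ l, A x₀ l = p y' l := fun l => by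
    change p y' l / ∑ m, x₀.1 m = _
    rw [hx₀, div_one]
  have hAx' : ∀ l, A' x₀ l = p y l := fun l => by
    change (p y' l + ∑ m, P l m * (p y - p y') m) / ∑ m, x₀.1 m = _
    rw [hx₀, div_one, hPp]
    ring
  have hev : ∀ᶠ x in 𝓝 x₀, (0 < ∑ m, x.1 m) ∧ ∀ l, 0 < A x l ∧ 0 < A' x l ∧ |A x l - y' l| < β ∧
      |A' x l - y l| < β := by
    refine (Filter.Tendsto.eventually_const_lt (u := 0) (v := ∑ m, x₀.1 m)
      (by rw [hx₀]; exact one_pos) (Continuous.tendsto (by fun_prop) x₀)).and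
      (Filter.eventually_all.mpr fun l => ?_)
    refine ((hA l).tendsto.eventually_const_lt ?_).and (((hA' l).tendsto.eventually_const_lt ?_).and
      ((((hA l).sub continuousAt_const).abs.tendsto.eventually_lt_const ?_).and
        (((hA' l).sub continuousAt_const).abs.tendsto.eventually_lt_const ?_)))
    · rw [hAx]; exact hp0 _ hy0' l
    · rw [hAx']; exact hp0 _ hy0 l
    · change |A x₀ l - y' l| < β
      rw [hAx]; exact hpβ _ hy0' hy1' l
    · change |A' x₀ l - y l| < β
      rw [hAx']; exact hpβ _ hy0 hy1 l
  have hdense : DenseRange (Prod.map (fun (v : ι → ℚ) l => (v l : ℝ)) fun (v : ι → ℚ) l => (v l : ℝ)) := by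
    have h1 : DenseRange fun (v : ι → ℚ) l => (v l : ℝ) := DenseRange.piMap fun _ => Rat.denseRange_cast
    exact h1.prodMap h1
  obtain ⟨⟨b, w⟩, hb, hbw⟩ := hdense.exists_mem_open isOpen_interior
    ⟨x₀, mem_interior_iff_mem_nhds.mpr hev⟩ |>.imp fun x hx => interior_subset hx
  let q : ι → ℚ := fun l => ∑ m, P l m * w m
  have hA1 : ∀ l, A (Prod.map (fun (v : ι → ℚ) l => (v l : ℝ)) (fun (v : ι → ℚ) l => (v l : ℝ))
      (b, w)) l = ((b l / ∑ m, b m : ℚ) : ℝ) := fun l => by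
    change (b l : ℝ) / ∑ m, (b m : ℝ) = _
    push_cast; rfl
  have hA2 : ∀ l, A' (Prod.map (fun (v : ι → ℚ) l => (v l : ℝ)) (fun (v : ι → ℚ) l => (v l : ℝ))
      (b, w)) l = (((b l + q l) / ∑ m, b m : ℚ) : ℝ) := fun l => by
    change ((b l : ℝ) + ∑ m, P l m * (w m : ℝ)) / ∑ m, (b m : ℝ) = _
    simp only [q]
    push_cast; rfl
  have hs0 : 0 < ∑ m, b m := by
    have h1 : 0 < ∑ m, (b m : ℝ) := hb
    exact_mod_cast h1
  -- Both vectors are normalised by the same number, as a multiple of q lies in H and thus has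
  -- coordinate sum 0.
  have hq0 : ∑ l, q l = 0 := by
    obtain ⟨M, hM, u, hu, h⟩ := hP w
    have h1 : (M : ℚ) * ∑ l, q l = 0 := by
      rw [Finset.mul_sum]
      have h2 : ∑ l, (u l : ℚ) = 0 := by exact_mod_cast hsum u hu
      rw [← h2]
      exact Finset.sum_congr rfl fun l _ => h l
    exact (mul_eq_zero.mp h1).resolve_left (Nat.cast_ne_zero.mpr hM.ne')
  refine ⟨fun l => (b l + q l) / ∑ m, b m, fun l => b l / ∑ m, b m, fun l => ?_, fun l => ?_, ?_,
    ?_, fun l => ?_, fun l => ?_, ?_⟩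
  · have h1 := (hbw l).2.1
    rw [hA2] at h1
    exact_mod_cast h1
  · have h1 := (hbw l).1
    rw [hA1] at h1
    exact_mod_cast h1
  · rw [← Finset.sum_div, Finset.sum_add_distrib, hq0, add_zero, div_self hs0.ne']
  · rw [← Finset.sum_div, div_self hs0.ne']
  · have h1 := (hbw l).2.2.2
    rwa [hA2] at h1
  · have h1 := (hbw l).2.2.1
    rwa [hA1] at h1
  · have h1 := H.rationalSpan.smul_mem (∑ m, b m)⁻¹ (hP w)
    convert h1 using 1
    funext l
    simp only [Pi.sub_apply, Pi.smul_apply, smul_eq_mul, q]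
    ring

/-- Approximation of two vectors of weights by the frequencies of natural vectors with difference in
`H`. -/
theorem exists_natural_weights [Nonempty ι] (H : AddSubgroup (ι → ℤ))
    (hsum : ∀ v ∈ H, ∑ l, v l = 0) {y y' : ι → ℝ} (hy0 : ∀ l, 0 ≤ y l) (hy0' : ∀ l, 0 ≤ y' l)
    (hy1 : ∑ l, y l = 1) (hy1' : ∑ l, y' l = 1)
    (hyy : ∀ d : ι → ℕ, (∀ v ∈ H, ∑ l, v l * (d l : ℤ) = 0) →
      ∑ l, d l * y l = ∑ l, d l * y' l) {β : ℝ} (hβ : 0 < β) (hβ1 : β ≤ 1) :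
    ∃ (N : ℕ) (k k' : ι → ℕ), 0 < N ∧ (∀ l, 0 < k l) ∧ (∀ l, 0 < k' l) ∧ ∑ l, k l = N ∧
      ∑ l, k' l = N ∧ (∀ l, |(k l : ℝ) / N - y l| < β) ∧ (∀ l, |(k' l : ℝ) / N - y' l| < β) ∧
      (fun l => (k l : ℤ) - k' l) ∈ H := by
  obtain ⟨a, a', ha, ha', ha1, ha1', haβ, haβ', M, hM, u, hu, hMu⟩ :=
    exists_rational_weights H hsum hy0 hy0' hy1 hy1' hyy hβ hβ1
  obtain ⟨D, hD, hDa⟩ := Rat.exists_common_denominator (Sum.elim a a')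
  have hN : 0 < D * M := Nat.mul_pos hD hM
  -- The factor D clears the denominators of the weights, and M is the factor which carries their
  -- difference into H. The product D M serves both purposes.
  have hnat : ∀ x : ℚ, 0 < x → (∃ z : ℤ, D * x = z) →
      ∃ k : ℕ, (k : ℚ) = (D * M : ℕ) * x ∧ 0 < k := fun x hx hz => by
    obtain ⟨z, hz⟩ := hz
    have hz0 : 0 < z := by
      have h1 : (0 : ℚ) < z := by
        rw [← hz]; exact mul_pos (Nat.cast_pos.mpr hD) hx
      exact_mod_cast h1
    refine ⟨M * z.toNat, ?_, Nat.mul_pos hM (by omega)⟩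
    have h2 : ((z.toNat : ℕ) : ℚ) = z := by
      rw [← Int.cast_natCast, Int.toNat_of_nonneg hz0.le]
    rw [Nat.cast_mul, h2, ← hz]
    push_cast
    ring
  choose k hk hk0 using fun l => hnat (a l) (ha l) (hDa (Sum.inl l))
  choose k' hk' hk0' using fun l => hnat (a' l) (ha' l) (hDa (Sum.inr l))
  have hN' : ((D * M : ℕ) : ℚ) ≠ 0 := Nat.cast_ne_zero.mpr hN.ne'
  have hdiv : ∀ (j : ℕ) (x : ℚ), (j : ℚ) = (D * M : ℕ) * x → (j : ℝ) / (D * M : ℕ) = x := by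
    intro j x h
    have h1 : (x : ℚ) = j / (D * M : ℕ) := by rw [h, mul_div_cancel_left₀ _ hN']
    rw [h1]
    push_cast; rfl
  refine ⟨D * M, k, k', hN, hk0, hk0', ?_, ?_, fun l => ?_, fun l => ?_, ?_⟩
  · have h1 : ((∑ l, k l : ℕ) : ℚ) = (D * M : ℕ) := by
      rw [Nat.cast_sum]
      simp only [hk]
      rw [← Finset.mul_sum, ha1, mul_one]
    exact_mod_cast h1
  · have h1 : ((∑ l, k' l : ℕ) : ℚ) = (D * M : ℕ) := by
      rw [Nat.cast_sum]
      simp only [hk']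
      rw [← Finset.mul_sum, ha1', mul_one]
    exact_mod_cast h1
  · rw [hdiv _ _ (hk l)]; exact haβ l
  · rw [hdiv _ _ (hk' l)]; exact haβ' l
  · have h1 : (fun l => (k l : ℤ) - k' l) = D • u := by
      funext l
      have h2 : (((k l : ℤ) - k' l : ℤ) : ℚ) = ((D * u l : ℤ) : ℚ) := by
        push_cast
        rw [hk, hk', ← hMu l, Pi.sub_apply]
        push_cast
        ring
      simpa using (Int.cast_injective h2)
    rw [h1]
    exact H.nsmul_mem hu D

end Approximation

/-! ### The bridge -/

namespace UniversalUHF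

section WordEmbedding

variable {m n : ℕ} [NeZero m]

/-- The unital homomorphism `⨁ 𝒬 → 𝒬` which repeats the summands according to a word. -/
noncomputable def wordEmbedding (f : Fin m → Fin n) : (Fin n → UniversalUHF) →⋆ₐ[ℂ] UniversalUHF :=
  diagHom m fun s => Pi.evalStarAlgHom ℂ (fun _ => UniversalUHF) (f s)

theorem wordEmbedding_injective {f : Fin m → Fin n} (hf : Function.Surjective f) :
    Function.Injective (wordEmbedding f) := fun x y h => by
  funext l
  obtain ⟨s, rfl⟩ := hf l
  exact congrFun (diag_injective m h) s

theorem trace_wordEmbedding (f : Fin m → Fin n) (l : Fin n) :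
    (wordEmbedding f (Pi.single l 1)).trace = (letterCount f l : ℂ) / m := by
  have h : wordEmbedding f (Pi.single l 1) = diag m fun s => if f s = l then 1 else 0 := by
    refine congrArg (diag m) (funext fun s => ?_)
    change (Pi.single l 1 : Fin n → UniversalUHF) (f s) = _
    rw [Pi.single_apply]
  rw [h]
  exact trace_diag_indicator m fun s => f s = l

/-- The unital homomorphism `𝒬 ⊕ 𝒬 → 𝒬` which repeats the summands `a` and `b` times. -/
noncomputable def pairEmbedding (a b : ℕ) [NeZero (a + b)] :
    (UniversalUHF × UniversalUHF) →⋆ₐ[ℂ] UniversalUHF :=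
  diagHom (a + b) (Fin.append (fun _ : Fin a => StarAlgHom.fst ℂ UniversalUHF UniversalUHF)
    fun _ : Fin b => StarAlgHom.snd ℂ UniversalUHF UniversalUHF)

theorem pairEmbedding_injective (a b : ℕ) [NeZero a] [NeZero b] [NeZero (a + b)] :
    Function.Injective (pairEmbedding a b) := fun x y h => by
  have h1 := diag_injective (a + b) h
  refine Prod.ext ?_ ?_
  · have h2 : Fin.append (fun _ : Fin a => StarAlgHom.fst ℂ UniversalUHF UniversalUHF)
        (fun _ : Fin b => StarAlgHom.snd ℂ UniversalUHF UniversalUHF) (Fin.castAdd b 0) x =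
        Fin.append (fun _ : Fin a => StarAlgHom.fst ℂ UniversalUHF UniversalUHF)
        (fun _ : Fin b => StarAlgHom.snd ℂ UniversalUHF UniversalUHF) (Fin.castAdd b 0) y :=
      congrFun h1 (Fin.castAdd b 0)
    rw [Fin.append_left] at h2
    exact h2
  · have h2 : Fin.append (fun _ : Fin a => StarAlgHom.fst ℂ UniversalUHF UniversalUHF)
        (fun _ : Fin b => StarAlgHom.snd ℂ UniversalUHF UniversalUHF) (Fin.natAdd a 0) x =
        Fin.append (fun _ : Fin a => StarAlgHom.fst ℂ UniversalUHF UniversalUHF)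
        (fun _ : Fin b => StarAlgHom.snd ℂ UniversalUHF UniversalUHF) (Fin.natAdd a 0) y :=
      congrFun h1 (Fin.natAdd a 0)
    rw [Fin.append_right] at h2
    exact h2

end WordEmbedding

end UniversalUHF

theorem surjective_of_letterCount_pos {m n : ℕ} {f : Fin m → Fin n} (h : ∀ l, 0 < letterCount f l) :
    Function.Surjective f := fun l => by
  obtain ⟨s, hs⟩ := Finset.card_pos.mp (h l)
  exact ⟨s, by simpa using hs⟩

/-! ### Words approximating the weights of the two traces -/

namespace RSHDecomposition

variable {B : Type*} [CStarAlgebra B] {R : ℕ} {D : RSHDecomposition B R} {F : Finset B} {η : ℝ}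

theorem WordBridge.sum_eq {n : ℕ} [NeZero n] {p : Fin n → D.GenericPoint} {k k' : Fin n → ℕ}
    (h : WordBridge F η p k k') : ∑ l, k l = ∑ l, k' l := by
  obtain ⟨m, hm, f, f', hf, hf', -⟩ := h
  simp only [← hf, ← hf', sum_letterCount]

/-- The differences of the letter counts of words connected by a bridge. -/
def wordBridgeSubgroup (hη : 0 < η) {n : ℕ} [NeZero n] (p : Fin n → D.GenericPoint)
    (F : Finset B) : AddSubgroup (Fin n → ℤ) where
  carrier := {v | ∃ k k', WordBridge F η p k k' ∧ ∀ l, v l = k l - k' l}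
  -- Words are nonempty, so the zero vector is represented as 1 - 1.
  zero_mem' := ⟨1, 1, .refl hη 1 one_ne_zero, fun l => by simp⟩
  add_mem' := by
    rintro v v' ⟨k, k', h, hv⟩ ⟨j, j', h', hv'⟩
    refine ⟨k + j, k' + j', h.add hη h', fun l => ?_⟩
    simp only [Pi.add_apply, hv, hv']
    push_cast
    ring
  neg_mem' := by
    rintro v ⟨k, k', h, hv⟩
    refine ⟨k', k, h.symm, fun l => ?_⟩
    rw [Pi.neg_apply, hv]
    ring

theorem weight_eq_ofReal (D : RSHDecomposition B R) (τ : TracialState B) (l : Fin R) :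
    D.weight τ l = ((D.weight τ l).re : ℂ) :=
  Complex.ext rfl (by simpa using (Complex.le_def.mp (D.weight_nonneg τ l)).2.symm)

theorem sum_re_weight (D : RSHDecomposition B R) (τ : TracialState B) :
    ∑ l, (D.weight τ l).re = 1 := by
  rw [← Complex.re_sum, D.sum_weight, Complex.one_re]

/-- Tracial states which agree on `K₀` have the same weights, up to relations between points. -/
theorem sum_mul_re_weight_eq [NeZero R] (hη : 0 < η) (hconn : D.IsConnected F η)
    (hlift : D.ProjectionsLift) {x : ∀ l, D.X l} (hx : ∀ l, x l ∉ D.Ω l) {τ τ' : TracialState B}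
    (hτ : τ.kZero = τ'.kZero) {d : Fin R → ℕ}
    (hd : ∀ v ∈ wordBridgeSubgroup hη (basePoint hx) F, ∑ l, v l * (d l : ℤ) = 0) :
    ∑ l, d l * (D.weight τ l).re = ∑ l, d l * (D.weight τ' l).re := by
  -- The matrix size only has to bound every d l; the sum is a convenient bound.
  obtain ⟨P, hP⟩ := exists_projection hη hconn hlift hx (d := d) (N := ∑ l, d l)
    (fun l => Finset.single_le_sum (fun _ _ => Nat.zero_le _) (Finset.mem_univ l))
    fun k k' h => by
      have h1 := hd (fun l => (k l : ℤ) - k' l) ⟨k, k', h, fun l => rfl⟩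
      simp only [sub_mul, Finset.sum_sub_distrib, sub_eq_zero] at h1
      exact_mod_cast h1
  have h1 : ∀ τ : TracialState B,
      τ.toLin P.mat.trace = ((∑ l, d l * (D.weight τ l).re : ℝ) : ℂ) := fun τ => by
    rw [D.toLin_eq_sum_weight τ (d := fun l => (d l : ℂ)) hP]
    push_cast
    exact Finset.sum_congr rfl fun l _ => congrArg _ (D.weight_eq_ofReal τ l)
  have h2 := TracialState.toLin_trace_eq hτ P
  rw [h1, h1] at h2
  exact Complex.ofReal_injective h2

/-- Words with bridges between their sums with a third word, the frequencies of the letters of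
which approximate the weights. -/
theorem exists_words [NeZero R] (hη : 0 < η) (hconn : D.IsConnected F η)
    (hlift : D.ProjectionsLift) {x : ∀ l, D.X l} (hx : ∀ l, x l ∉ D.Ω l)
    (τ : Fin 2 → TracialState B) (hτ : (τ 0).kZero = (τ 1).kZero) {β : ℝ} (hβ : 0 < β)
    (hβ1 : β ≤ 1) :
    ∃ (N M : ℕ) (_ : NeZero N) (_ : NeZero M) (f : Fin 2 → Fin N → Fin R) (g : Fin M → Fin R),
      (∀ i, Function.Surjective (f i)) ∧ Function.Surjective g ∧
      HomBridge D F η (wordHom (m := N + M) (basePoint hx) (Fin.append (f 0) g))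
        (wordHom (m := N + M) (basePoint hx) (Fin.append (f 1) g)) ∧
      ∀ i l, ‖(letterCount (f i) l : ℂ) / N - D.weight (τ i) l‖ < β := by
  obtain ⟨N, a, a', hN, ha, ha', haN, haN', haβ, haβ', k, k', hk, hkv⟩ :=
    exists_natural_weights (wordBridgeSubgroup hη (basePoint hx) F)
      (fun v hv => by
        obtain ⟨k, k', h, hv⟩ := hv
        simp only [hv, Finset.sum_sub_distrib, sub_eq_zero]
        exact_mod_cast h.sum_eq)
      (y := fun l => (D.weight (τ 0) l).re) (y' := fun l => (D.weight (τ 1) l).re)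
      (fun l => (Complex.le_def.mp (D.weight_nonneg (τ 0) l)).1)
      (fun l => (Complex.le_def.mp (D.weight_nonneg (τ 1) l)).1)
      (D.sum_re_weight _) (D.sum_re_weight _)
      (fun d hd => sum_mul_re_weight_eq hη hconn hlift hx hτ hd) hβ hβ1
  obtain ⟨f, hf⟩ := exists_word a haN
  obtain ⟨f', hf'⟩ := exists_word a' haN'
  -- The common word with which both words are completed. Adding k' makes the bridge between k and
  -- k' applicable; the extra 1 makes every letter occur, so that γ̃ is injective.
  obtain ⟨g, hg⟩ := exists_word (k' + 1) rfl
  have hM : (∑ l, (k' + 1) l : ℕ) ≠ 0 := by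
    have : 0 < ∑ l : Fin R, (k' + 1) l :=
      Finset.sum_pos (fun l _ => Nat.succ_pos _) Finset.univ_nonempty
    exact this.ne'
  -- The constant summand a' + 1 is nonzero, as reflexivity requires.
  have hbridge : WordBridge F η (basePoint hx) (k + (a' + 1)) (k' + (a' + 1)) :=
    hk.add hη (.refl hη _ fun h => by simpa using congrFun h 0)
  have hka : ∀ l, a l + k' l = a' l + k l := fun l => by
    have h1 : (a l : ℤ) - a' l = k l - k' l := hkv l
    omega
  refine ⟨N, _, ⟨hN.ne'⟩, ⟨hM⟩, ![f, f'], g, fun i => ?_, ?_, ?_, fun i l => ?_⟩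
  · refine surjective_of_letterCount_pos fun l => ?_
    fin_cases i
    · change 0 < letterCount f l
      rw [hf]; exact ha l
    · change 0 < letterCount f' l
      rw [hf']; exact ha' l
  · exact surjective_of_letterCount_pos fun l => by rw [hg]; exact Nat.succ_pos _
  · have : NeZero (N + ∑ l, (k' + 1) l) := ⟨by omega⟩
    refine WordBridge.homBridge hη hbridge (fun l => ?_) fun l => ?_
    · change letterCount (Fin.append f g) l = k l + (a' l + 1)
      rw [letterCount_append, hf, hg]
      change a l + (k' l + 1) = _
      have := hka l
      omega
    · change letterCount (Fin.append f' g) l = k' l + (a' l + 1)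
      rw [letterCount_append, hf', hg]
      change a' l + (k' l + 1) = _
      omega
  · have h1 : ∀ (z : ℕ) (w : ℂ), w = (w.re : ℂ) → |(z : ℝ) / N - w.re| < β →
        ‖(z : ℂ) / N - w‖ < β := fun z w hw h => by
      rw [hw]
      have h2 : (z : ℂ) / N - (w.re : ℂ) = (((z : ℝ) / N - w.re : ℝ) : ℂ) := by push_cast; rfl
      rw [h2, Complex.norm_real]
      exact h
    fin_cases i
    · change ‖(letterCount f l : ℂ) / N - D.weight (τ 0) l‖ < β
      rw [hf]
      exact h1 _ _ (D.weight_eq_ofReal _ l) (haβ l)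
    · change ‖(letterCount f' l : ℂ) / N - D.weight (τ 1) l‖ < β
      rw [hf']
      exact h1 _ _ (D.weight_eq_ofReal _ l) (haβ' l)

end RSHDecomposition

open RSHDecomposition in
theorem proposition6p1 {B : Type*} [CStarAlgebra B] {R : ℕ}
    (D : RSHDecomposition B R)
    (F : Finset B) (hF : ∀ b ∈ F, (∃ c : B, b = star c * c) ∧ ‖b‖ ≤ 1)
    (η : ℝ) (hη : 0 < η)
    (hconn : D.IsConnected F η) (hlift : D.ProjectionsLift)
    (hne : ∀ l, ((D.Ω l)ᶜ).Nonempty)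
    (τ : Fin 2 → TracialState B) (hτ : (τ 0).kZero = (τ 1).kZero)
    (β : ℝ) (hβ : 0 < β) (hβ1 : β ≤ 1) :
    ∃ (x : ∀ l, D.X l) (V : Fin R → ExcisorData D)
      (γ : Fin 2 → ((Fin R → UniversalUHF) →⋆ₐ[ℂ] UniversalUHF))
      (γt : (Fin R → UniversalUHF) →⋆ₐ[ℂ] UniversalUHF)
      (γb : (UniversalUHF × UniversalUHF) →⋆ₐ[ℂ] UniversalUHF),
      (∀ l, x l ∉ D.Ω l) ∧
      (∀ l, (V l).IsWeightedExcisor F η ∧ (V l).IsPoint l (x l)) ∧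
      ExcisorData.PairwiseOrthogonal V ∧
      (∀ i, Function.Injective (γ i)) ∧ Function.Injective γt ∧ Function.Injective γb ∧
      (∀ i, (ExcisorData.sum V (ExcisorData.sumκ V (γ i))).IsWeightedExcisor F η) ∧
      (ExcisorData.sum V (ExcisorData.sumκ V γt)).IsWeightedExcisor F η ∧
      ExcisorData.Bridge F η
        (ExcisorData.sum V
          (γb.comp ((ExcisorData.sumκ V (γ 0)).prod (ExcisorData.sumκ V γt))))
        (ExcisorData.sum V
          (γb.comp ((ExcisorData.sumκ V (γ 1)).prod (ExcisorData.sumκ V γt)))) ∧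
      ∀ (i : Fin 2) (l : Fin R),
        ‖(γ i (Pi.single l 1)).trace - D.weight (τ i) l‖ < β := by
  -- The weights of a tracial state add up to 1, which is impossible for an empty family.
  have hR : NeZero R := ⟨by
    rintro rfl
    have h1 := D.sum_weight (τ 0)
    simp at h1⟩
  choose x hx using hne
  choose σ hσ using fun l => ExcisorData.exists_ofPoint F hη (hx l)
  obtain ⟨N, M, hN, hM, f, g, hf, hg, hb, hw⟩ :=
    exists_words hη hconn hlift hx τ hτ hβ hβ1
  let W : Fin R → ExcisorData D := fun l =>
    ExcisorData.ofPoint D l (x l) (σ l) (UniversalUHF.ofMat (D.r l))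
  have hW : ∀ l, (W l).IsWeightedExcisor F η := fun l => hσ l _
  have hsum : ∀ κ, (ExcisorData.sum (fun l => (W l).toCorner R l) κ).IsWeightedExcisor F η :=
    fun κ => by
      have h := ExcisorData.IsWeightedExcisor.diagSum hη hW κ
      rw [← ExcisorData.sum_toCorner W κ] at h
      exact h
  -- The pairing embedding repeats the word f i as often as its length N, and g as often as its
  -- length M. This is the form in which `homBridge_append` relates the diagonal sum to the
  -- concatenated word.
  have htotal : ∀ i, (ExcisorData.sum (fun l => (W l).toCorner R l)
      ((UniversalUHF.pairEmbedding N M).comp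
        ((ExcisorData.sumκ (fun l => (W l).toCorner R l) (UniversalUHF.wordEmbedding (f i))).prod
          (ExcisorData.sumκ (fun l => (W l).toCorner R l) (UniversalUHF.wordEmbedding g))))).total =
      diagHom (N + M) (Fin.append (fun _ : Fin N => wordHom (basePoint hx) (f i))
        fun _ : Fin M => wordHom (basePoint hx) g) := fun i => by
    refine StarAlgHom.ext fun b => ?_
    refine congrArg (UniversalUHF.diag (N + M)) (funext fun s => ?_)
    change Fin.append (fun _ : Fin N => StarAlgHom.fst ℂ UniversalUHF UniversalUHF)
        (fun _ : Fin M => StarAlgHom.snd ℂ UniversalUHF UniversalUHF) s _ =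
      Fin.append (fun _ : Fin N => wordHom (basePoint hx) (f i))
        (fun _ : Fin M => wordHom (basePoint hx) g) s b
    refine Fin.addCases (fun s => ?_) (fun s => ?_) s
    · rw [Fin.append_left, Fin.append_left]; rfl
    · rw [Fin.append_right, Fin.append_right]; rfl
  refine ⟨x, fun l => (W l).toCorner R l, fun i => UniversalUHF.wordEmbedding (f i),
    UniversalUHF.wordEmbedding g, UniversalUHF.pairEmbedding N M, hx,
    fun l => ⟨(hW l).toCorner l, ExcisorData.isPoint_ofPoint (hx l) _ _⟩,
    ExcisorData.pairwiseOrthogonal_toCorner W,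
    fun i => UniversalUHF.wordEmbedding_injective (hf i),
    UniversalUHF.wordEmbedding_injective hg, UniversalUHF.pairEmbedding_injective N M,
    fun i => hsum _, hsum _, HomBridge.bridge (hsum _) (hsum _) ?_, fun i l => ?_⟩
  · rw [htotal, htotal]
    exact (homBridge_append hη (f 0) g).trans (hb.trans (homBridge_append hη (f 1) g).symm)
  · rw [UniversalUHF.trace_wordEmbedding]
    exact hw i l
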